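/- **Setting.** Let $(\Omega,\mathcal F)$ be a measurable space with a filtration $\mathbb F=(\mathcal F_t)_{t\ge 0}$, $\mathcal F_0=\{\emptyset,\Omega\}$, and let $S^1,\dots,S^d$ ($d\ge 1$) be real adapted processes all of whose trajectories are continuous. A *process* is an adapted map $[0,\infty)\times\Omega\to[-\infty,\infty]$ (a *real process* if real-valued); a *generalized process* is any such map, adapted or not. A *simple trading strategy* $(c,(\tau_n),(g_n))$ consists of $c\in\mathbb R$, stopping times $0=\tau_0\le\tau_1\le\cdots\le\infty$ which for every $\omega$ diverge to $\infty$ or are eventually constant, and bounded $\mathcal F_{\tau_n}$-measurable $g_n:\Omega\to\mathbb R$ with $g_n=0$ on $\{\tau_n=\infty\}$. Its step process is $\sum_{n\ge1} g_{n-1}\mathbf 1_{[\tau_{n-1},\tau_n)}$ and its simple integral is $(G\cdot X)_t=c+\sum_{n\ge1}g_{n-1}(X_{\tau_n\wedge t}-X_{\tau_{n-1}\wedge t})$. *Simple capital processes* are the sums $\sum_{j=1}^d G^j\cdot S^j$ with simple trading strategies $G^j$. The class $\mathcal C$ of *nonnegative supermartingales* is the smallest class of $[0,\infty]$-valued maps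 that contains the nonnegative simple capital processes, contains $V+K$ whenever $V\in\mathcal C$, $K$ is a simple capital process and $V+K\ge0$, and is closed under pointwise $\liminf$ of sequences. A set $E\subseteq[0,\infty)\times\Omega$ holds *with instant enforcement* (w.i.e.) if some $V\in\mathcal C$ has $V_0=1$ and $V_t(\omega)=\infty$ for all $(t,\omega)\notin E$; the complement of $E$ is then *instantly blockable*. Assume that for every $t\ge 0$ and every instantly blockable $B$ the projection of $B\cap([0,t]\times\Omega)$ on $\Omega$ lies in $\mathcal F_t$. For generalized processes, $Y^n\to Y$ *locally uniformly w.i.e.* if $\sup_{s\le t}|Y_s-Y^n_s|\to0$ w.i.e. (as a property of $(t,\omega)$). The class of *martingales* is the smallest class of processes, real w.i.e., that contains all simple capital processes and contains every process, real w.i.e., that is the locally uniform limit w.i.e. of a sequence from the class. Infinite values of martingales are read as $0$ inside simple integrals and inside the sums $[X]^\tau$ below. For a generalized process $Y\ge0$ put $\overline{\mathbb E}\,Y=\inf\{V_0: V\in\mathcal C,\ V\ge Y \text{ everywhere}\}$. *Quadratic variation.* A nondecreasing sequence $\tau=(\tau_n)$ of stopping times with $\tau_0=0$ is a *fine cover*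 of $X$ with accuracy $\delta>0$ w.i.e. if, for all $(t,\omega)$ in some set that holds w.i.e., only finitely many $\tau_n(\omega)$ are $\le t$, and the oscillation ($\sup-\inf$) of $s\mapsto X_s(\omega)$ on each $[\tau_n(\omega)\wedge t,\tau_{n+1}(\omega)\wedge t]$ is at most $\delta$. With $[X]^\tau_t=\sum_{n\ge1}(X_{\tau_n\wedge t}-X_{\tau_{n-1}\wedge t})^2$, a (version of the) quadratic variation $[X]$ is a real process, continuous on $[0,t]$ w.i.e., to which $[X]^{\sigma^m}$ converges locally uniformly w.i.e. for all fine covers $\sigma^m$ of $X$ w.i.e. with accuracies $\delta_m>0$, $\sum_m\delta_m<\infty$. Further, $[X,Y]=\frac14[X+Y]-\frac14[X-Y]$. *Integral.* Let $\sigma(X,N)=\inf\{t\ge0:|X_t|\ge N\}$ and $$d_{QV}(F,F')=\sum_{N\ge1}2^{-N}\,\overline{\mathbb E}\Bigl(\int_0^{\,\cdot\,\wedge\sigma(X,N)}(F_s-F'_s)^2\,d[X]_s\Bigr)^{1/2},\qquad d_\infty(Y,Z)=\sum_{N\ge1}2^{-N}\,\overline{\mathbb E}\sup_{s\le\,\cdot\,\wedge\sigma(X,N)}|Y_s-Z_s|.$$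 A (version of the) *model-free integral* $F\cdot X$ is a process $I$ whose trajectories are w.i.e. real and Borel on $[0,t]$, such that there are simple trading strategies $(0,(\tau^m_n),(f^m_n))$ whose step processes $F^m$ satisfy $d_{QV}(F^m,F)\to0$ and whose simple integrals satisfy $d_\infty(F^m\cdot X,I)\to0$. **Statement.** Assume that $\mathbb F$ is right-continuous, let $G,H$ be globally bounded real (adapted) processes with càdlàg trajectories, and let $X,Y$ be martingales. Then the integrals $G\cdot X$ and $H\cdot Y$ exist and all their versions are martingales, the covariations $[X,Y]$ and $[G\cdot X,H\cdot Y]$ exist, and for all versions of these objects $$[G\cdot X,H\cdot Y]_t=\int_0^tG_sH_s\,d[X,Y]_s\quad\text{w.i.e.},$$ where the right-hand side is a pathwise Lebesgue–Stieltjes integral, which is well defined w.i.e. ($[X,Y]$ has bounded variation on $[0,t]$ and $GH$ is integrable against it on $(0,t]$). -/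

import Mathlib

open MeasureTheory Filter Set
open scoped NNReal ENNReal Topology

noncomputable section

namespace ModelFree

/-! ### Deterministic notions -/

/-- Right-continuous with left limits (at `t = 0` the left-limit condition is void). -/
def IsCadlag (f : ℝ≥0 → ℝ) : Prop :=
  ∀ t, ContinuousWithinAt f (Ici t) t ∧ ∃ l, Tendsto f (𝓝[<] t) (𝓝 l)

/-- `f` is Lebesgue–Stieltjes integrable against `q` over `(0, t]`: the path `q` has bounded
variation on `[0, t]` and `f` is integrable for the total variation of its Stieltjes measure. -/
def LSIntegrable (f q : ℝ≥0 → ℝ) (t : ℝ≥0) : Prop :=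
  ∃ h : BoundedVariationOn (fun s => q (min s t)) univ,
    h.vectorMeasure.IntegrableOn f (Ioc 0 t)

open Classical in
/-- The Lebesgue–Stieltjes integral `∫₀ᵗ f dq`
(meaningful when `LSIntegrable f q t`). -/
def lsIntegral (f q : ℝ≥0 → ℝ) (t : ℝ≥0) : ℝ :=
  if h : BoundedVariationOn (fun s => q (min s t)) univ then
    VectorMeasure.integral (h.vectorMeasure.restrict (Ioc 0 t)) f (ContinuousLinearMap.lsmul ℝ ℝ)
  else 0

variable {Ω : Type*} [mΩ : MeasurableSpace Ω]

/-! ### Simple trading strategies -/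

/-- A simple trading strategy: initial capital, a proper sequence of stopping times, and globally
bounded positions `g n`, known at time `τ n` and vanishing where `τ n = ∞`. -/
structure SimpleStrategy (𝓕 : Filtration ℝ≥0 mΩ) where
  c : ℝ
  τ : ℕ → Ω → WithTop ℝ≥0
  g : ℕ → Ω → ℝ
  isStoppingTime : ∀ n, IsStoppingTime 𝓕 (τ n)
  monotone : ∀ ω, Monotone fun n => τ n ω
  zero : ∀ ω, τ 0 ω = 0
  proper : ∀ ω, (∀ T : ℝ≥0, ∃ n, (T : WithTop ℝ≥0) < τ n ω) ∨ ∃ n, ∀ k, n ≤ k → τ k ω = τ n ω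
  bounded : ∀ n, ∃ K : ℝ, ∀ ω, |g n ω| ≤ K
  measurable : ∀ n, Measurable[(isStoppingTime n).measurableSpace] (g n)
  eq_zero : ∀ n ω, τ n ω = ⊤ → g n ω = 0

namespace SimpleStrategy

variable {𝓕 : Filtration ℝ≥0 mΩ}

/-- The step process `∑ₙ gₙ₋₁ 1_{[τₙ₋₁, τₙ)}`; at most one summand is nonzero. -/
def step (G : SimpleStrategy 𝓕) (t : ℝ≥0) (ω : Ω) : ℝ :=
  ∑' n, {s : ℝ≥0 | G.τ n ω ≤ s ∧ (s : WithTop ℝ≥0) < G.τ (n + 1) ω}.indicator (fun _ => G.g n ω) t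

/-- The simple integral `(G · X)ₜ = c + ∑ₙ gₙ₋₁ (X_{τₙ ∧ t} - X_{τₙ₋₁ ∧ t})`; properness makes the
sum finite. -/
def integral (G : SimpleStrategy 𝓕) (X : ℝ≥0 → Ω → ℝ) (t : ℝ≥0) (ω : Ω) : ℝ :=
  G.c + ∑' n, G.g n ω * (stoppedProcess X (G.τ (n + 1)) t ω - stoppedProcess X (G.τ n) t ω)

end SimpleStrategy

/-! ### Martingale spaces -/

variable (Ω) in
/-- A martingale space with basic continuous martingales `S 0, …, S (d - 1)`: real adapted
processes with continuous trajectories, over a filtration with trivial initial σ-field. -/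
structure MartingaleSpace (d : ℕ) where
  𝓕 : Filtration ℝ≥0 mΩ
  S : Fin d → ℝ≥0 → Ω → ℝ
  trivial_zero : 𝓕 0 = ⊥
  measurable_S : ∀ j t, Measurable[𝓕 t] (S j t)
  continuous_S : ∀ j ω, Continuous fun t => S j t ω

namespace MartingaleSpace

variable {d : ℕ} (𝓜 : MartingaleSpace Ω d)

/-- Simple capital processes. -/
def IsSimpleCapital (K : ℝ≥0 → Ω → ℝ) : Prop :=
  ∃ G : Fin d → SimpleStrategy 𝓜.𝓕, ∀ t ω, K t ω = ∑ j, (G j).integral (𝓜.S j) t ω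

/-- The class `𝒞` of nonnegative supermartingales. -/
inductive IsNonnegSupermartingale : (ℝ≥0 → Ω → ℝ≥0∞) → Prop
  | simple (K : ℝ≥0 → Ω → ℝ) (hK : 𝓜.IsSimpleCapital K) (h0 : ∀ t ω, 0 ≤ K t ω) :
      IsNonnegSupermartingale fun t ω => ENNReal.ofReal (K t ω)
  | add (V : ℝ≥0 → Ω → ℝ≥0∞) (K : ℝ≥0 → Ω → ℝ) (Z : ℝ≥0 → Ω → ℝ≥0∞)
      (hV : IsNonnegSupermartingale V) (hK : 𝓜.IsSimpleCapital K)
      (hZ : ∀ t ω, (Z t ω : EReal) = (V t ω : EReal) + (K t ω : EReal)) :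
      IsNonnegSupermartingale Z
  | liminf (V : ℕ → ℝ≥0 → Ω → ℝ≥0∞) (hV : ∀ n, IsNonnegSupermartingale (V n)) :
      IsNonnegSupermartingale fun t ω => Filter.liminf (fun n => V n t ω) atTop

/-- The property `E` of pairs `(t, ω)` holds with instant enforcement (w.i.e.). -/
def Wie (E : Set (ℝ≥0 × Ω)) : Prop :=
  ∃ V, 𝓜.IsNonnegSupermartingale V ∧ (∀ ω, V 0 ω = 1) ∧ ∀ t ω, (t, ω) ∉ E → V t ω = ⊤

/-- Assumption A: for every instantly blockable set `B` (the complement is instantly enforceable),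
the projection of `B ∩ ([0, t] × Ω)` on `Ω` belongs to `𝓕 t`. -/
def AssumptionA : Prop :=
  ∀ (t : ℝ≥0) (B : Set (ℝ≥0 × Ω)), 𝓜.Wie Bᶜ → MeasurableSet[𝓜.𝓕 t] {ω | ∃ s ≤ t, (s, ω) ∈ B}

/-- The upper expectation of a nonnegative generalized process. -/
def upperExp (Y : ℝ≥0 → Ω → ℝ≥0∞) : ℝ≥0∞ :=
  sInf {x | ∃ V, 𝓜.IsNonnegSupermartingale V ∧ (∀ ω, V 0 ω = x) ∧ ∀ t ω, Y t ω ≤ V t ω}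

/-- Local uniform convergence w.i.e. (`|·|` of a difference involving an infinite value is `∞`). -/
def TendstoLocUnifWie (Y : ℕ → ℝ≥0 → Ω → EReal) (Z : ℝ≥0 → Ω → EReal) : Prop :=
  𝓜.Wie {p | Tendsto (fun n => ⨆ s ≤ p.1, (Z s p.2 - Y n s p.2).abs) atTop (𝓝 0)}

/-- The class `ℳ` of martingales: the smallest class of processes, real w.i.e., that contains the
simple capital processes and is closed under local uniform convergence w.i.e. -/
inductive IsMartingale : (ℝ≥0 → Ω → EReal) → Prop
  | simple (K : ℝ≥0 → Ω → ℝ) (hK : 𝓜.IsSimpleCapital K) :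
      IsMartingale fun t ω => (K t ω : EReal)
  | lim (X : ℕ → ℝ≥0 → Ω → EReal) (Z : ℝ≥0 → Ω → EReal) (hX : ∀ n, IsMartingale (X n))
      (hZ : Adapted 𝓜.𝓕 Z) (hreal : 𝓜.Wie {p | Z p.1 p.2 ≠ ⊥ ∧ Z p.1 p.2 ≠ ⊤})
      (hlim : 𝓜.TendstoLocUnifWie X Z) :
      IsMartingale Z

end MartingaleSpace

/-! ### Quadratic variation and covariation -/

/-- The real-valued process obtained by replacing infinite values by `0`. -/
def realPart (X : ℝ≥0 → Ω → EReal) (t : ℝ≥0) (ω : Ω) : ℝ := (X t ω).toReal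

/-- The simple quadratic variation along a sequence of times. -/
def simpleQV (τ : ℕ → Ω → WithTop ℝ≥0) (X : ℝ≥0 → Ω → EReal) (t : ℝ≥0) (ω : Ω) : ℝ≥0∞ :=
  ∑' n, ENNReal.ofReal
    ((stoppedProcess (realPart X) (τ (n + 1)) t ω - stoppedProcess (realPart X) (τ n) t ω) ^ 2)

namespace MartingaleSpace

variable {d : ℕ} (𝓜 : MartingaleSpace Ω d)

/-- `τ` is a fine cover of `X` with accuracy `δ` on `E`. -/
def FinelyCovers (τ : ℕ → Ω → WithTop ℝ≥0) (X : ℝ≥0 → Ω → EReal) (δ : ℝ)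
    (E : Set (ℝ≥0 × Ω)) : Prop :=
  (∀ n, IsStoppingTime 𝓜.𝓕 (τ n)) ∧ (∀ ω, Monotone fun n => τ n ω) ∧ (∀ ω, τ 0 ω = 0) ∧
    ∀ t ω, (t, ω) ∈ E → {n | τ n ω ≤ (t : WithTop ℝ≥0)}.Finite ∧
      ∀ n, (⨆ s ∈ {s : ℝ≥0 | min (τ n ω) t ≤ s ∧ (s : WithTop ℝ≥0) ≤ min (τ (n + 1) ω) t}, X s ω) -
        (⨅ s ∈ {s : ℝ≥0 | min (τ n ω) t ≤ s ∧ (s : WithTop ℝ≥0) ≤ min (τ (n + 1) ω) t}, X s ω)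
          ≤ (δ : EReal)

/-- `Q` is (a version of) the quadratic variation `[X]`: a real process, continuous w.i.e., that is
the locally uniform limit w.i.e. of the simple quadratic variations along all sequences of fine
covers w.i.e. of `X` with summable accuracies. -/
def IsQuadVar (X : ℝ≥0 → Ω → EReal) (Q : ℝ≥0 → Ω → ℝ) : Prop :=
  Adapted 𝓜.𝓕 Q ∧ 𝓜.Wie {p | ContinuousOn (fun s => Q s p.2) (Iic p.1)} ∧
    ∀ (δ : ℕ → ℝ) (σ : ℕ → ℕ → Ω → WithTop ℝ≥0), (∀ m, 0 < δ m) → Summable δ →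
      (∀ m, ∃ E, 𝓜.Wie E ∧ 𝓜.FinelyCovers (σ m) X (δ m) E) →
      𝓜.TendstoLocUnifWie (fun m t ω => (simpleQV (σ m) X t ω : EReal)) fun t ω => (Q t ω : EReal)

/-- `C` is (a version of) the quadratic covariation `[X, Y] = ([X + Y] - [X - Y]) / 4`. -/
def IsQuadCovar (X Y : ℝ≥0 → Ω → EReal) (C : ℝ≥0 → Ω → ℝ) : Prop :=
  ∃ P N, 𝓜.IsQuadVar (fun t ω => X t ω + Y t ω) P ∧ 𝓜.IsQuadVar (fun t ω => X t ω - Y t ω) N ∧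
    ∀ t ω, C t ω = 1 / 4 * P t ω - 1 / 4 * N t ω

end MartingaleSpace

/-! ### The model-free integral -/

/-- `σ(X, M) = inf {t ≥ 0 : |Xₜ| ≥ M}`. -/
def sigma (X : ℝ≥0 → Ω → EReal) (M : ℝ≥0∞) : Ω → WithTop ℝ≥0 :=
  hittingAfter (fun t ω => (X t ω).abs) (Ici M) 0

open Classical in
/-- The generalized process `t ↦ (∫₀^{t ∧ σ} (F - G)² dQ)^{1/2}`
(`∞` where the Lebesgue–Stieltjes integral is undefined). -/
def qvDist (σ : Ω → WithTop ℝ≥0) (Q F G : ℝ≥0 → Ω → ℝ) (t : ℝ≥0) (ω : Ω) : ℝ≥0∞ :=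
  if LSIntegrable (fun s => (F s ω - G s ω) ^ 2) (fun s => Q s ω)
      (min (t : WithTop ℝ≥0) (σ ω)).untopA then
    ENNReal.ofReal (lsIntegral (fun s => (F s ω - G s ω) ^ 2) (fun s => Q s ω)
      (min (t : WithTop ℝ≥0) (σ ω)).untopA) ^ (1 / 2 : ℝ)
  else ⊤

namespace MartingaleSpace

variable {d : ℕ} (𝓜 : MartingaleSpace Ω d)

/-- The pseudo-distance `d_{QV,X,loc}`, for a version `Q` of `[X]`. -/
def distQV (X : ℝ≥0 → Ω → EReal) (Q F G : ℝ≥0 → Ω → ℝ) : ℝ≥0∞ :=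
  ∑' N : ℕ, (2 : ℝ≥0∞)⁻¹ ^ (N + 1) *
    𝓜.upperExp (qvDist (sigma X ((N + 1 : ℕ) : ℝ≥0∞)) Q F G)

/-- The pseudo-distance `d_{∞,X,loc}`. -/
def distInf (X Y Z : ℝ≥0 → Ω → EReal) : ℝ≥0∞ :=
  ∑' N : ℕ, (2 : ℝ≥0∞)⁻¹ ^ (N + 1) *
    𝓜.upperExp fun t ω =>
      ⨆ s ∈ {s : ℝ≥0 | s ≤ t ∧ (s : WithTop ℝ≥0) ≤ sigma X ((N + 1 : ℕ) : ℝ≥0∞) ω},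
        (Y s ω - Z s ω).abs

/-- The class `ℛ` of generalized processes whose trajectories are real and Borel on `[0, t]`
w.i.e. -/
def MemR (Y : ℝ≥0 → Ω → EReal) : Prop :=
  𝓜.Wie {p | (∀ s ≤ p.1, Y s p.2 ≠ ⊥ ∧ Y s p.2 ≠ ⊤) ∧
    Measurable fun s : Iic p.1 => Y (s : ℝ≥0) p.2}

/-- `I` is (a version of) the model-free integral `F · X`: a process in `ℛ` that is the limit in
`d_{∞,X,loc}` of the simple integrals, started at `0`, of step processes converging to `F` in
`d_{QV,X,loc}`. -/
def IsIntegral (F : ℝ≥0 → Ω → ℝ) (X I : ℝ≥0 → Ω → EReal) : Prop :=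
  Adapted 𝓜.𝓕 I ∧ 𝓜.MemR I ∧
    ∃ (Q : ℝ≥0 → Ω → ℝ) (Φ : ℕ → SimpleStrategy 𝓜.𝓕),
      𝓜.IsQuadVar X Q ∧ (∀ m, (Φ m).c = 0) ∧
      Tendsto (fun m => 𝓜.distQV X Q (Φ m).step F) atTop (𝓝 0) ∧
      Tendsto (fun m => 𝓜.distInf X
        (fun t ω => ((Φ m).integral (realPart X) t ω : EReal)) I) atTop (𝓝 0)

end MartingaleSpace

end ModelFree

end

/-! The argument is an L² theory of stochastic integration in which supermartingale domination
replaces expectation. Two facts drive it. First, a nonnegative martingale is dominated, up to an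
arbitrarily small increase of initial capital, by an element of `𝒞` (`RM.exists_supermartingale`,
`RM.upperExp_le`). Second, if `|x| ≤ N` before a stopping time and a step process is at most `ε` in
absolute value there, then the square of its simple integral against `x` is at most `ε² N²` plus a
martingale started at `0`. This is plain discrete algebra (`sq_le_of_increments`,
`L2Bound.strategy`) and requires no quadratic variation. With the maximal inequality
`L2Bound.upperExp_sup_ge` and Borel–Cantelli it turns second moment bounds into locally uniform
convergence w.i.e. (`exists_limit_of_L2Bound`).

Quadratic variation: along a cover of accuracy `δ`, the step process holding the last sampled value
of `x` is within `δ` of `x`, so the sums `∑ x_{σₙ} Δx` along finer and finer covers are Cauchy.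
Their limit `L` gives `[X] = x² - x₀² - 2 L`, hence `X² - [X]` is a martingale, and by polarization
so is `X Y - [X, Y]` (`IsQuadCovar.mul_sub_RM`).

Integral: a bounded càdlàg process is a uniform limit of step processes sampled at the times at
which it has moved by more than `4⁻ʲ` (`exists_stepApprox`), and the same L² bound makes their
integrals converge. If another version comes from step processes `Θ`, the simple integrals of the
differences `Λ` converge to the difference `z` of the versions, while `∫ Λ² d[X] → 0`. Integration
by parts then makes `z²` a martingale started at `0`, so `z = 0` (`StepApprox.locUnif`).

Covariation: for step processes on common times, discrete integration by parts shows that `Φ·X Ψ·Y -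
∫ Φ Ψ d[X, Y]` is a martingale (`RM.integral_mul_sub`). In the limit `I J - ∫ G H d[X, Y]` is a
martingale, for `I = G·X` and `J = H·Y`. So is `I J - [I, J]`. The difference of the two is a
martingale of finite variation started at `0`, and such a martingale vanishes
(`RM.eventually_eq_zero_of_variation`).

Assumption A plays the part of completeness of the filtration (`measurable_of_tendsto_wie`);
right-continuity makes hitting times stopping times. -/

noncomputable section
-- Random times and normal forms of simple strategies.
namespace ModelFree

/-! ### Capping times -/

/-- The real time `t ∧ τ`. -/
def cap (t : ℝ≥0) (τ : WithTop ℝ≥0) : ℝ≥0 := (min (t : WithTop ℝ≥0) τ).untopA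

@[simp] lemma cap_top (t : ℝ≥0) : cap t ⊤ = t := by rw [cap, min_eq_left le_top]; rfl

lemma coe_cap (t : ℝ≥0) (τ : WithTop ℝ≥0) : (cap t τ : WithTop ℝ≥0) = min (t : WithTop ℝ≥0) τ := by
  induction τ with
  | top => rw [cap_top, min_eq_left le_top]
  | coe s => rw [cap, ← WithTop.coe_min]; rfl

@[simp] lemma cap_coe (t s : ℝ≥0) : cap t (s : WithTop ℝ≥0) = min t s := by
  have := coe_cap t s
  rw [← WithTop.coe_min] at this
  exact_mod_cast this

@[simp] lemma cap_zero (t : ℝ≥0) : cap t 0 = 0 := by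
  have := cap_coe t 0
  simpa using this

lemma cap_le (t : ℝ≥0) (τ : WithTop ℝ≥0) : cap t τ ≤ t := by
  have := coe_cap t τ
  have h : (cap t τ : WithTop ℝ≥0) ≤ t := this ▸ min_le_left _ _
  exact_mod_cast h

lemma coe_cap_le (t : ℝ≥0) (τ : WithTop ℝ≥0) : (cap t τ : WithTop ℝ≥0) ≤ τ :=
  coe_cap t τ ▸ min_le_right _ _

lemma cap_of_le {t : ℝ≥0} {τ : WithTop ℝ≥0} (h : (t : WithTop ℝ≥0) ≤ τ) : cap t τ = t := by
  have := coe_cap t τ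
  rw [min_eq_left h] at this
  exact_mod_cast this

lemma coe_cap_of_ge {t : ℝ≥0} {τ : WithTop ℝ≥0} (h : τ ≤ t) : (cap t τ : WithTop ℝ≥0) = τ := by
  rw [coe_cap, min_eq_right h]

lemma cap_mono {s t : ℝ≥0} {σ τ : WithTop ℝ≥0} (h : s ≤ t) (h' : σ ≤ τ) : cap s σ ≤ cap t τ := by
  have : (cap s σ : WithTop ℝ≥0) ≤ cap t τ := by
    rw [coe_cap, coe_cap]; exact min_le_min (by exact_mod_cast h) h'
  exact_mod_cast this

lemma cap_cap (t : ℝ≥0) (σ τ : WithTop ℝ≥0) : cap (cap t σ) τ = cap t (min σ τ) := by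
  have : (cap (cap t σ) τ : WithTop ℝ≥0) = cap t (min σ τ) := by
    rw [coe_cap, coe_cap, coe_cap, min_assoc]
  exact_mod_cast this

lemma stoppedProcess_eq {Ω β : Type*} (X : ℝ≥0 → Ω → β) (τ : Ω → WithTop ℝ≥0) (t : ℝ≥0) (ω : Ω) :
    stoppedProcess X τ t ω = X (cap t (τ ω)) ω := rfl

variable {Ω : Type*} [mΩ : MeasurableSpace Ω] {𝓕 : Filtration ℝ≥0 mΩ}

/-! ### Local measurability at a stopping time -/

/-- `g` is known at time `τ`, on `{τ < ∞}`. -/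
def LocMeas (𝓕 : Filtration ℝ≥0 mΩ) (τ : Ω → WithTop ℝ≥0) (g : Ω → ℝ) : Prop :=
  ∀ t : ℝ≥0, Measurable[𝓕 t] ({ω | τ ω ≤ t}.indicator g)

lemma locMeas_of_measurable {τ : Ω → WithTop ℝ≥0} (hτ : IsStoppingTime 𝓕 τ) {g : Ω → ℝ}
    (hg : Measurable[hτ.measurableSpace] g) : LocMeas 𝓕 τ g := by
  classical
  intro t s hs
  rw [indicator_preimage, Set.ite]
  refine MeasurableSet.union ((hg hs).2 t) (MeasurableSet.diff ?_ (hτ t))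
  exact measurable_const hs

/-- The σ-field of a stopping time also demands measurability for `⨆ t, 𝓕 t`. This is where `g = 0`
on `{τ = ⊤}` enters: `g` is then the pointwise limit of its cut-offs to `{τ ≤ n}`. -/
lemma measurable_of_locMeas {τ : Ω → WithTop ℝ≥0} (hτ : IsStoppingTime 𝓕 τ) {g : Ω → ℝ}
    (hg : LocMeas 𝓕 τ g) (h0 : ∀ ω, τ ω = ⊤ → g ω = 0) : Measurable[hτ.measurableSpace] g := by
  have key : Measurable[⨆ t, 𝓕 t] g := by
    have hm : ∀ n : ℕ, Measurable[⨆ t, 𝓕 t] ({ω | τ ω ≤ ((n : ℝ≥0) : WithTop ℝ≥0)}.indicator g) :=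
      fun n => (hg n).mono (le_iSup (fun t => 𝓕 t) (n : ℝ≥0)) le_rfl
    refine @measurable_of_tendsto_metrizable _ _ (⨆ t, 𝓕 t) _ _ _ _ _ _ hm ?_
    rw [tendsto_pi_nhds]
    intro ω
    refine tendsto_const_nhds.congr' ?_
    rcases eq_or_ne (τ ω) ⊤ with h | h
    · refine Eventually.of_forall fun n => ?_
      simp [indicator, h0 ω h]
    · lift τ ω to ℝ≥0 using h with r hr
      obtain ⟨N, hN⟩ := exists_nat_ge r
      filter_upwards [eventually_ge_atTop N] with n hn
      rw [indicator_of_mem]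
      simp only [mem_ofPred_eq, ← hr]
      exact_mod_cast hN.trans (by exact_mod_cast hn)
  intro s hs
  refine ⟨key hs, fun t => ?_⟩
  have := (hg t hs).inter (hτ t)
  convert this using 1
  ext ω
  simp only [mem_inter_iff, mem_preimage, mem_ofPred_eq, and_congr_left_iff]
  intro h
  rw [indicator_of_mem (by exact h)]

namespace LocMeas

variable {τ σ : Ω → WithTop ℝ≥0} {g h : Ω → ℝ}

lemma const (hτ : IsStoppingTime 𝓕 τ) (c : ℝ) : LocMeas 𝓕 τ (fun _ => c) :=
  fun t => (measurable_const).indicator (hτ t)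

lemma comp₂ (hg : LocMeas 𝓕 τ g) (hh : LocMeas 𝓕 τ h) (hτ : IsStoppingTime 𝓕 τ) (F : ℝ → ℝ → ℝ)
    (hF : Measurable (Function.uncurry F)) : LocMeas 𝓕 τ (fun ω => F (g ω) (h ω)) := by
  intro t
  have : {ω | τ ω ≤ t}.indicator (fun ω => F (g ω) (h ω)) = {ω | τ ω ≤ t}.indicator
      (fun ω => F ({ω | τ ω ≤ t}.indicator g ω) ({ω | τ ω ≤ t}.indicator h ω)) := by
    ext ω
    by_cases hω : τ ω ≤ t <;> grind [indicator]
  rw [this]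
  exact (hF.comp ((hg t).prodMk (hh t))).indicator (hτ t)

lemma comp (hg : LocMeas 𝓕 τ g) (hτ : IsStoppingTime 𝓕 τ) (F : ℝ → ℝ)
    (hF : Measurable F) : LocMeas 𝓕 τ (fun ω => F (g ω)) :=
  comp₂ hg hg hτ (fun a _ => F a) (hF.comp measurable_fst)

lemma sub (hg : LocMeas 𝓕 τ g) (hh : LocMeas 𝓕 τ h) (hτ : IsStoppingTime 𝓕 τ) :
    LocMeas 𝓕 τ (fun ω => g ω - h ω) := comp₂ hg hh hτ (· - ·) measurable_sub

lemma mul (hg : LocMeas 𝓕 τ g) (hh : LocMeas 𝓕 τ h) (hτ : IsStoppingTime 𝓕 τ) :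
    LocMeas 𝓕 τ (fun ω => g ω * h ω) := comp₂ hg hh hτ (· * ·) measurable_mul

lemma mono (hg : LocMeas 𝓕 τ g) (hσ : IsStoppingTime 𝓕 σ) (hle : ∀ ω, τ ω ≤ σ ω) :
    LocMeas 𝓕 σ g := by
  intro t
  have : {ω | σ ω ≤ t}.indicator g = {ω | σ ω ≤ t}.indicator ({ω | τ ω ≤ t}.indicator g) := by
    ext ω
    have := hle ω
    by_cases hω : σ ω ≤ t <;> grind [indicator]
  rw [this]
  exact (hg t).indicator (hσ t)

/-- A quantity known at `ρ`, cut off to `{ρ < b}`, is known at `ρ ∧ b`. -/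
lemma indicator_lt_min {ρ b : Ω → WithTop ℝ≥0} (hg : LocMeas 𝓕 ρ g)
    (hρ : IsStoppingTime 𝓕 ρ) (hb : IsStoppingTime 𝓕 b) :
    LocMeas 𝓕 (fun ω => min (ρ ω) (b ω)) ({ω | ρ ω < b ω}.indicator g) := by
  intro t
  have : {ω | min (ρ ω) (b ω) ≤ t}.indicator ({ω | ρ ω < b ω}.indicator g) =
      ({ω | b ω ≤ ρ ω}ᶜ ∩ {ω | ρ ω ≤ t}).indicator ({ω | ρ ω ≤ t}.indicator g) := by
    ext ω
    by_cases h : ρ ω < b ω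
    · have h1 : min (ρ ω) (b ω) = ρ ω := min_eq_left h.le
      have h2 := not_le.2 h
      by_cases hω : ρ ω ≤ t <;>
        simp only [Set.indicator, mem_ofPred_eq, h1, hω, h, h2, mem_inter_iff, mem_compl_iff,
          if_true, if_false, not_false_iff, true_and]
    · have h2 := not_lt.1 h
      simp only [Set.indicator, mem_ofPred_eq, h, h2, mem_inter_iff, mem_compl_iff,
        if_false, not_true, false_and, ite_self]
  rw [this]
  refine (hg t).indicator ?_
  have := (IsStoppingTime.measurableSet_stopping_time_le hb hρ).compl
  exact this.2 t

end LocMeas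

lemma measurableSet_lt_inter {ρ b : Ω → WithTop ℝ≥0}
    (hρ : IsStoppingTime 𝓕 ρ) (hb : IsStoppingTime 𝓕 b) (t : ℝ≥0) :
    MeasurableSet[𝓕 t] ({ω | ρ ω < b ω} ∩ {ω | ρ ω ≤ t}) := by
  have := (IsStoppingTime.measurableSet_stopping_time_le hb hρ).compl.2 t
  convert this using 2
  ext ω; simp

lemma measurableSet_le_inter {ρ b : Ω → WithTop ℝ≥0}
    (hρ : IsStoppingTime 𝓕 ρ) (hb : IsStoppingTime 𝓕 b) (t : ℝ≥0) :
    MeasurableSet[𝓕 t] ({ω | ρ ω ≤ b ω} ∩ {ω | ρ ω ≤ t}) :=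
  (IsStoppingTime.measurableSet_le_stopping_time hρ hb).2 t

lemma isStoppingTime_zero : IsStoppingTime 𝓕 (fun _ : Ω => (0 : WithTop ℝ≥0)) :=
  isStoppingTime_const 𝓕 0

lemma isStoppingTime_top : IsStoppingTime 𝓕 (fun _ : Ω => (⊤ : WithTop ℝ≥0)) := by
  intro t
  simp

/-! ### Simple strategies -/

namespace SimpleStrategy

/-- The constructor with locally measurable positions. -/
def ofLocMeas (c : ℝ) (τ : ℕ → Ω → WithTop ℝ≥0) (g : ℕ → Ω → ℝ)
    (hτ : ∀ n, IsStoppingTime 𝓕 (τ n)) (hmono : ∀ ω, Monotone fun n => τ n ω)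
    (h0 : ∀ ω, τ 0 ω = 0)
    (hproper : ∀ ω, (∀ T : ℝ≥0, ∃ n, (T : WithTop ℝ≥0) < τ n ω) ∨ ∃ n, ∀ k, n ≤ k → τ k ω = τ n ω)
    (hb : ∀ n, ∃ K : ℝ, ∀ ω, |g n ω| ≤ K) (hg : ∀ n, LocMeas 𝓕 (τ n) (g n))
    (hg0 : ∀ n ω, τ n ω = ⊤ → g n ω = 0) : SimpleStrategy 𝓕 where
  c := c
  τ := τ
  g := g
  isStoppingTime := hτ
  monotone := hmono
  zero := h0
  proper := hproper
  bounded := hb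
  measurable n := measurable_of_locMeas (hτ n) (hg n) (hg0 n)
  eq_zero := hg0

variable (G H : SimpleStrategy 𝓕)

lemma locMeas (n : ℕ) : LocMeas 𝓕 (G.τ n) (G.g n) :=
  locMeas_of_measurable (G.isStoppingTime n) (G.measurable n)

/-- The `n`th gain `g n (X_{τ (n+1) ∧ t} - X_{τ n ∧ t})`. -/
def gain (X : ℝ≥0 → Ω → ℝ) (n : ℕ) (t : ℝ≥0) (ω : Ω) : ℝ :=
  G.g n ω * (X (cap t (G.τ (n + 1) ω)) ω - X (cap t (G.τ n ω)) ω)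

lemma exists_gain_eq_zero (ω : Ω) (T : ℝ≥0) :
    ∃ N, ∀ n, N ≤ n → ∀ (X : ℝ≥0 → Ω → ℝ) (t : ℝ≥0), t ≤ T → G.gain X n t ω = 0 := by
  rcases G.proper ω with h | ⟨N, hN⟩
  · obtain ⟨N, hN⟩ := h T
    refine ⟨N, fun n hn X t ht => ?_⟩
    have h1 : (t : WithTop ℝ≥0) ≤ G.τ n ω :=
      (WithTop.coe_le_coe.2 ht).trans (hN.le.trans (G.monotone ω hn))
    have h2 : (t : WithTop ℝ≥0) ≤ G.τ (n + 1) ω := h1.trans (G.monotone ω (Nat.le_succ n))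
    simp [gain, cap_of_le h1, cap_of_le h2]
  · refine ⟨N, fun n hn X t ht => ?_⟩
    simp [gain, hN n hn, hN (n + 1) (by omega)]

lemma integral_eq_sum {ω : Ω} {T : ℝ≥0} {N : ℕ} {X : ℝ≥0 → Ω → ℝ}
    (hN : ∀ n, N ≤ n → ∀ t, t ≤ T → G.gain X n t ω = 0) {t : ℝ≥0} (ht : t ≤ T) :
    G.integral X t ω = G.c + ∑ n ∈ Finset.range N, G.gain X n t ω := by
  rw [integral]
  congr 1
  refine tsum_eq_sum fun n hn => ?_
  exact hN n (by simpa using hn) t ht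

lemma exists_integral_eq_sum (ω : Ω) (T : ℝ≥0) :
    ∃ N₀, ∀ N, N₀ ≤ N → ∀ (X : ℝ≥0 → Ω → ℝ) (t : ℝ≥0), t ≤ T →
      G.integral X t ω = G.c + ∑ n ∈ Finset.range N, G.gain X n t ω := by
  obtain ⟨N₀, h⟩ := G.exists_gain_eq_zero ω T
  exact ⟨N₀, fun N hN X t ht => G.integral_eq_sum (fun n hn t ht => h n (hN.trans hn) X t ht) ht⟩

lemma step_eq {n : ℕ} {t : ℝ≥0} {ω : Ω} (h1 : G.τ n ω ≤ t) (h2 : (t : WithTop ℝ≥0) < G.τ (n + 1) ω) :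
    G.step t ω = G.g n ω := by
  rw [step, tsum_eq_single n]
  · exact indicator_of_mem (by exact ⟨h1, h2⟩) _
  · intro m hm
    refine indicator_of_notMem ?_ _
    rintro ⟨h3, h4⟩
    rcases lt_or_gt_of_ne hm with h | h
    · exact absurd (h4.trans_le ((G.monotone ω (Nat.succ_le_of_lt h)).trans h1)) (lt_irrefl _)
    · exact absurd (h2.trans_le ((G.monotone ω (Nat.succ_le_of_lt h)).trans h3)) (lt_irrefl _)

lemma step_eq_zero {t : ℝ≥0} {ω : Ω}
    (h : ∀ n, G.τ n ω ≤ t → ¬ (t : WithTop ℝ≥0) < G.τ (n + 1) ω) : G.step t ω = 0 := by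
  rw [step]
  convert tsum_zero with n
  exact indicator_of_notMem (fun h' => h n h'.1 h'.2) _

lemma exists_index {τ : ℕ → WithTop ℝ≥0} (h0 : τ 0 = 0) {t : ℝ≥0} {m : ℕ}
    (hm : (t : WithTop ℝ≥0) < τ m) : ∃ n, n < m ∧ τ n ≤ t ∧ (t : WithTop ℝ≥0) < τ (n + 1) := by
  induction m with
  | zero => rw [h0] at hm; exact absurd hm (not_lt.2 bot_le)
  | succ m ih =>
    by_cases h : (t : WithTop ℝ≥0) < τ m
    · obtain ⟨n, hn, h'⟩ := ih h
      exact ⟨n, by omega, h'⟩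
    · exact ⟨m, by omega, not_lt.1 h, hm⟩

/-- The times of the strategy are unbounded on every path. -/
def Unbounded : Prop := ∀ ω (T : ℝ≥0), ∃ n, (T : WithTop ℝ≥0) < G.τ n ω

/-- The times `τ k`, `k ≥ n`, all coincide. -/
def Stuck (n : ℕ) (ω : Ω) : Prop := ∀ k, n ≤ k → G.τ k ω = G.τ n ω

variable {G} in
lemma Stuck.succ {n : ℕ} {ω : Ω} (h : G.Stuck n ω) : G.Stuck (n + 1) ω := fun k hk => by
  rw [h k (by omega), h (n + 1) (by omega)]

/-- Although stuckness refers to the whole future, by monotonicity it says that each later time is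
at most `τ n`, an event already known at time `τ n`. -/
lemma measurableSet_stuck (n : ℕ) (t : ℝ≥0) :
    MeasurableSet[𝓕 t] ({ω | G.Stuck n ω} ∩ {ω | G.τ n ω ≤ t}) := by
  have : {ω | G.Stuck n ω} ∩ {ω | G.τ n ω ≤ t} =
      ⋂ k : ℕ, {ω | G.τ (n + k) ω ≤ G.τ n ω} ∩ {ω | G.τ n ω ≤ t} := by
    ext ω
    simp only [Stuck, mem_inter_iff, mem_ofPred_eq, mem_iInter]
    constructor
    · rintro ⟨h, h'⟩ k
      exact ⟨(h _ (by omega)).le, h'⟩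
    · intro h
      refine ⟨fun k hk => ?_, (h 0).2⟩
      obtain ⟨j, rfl⟩ := Nat.exists_eq_add_of_le hk
      exact le_antisymm (h j).1 (G.monotone ω hk)
  rw [this]
  refine MeasurableSet.iInter fun k => ?_
  exact (IsStoppingTime.measurableSet_stopping_time_le (G.isStoppingTime (n + k))
    (G.isStoppingTime n)).2 t

open Classical in
/-- The times of the normalized strategy. -/
def normTime (n : ℕ) (ω : Ω) : WithTop ℝ≥0 :=
  match n with
  | 0 => 0
  | n + 1 => if G.Stuck n ω then ⊤ else G.τ (n + 1) ω

lemma normTime_succ_of_stuck {n : ℕ} {ω : Ω} (h : G.Stuck n ω) : G.normTime (n + 1) ω = ⊤ := by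
  simp [normTime, h]

lemma normTime_succ_of_not_stuck {n : ℕ} {ω : Ω} (h : ¬ G.Stuck n ω) :
    G.normTime (n + 1) ω = G.τ (n + 1) ω := by
  simp [normTime, h]

lemma normTime_of_not_stuck {n : ℕ} {ω : Ω} (h : ¬ G.Stuck n ω) : G.normTime n ω = G.τ n ω := by
  cases n with
  | zero => simp [normTime, G.zero]
  | succ n => exact G.normTime_succ_of_not_stuck fun h' => h h'.succ

lemma normTime_monotone (ω : Ω) : Monotone fun n => G.normTime n ω := by
  refine monotone_nat_of_le_succ fun n => ?_
  by_cases h : G.Stuck n ω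
  · rw [G.normTime_succ_of_stuck h]; exact le_top
  · rw [G.normTime_succ_of_not_stuck h, G.normTime_of_not_stuck h]
    exact G.monotone ω (Nat.le_succ n)

lemma isStoppingTime_normTime (n : ℕ) : IsStoppingTime 𝓕 (G.normTime n) := by
  cases n with
  | zero => exact isStoppingTime_zero
  | succ n =>
    intro t
    have : {ω | G.normTime (n + 1) ω ≤ t} =
        {ω | G.τ (n + 1) ω ≤ t} \ ({ω | G.Stuck n ω} ∩ {ω | G.τ n ω ≤ t}) := by
      ext ω
      rw [Set.mem_sdiff, mem_inter_iff, mem_ofPred_eq, mem_ofPred_eq, mem_ofPred_eq, mem_ofPred_eq]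
      by_cases h : G.Stuck n ω
      · have := WithTop.coe_lt_top t
        rw [G.normTime_succ_of_stuck h, h (n + 1) (by omega)]
        exact ⟨fun h' => absurd h' (not_le.2 this), fun h' => absurd ⟨h, h'.1⟩ h'.2⟩
      · simp [G.normTime_succ_of_not_stuck h, h]
    rw [this]
    exact (G.isStoppingTime (n + 1) t).diff (G.measurableSet_stuck n t)

lemma normTime_unbounded (ω : Ω) (T : ℝ≥0) : ∃ n, (T : WithTop ℝ≥0) < G.normTime n ω := by
  by_cases h : ∃ n, G.Stuck n ω
  · obtain ⟨n, hn⟩ := h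
    exact ⟨n + 1, by rw [G.normTime_succ_of_stuck hn]; exact WithTop.coe_lt_top T⟩
  · push Not at h
    rcases G.proper ω with h' | ⟨n, hn⟩
    · obtain ⟨n, hn⟩ := h' T
      exact ⟨n, by rwa [G.normTime_of_not_stuck (h n)]⟩
    · exact absurd hn (h n)

/-- An equivalent strategy with unbounded times. -/
def normalize : SimpleStrategy 𝓕 :=
  -- Once stuck, the next time becomes `⊤`, which turns an empty trading interval into an infinite
  -- one. The position there must therefore be set to zero.
  ofLocMeas G.c G.normTime (fun n => {ω | ¬ G.Stuck n ω}.indicator (G.g n))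
    G.isStoppingTime_normTime G.normTime_monotone (fun _ => rfl)
    (fun ω => Or.inl (G.normTime_unbounded ω))
    (fun n => by
      obtain ⟨K, hK⟩ := G.bounded n
      refine ⟨K, fun ω => ?_⟩
      by_cases h : G.Stuck n ω
      · simpa [indicator, h] using (abs_nonneg _).trans (hK ω)
      · simpa [indicator, h] using hK ω)
    (fun n t => by
      have : {ω | G.normTime n ω ≤ t}.indicator ({ω | ¬ G.Stuck n ω}.indicator (G.g n)) =
          ({ω | G.Stuck n ω} ∩ {ω | G.τ n ω ≤ t})ᶜ.indicator
            ({ω | G.τ n ω ≤ t}.indicator (G.g n)) := by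
        ext ω
        by_cases h : G.Stuck n ω
        · by_cases h' : G.τ n ω ≤ t <;>
            simp only [indicator, mem_ofPred_eq, h, h', mem_inter_iff, mem_compl_iff, not_true,
              and_self, if_false, ite_self]
        · simp only [indicator, mem_ofPred_eq, h, mem_inter_iff, mem_compl_iff, not_false_iff,
            if_true, false_and, G.normTime_of_not_stuck h]
          split_ifs <;> rfl
      rw [this]
      exact (G.locMeas n t).indicator (G.measurableSet_stuck n t).compl)
    (fun n ω h => by
      by_cases h' : G.Stuck n ω
      · simp [indicator, h']
      · rw [G.normTime_of_not_stuck h'] at h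
        simp [indicator, h', G.eq_zero n ω h])

lemma normalize_unbounded : G.normalize.Unbounded := G.normTime_unbounded

lemma normalize_integral (X : ℝ≥0 → Ω → ℝ) (t : ℝ≥0) (ω : Ω) :
    G.normalize.integral X t ω = G.integral X t ω := by
  rw [integral, integral]
  refine congrArg₂ (· + ·) rfl (tsum_congr fun n => ?_)
  change {ω | ¬ G.Stuck n ω}.indicator (G.g n) ω * (X (cap t (G.normTime (n + 1) ω)) ω -
    X (cap t (G.normTime n ω)) ω) = G.g n ω * (X (cap t (G.τ (n + 1) ω)) ω - X (cap t (G.τ n ω)) ω)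
  by_cases h : G.Stuck n ω
  · simp [indicator, h, h (n + 1) (by omega)]
  · simp [indicator, h, G.normTime_succ_of_not_stuck h, G.normTime_of_not_stuck h]

lemma normalize_step (t : ℝ≥0) (ω : Ω) : G.normalize.step t ω = G.step t ω := by
  obtain ⟨m, hm⟩ := G.normTime_unbounded ω t
  obtain ⟨n, -, h1, h2⟩ := exists_index (τ := fun n => G.normTime n ω) rfl hm
  rw [G.normalize.step_eq (n := n) h1 h2]
  change {ω | ¬ G.Stuck n ω}.indicator (G.g n) ω = _
  by_cases h : G.Stuck n ω
  · rw [indicator_of_notMem (by simpa using h), step_eq_zero]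
    -- A nonempty interval of the original times has an index `k` at which the strategy is not
    -- stuck, hence `k < n`. It therefore ends by `normTime n ≤ t` and cannot contain `t`.
    intro k hk hk'
    have hks : ¬ G.Stuck k ω := fun h' => by
      rw [h' (k + 1) (by omega)] at hk'; exact absurd hk (not_le.2 hk')
    have hkn : k < n := by
      by_contra hcon
      exact hks fun j hj => by rw [h j (by omega), h k (by omega)]
    rw [← G.normTime_succ_of_not_stuck hks] at hk'
    exact absurd (hk'.trans_le ((G.normTime_monotone ω hkn).trans h1)) (lt_irrefl _)
  · rw [indicator_of_mem (by exact h)]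
    rw [G.normTime_of_not_stuck h] at h1
    rw [G.normTime_succ_of_not_stuck h] at h2
    exact (G.step_eq h1 h2).symm

/-- The sum of the strategy with a constant multiple of the positions: scaling. -/
def smul (a : ℝ) : SimpleStrategy 𝓕 :=
  ofLocMeas (a * G.c) G.τ (fun n ω => a * G.g n ω) G.isStoppingTime G.monotone G.zero G.proper
    (fun n => by
      obtain ⟨K, hK⟩ := G.bounded n
      exact ⟨|a| * K, fun ω => by rw [abs_mul]; exact mul_le_mul_of_nonneg_left (hK ω) (abs_nonneg _)⟩)
    (fun n => (LocMeas.const (G.isStoppingTime n) a).mul (G.locMeas n) (G.isStoppingTime n))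
    (fun n ω h => by simp [G.eq_zero n ω h])

lemma smul_integral (a : ℝ) (X : ℝ≥0 → Ω → ℝ) (t : ℝ≥0) (ω : Ω) :
    (G.smul a).integral X t ω = a * G.integral X t ω := by
  rw [integral, integral, mul_add, ← tsum_mul_left]
  simp only [smul, ofLocMeas, mul_assoc]

lemma smul_step (a : ℝ) (t : ℝ≥0) (ω : Ω) : (G.smul a).step t ω = a * G.step t ω := by
  by_cases h : ∃ n, G.τ n ω ≤ t ∧ (t : WithTop ℝ≥0) < G.τ (n + 1) ω
  · obtain ⟨n, h1, h2⟩ := h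
    rw [G.step_eq h1 h2, (G.smul a).step_eq (n := n) h1 h2]; rfl
  · push Not at h
    rw [G.step_eq_zero fun n hn => not_lt.2 (h n hn),
      (G.smul a).step_eq_zero fun n hn => not_lt.2 (h n hn), mul_zero]

end SimpleStrategy
end ModelFree
end

/-! ### Sums of simple strategies. -/

noncomputable section
namespace ModelFree

/-! ### Merging two sequences of times -/

/-- After `n` steps of the merge, the number of steps made along `τ` and along `σ`. -/
def mergeIdx (τ σ : ℕ → WithTop ℝ≥0) : ℕ → ℕ × ℕ
  | 0 => (0, 0)
  | n + 1 =>
    let p := mergeIdx τ σ n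
    if τ (p.1 + 1) ≤ σ (p.2 + 1) then (p.1 + 1, p.2) else (p.1, p.2 + 1)

/-- The times of the merged sequence. -/
def mergeTime (τ σ : ℕ → WithTop ℝ≥0) (n : ℕ) : WithTop ℝ≥0 :=
  max (τ (mergeIdx τ σ n).1) (σ (mergeIdx τ σ n).2)

section merge

variable {τ σ : ℕ → WithTop ℝ≥0}

lemma mergeIdx_succ_of_le {n : ℕ}
    (h : τ ((mergeIdx τ σ n).1 + 1) ≤ σ ((mergeIdx τ σ n).2 + 1)) :
    mergeIdx τ σ (n + 1) = ((mergeIdx τ σ n).1 + 1, (mergeIdx τ σ n).2) := by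
  rw [mergeIdx]; exact if_pos h

lemma mergeIdx_succ_of_not_le {n : ℕ}
    (h : ¬ τ ((mergeIdx τ σ n).1 + 1) ≤ σ ((mergeIdx τ σ n).2 + 1)) :
    mergeIdx τ σ (n + 1) = ((mergeIdx τ σ n).1, (mergeIdx τ σ n).2 + 1) := by
  rw [mergeIdx]; exact if_neg h

lemma mergeIdx_add (n : ℕ) : (mergeIdx τ σ n).1 + (mergeIdx τ σ n).2 = n := by
  induction n with
  | zero => rfl
  | succ n ih =>
    by_cases h : τ ((mergeIdx τ σ n).1 + 1) ≤ σ ((mergeIdx τ σ n).2 + 1)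
    · rw [mergeIdx_succ_of_le h]; simp only; omega
    · rw [mergeIdx_succ_of_not_le h]; simp only; omega

/-- The invariant of the merge: neither sequence has been advanced beyond the next time of the
other. It makes the maximum defining `mergeTime` at step `n + 1` equal to the minimum of the two
candidates. -/
lemma mergeIdx_le (hτ : Monotone τ) (hσ : Monotone σ) (h0 : τ 0 = 0) (h0' : σ 0 = 0) (n : ℕ) :
    τ (mergeIdx τ σ n).1 ≤ σ ((mergeIdx τ σ n).2 + 1) ∧
      σ (mergeIdx τ σ n).2 ≤ τ ((mergeIdx τ σ n).1 + 1) := by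
  induction n with
  | zero => simp only [mergeIdx, h0, h0']; exact ⟨bot_le, bot_le⟩
  | succ n ih =>
    by_cases h : τ ((mergeIdx τ σ n).1 + 1) ≤ σ ((mergeIdx τ σ n).2 + 1)
    · rw [mergeIdx_succ_of_le h]
      exact ⟨h, ih.2.trans (hτ (Nat.le_succ _))⟩
    · rw [mergeIdx_succ_of_not_le h]
      exact ⟨ih.1.trans (hσ (Nat.le_succ _)), (not_le.1 h).le⟩

lemma mergeTime_succ (hτ : Monotone τ) (hσ : Monotone σ) (h0 : τ 0 = 0) (h0' : σ 0 = 0) (n : ℕ) :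
    mergeTime τ σ (n + 1) = min (τ ((mergeIdx τ σ n).1 + 1)) (σ ((mergeIdx τ σ n).2 + 1)) := by
  have ih := mergeIdx_le hτ hσ h0 h0' n
  by_cases h : τ ((mergeIdx τ σ n).1 + 1) ≤ σ ((mergeIdx τ σ n).2 + 1)
  · rw [mergeTime, mergeIdx_succ_of_le h, min_eq_left h]
    exact max_eq_left ih.2
  · rw [mergeTime, mergeIdx_succ_of_not_le h, min_eq_right (not_le.1 h).le]
    exact max_eq_right ih.1

lemma mergeTime_monotone (hτ : Monotone τ) (hσ : Monotone σ) (h0 : τ 0 = 0) (h0' : σ 0 = 0) :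
    Monotone (mergeTime τ σ) := by
  refine monotone_nat_of_le_succ fun n => ?_
  have ih := mergeIdx_le hτ hσ h0 h0' n
  rw [mergeTime_succ hτ hσ h0 h0', mergeTime]
  exact max_le (le_min (hτ (Nat.le_succ _)) ih.1) (le_min ih.2 (hσ (Nat.le_succ _)))

/-- Each sequence contributes its completed increments and one increment still in progress, valued
at the current merged time. Keeping the unfinished terms makes the induction step an identity of
ring expressions. -/
lemma sum_merge (hτ : Monotone τ) (hσ : Monotone σ) (h0 : τ 0 = 0) (h0' : σ 0 = 0)
    (f : WithTop ℝ≥0 → ℝ) (g h : ℕ → ℝ) (n : ℕ) :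
    ∑ k ∈ Finset.range n, (g (mergeIdx τ σ k).1 + h (mergeIdx τ σ k).2) *
        (f (mergeTime τ σ (k + 1)) - f (mergeTime τ σ k)) =
      (∑ i ∈ Finset.range (mergeIdx τ σ n).1, g i * (f (τ (i + 1)) - f (τ i)) +
        g (mergeIdx τ σ n).1 * (f (mergeTime τ σ n) - f (τ (mergeIdx τ σ n).1))) +
      (∑ i ∈ Finset.range (mergeIdx τ σ n).2, h i * (f (σ (i + 1)) - f (σ i)) +
        h (mergeIdx τ σ n).2 * (f (mergeTime τ σ n) - f (σ (mergeIdx τ σ n).2))) := by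
  induction n with
  | zero => simp [mergeIdx, mergeTime, h0, h0']
  | succ n ih =>
    rw [Finset.sum_range_succ, ih, mergeTime_succ hτ hσ h0 h0']
    by_cases hle : τ ((mergeIdx τ σ n).1 + 1) ≤ σ ((mergeIdx τ σ n).2 + 1)
    · rw [mergeIdx_succ_of_le hle, min_eq_left hle]
      simp only [Finset.sum_range_succ]
      ring
    · rw [mergeIdx_succ_of_not_le hle, min_eq_right (not_le.1 hle).le]
      simp only [Finset.sum_range_succ]
      ring

lemma exists_lt_mergeTime (hτ : Monotone τ) (hσ : Monotone σ) {T : ℝ≥0}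
    (h : ∃ n, (T : WithTop ℝ≥0) < τ n) (h' : ∃ n, (T : WithTop ℝ≥0) < σ n) :
    ∃ n, (T : WithTop ℝ≥0) < mergeTime τ σ n := by
  obtain ⟨i, hi⟩ := h
  obtain ⟨j, hj⟩ := h'
  refine ⟨i + j, ?_⟩
  have hadd := mergeIdx_add (τ := τ) (σ := σ) (i + j)
  rcases le_or_gt i (mergeIdx τ σ (i + j)).1 with h | h
  · exact (hi.trans_le (hτ h)).trans_le (le_max_left _ _)
  · exact (hj.trans_le (hσ (by omega))).trans_le (le_max_right _ _)

end merge

variable {Ω : Type*} [mΩ : MeasurableSpace Ω] {𝓕 : Filtration ℝ≥0 mΩ}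

/-- The indices alone are not known at time `t`. Restricting to pairs whose times are at most `t`
makes every comparison that decided an earlier merge step `𝓕 t`-measurable, and this restriction is
inherited along the induction. -/
lemma measurableSet_mergeIdx {τ σ : ℕ → Ω → WithTop ℝ≥0} (hτ : ∀ n, IsStoppingTime 𝓕 (τ n))
    (hσ : ∀ n, IsStoppingTime 𝓕 (σ n)) (hτm : ∀ ω, Monotone fun n => τ n ω)
    (hσm : ∀ ω, Monotone fun n => σ n ω) (t : ℝ≥0) (n i j : ℕ) :
    MeasurableSet[𝓕 t] {ω | mergeIdx (fun n => τ n ω) (fun n => σ n ω) n = (i, j) ∧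
      τ i ω ≤ t ∧ σ j ω ≤ t} := by
  induction n generalizing i j with
  | zero =>
    by_cases h : i = 0 ∧ j = 0
    · have : {ω | mergeIdx (fun n => τ n ω) (fun n => σ n ω) 0 = (i, j) ∧ τ i ω ≤ t ∧ σ j ω ≤ t} =
          {ω | τ i ω ≤ t} ∩ {ω | σ j ω ≤ t} := by
        ext ω
        rw [mem_inter_iff, mem_ofPred_eq, mem_ofPred_eq, mem_ofPred_eq]
        exact ⟨fun h => h.2, fun h' => ⟨by rw [h.1, h.2]; rfl, h'⟩⟩
      rw [this]
      exact (hτ i t).inter (hσ j t)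
    · have : {ω | mergeIdx (fun n => τ n ω) (fun n => σ n ω) 0 = (i, j) ∧ τ i ω ≤ t ∧ σ j ω ≤ t} =
          ∅ := by
        ext ω
        rw [mem_ofPred_eq, mem_empty_iff_false, iff_false]
        rintro ⟨h1, -⟩
        rw [mergeIdx, Prod.mk.injEq] at h1
        exact h ⟨h1.1.symm, h1.2.symm⟩
      rw [this]
      exact @MeasurableSet.empty _ (𝓕 t)
  | succ n ih =>
    set A : Set Ω := {ω | ∃ i', i = i' + 1 ∧ (mergeIdx (fun n => τ n ω) (fun n => σ n ω) n = (i', j) ∧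
      τ i' ω ≤ t ∧ σ j ω ≤ t) ∧ τ i ω ≤ σ (j + 1) ω ∧ τ i ω ≤ t} with hA
    set B : Set Ω := {ω | ∃ j', j = j' + 1 ∧ (mergeIdx (fun n => τ n ω) (fun n => σ n ω) n = (i, j') ∧
      τ i ω ≤ t ∧ σ j' ω ≤ t) ∧ σ j ω < τ (i + 1) ω ∧ σ j ω ≤ t} with hB
    have : {ω | mergeIdx (fun n => τ n ω) (fun n => σ n ω) (n + 1) = (i, j) ∧
        τ i ω ≤ t ∧ σ j ω ≤ t} = A ∪ B := by
      ext ω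
      rw [mem_union, hA, hB, mem_ofPred_eq, mem_ofPred_eq, mem_ofPred_eq]
      set p := mergeIdx (fun n => τ n ω) (fun n => σ n ω) n with hp
      by_cases hle : τ (p.1 + 1) ω ≤ σ (p.2 + 1) ω
      · rw [mergeIdx_succ_of_le hle, ← hp]
        constructor
        · rintro ⟨h1, h2, h3⟩
          obtain ⟨rfl, rfl⟩ := Prod.mk.inj h1
          exact Or.inl ⟨p.1, rfl, ⟨rfl, (hτm ω (Nat.le_succ _)).trans h2, h3⟩, hle, h2⟩
        · rintro (⟨i', rfl, ⟨h1, h2, h3⟩, h4, h5⟩ | ⟨j', rfl, ⟨h1, h2, h3⟩, h4, h5⟩)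
          · rw [h1]; exact ⟨rfl, h5, h3⟩
          · rw [h1] at hle; exact absurd hle (not_le.2 h4)
      · rw [mergeIdx_succ_of_not_le hle, ← hp]
        constructor
        · rintro ⟨h1, h2, h3⟩
          obtain ⟨rfl, rfl⟩ := Prod.mk.inj h1
          exact Or.inr ⟨p.2, rfl, ⟨rfl, h2, (hσm ω (Nat.le_succ _)).trans h3⟩, not_le.1 hle, h3⟩
        · rintro (⟨i', rfl, ⟨h1, h2, h3⟩, h4, h5⟩ | ⟨j', rfl, ⟨h1, h2, h3⟩, h4, h5⟩)
          · rw [h1] at hle; exact absurd h4 hle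
          · rw [h1]; exact ⟨rfl, h2, h5⟩
    rw [this]
    refine MeasurableSet.union ?_ ?_
    · cases i with
      | zero =>
        have : A = ∅ := by
          ext ω
          rw [hA, mem_ofPred_eq, mem_empty_iff_false, iff_false]
          rintro ⟨i', h, -⟩
          omega
        rw [this]; exact @MeasurableSet.empty _ (𝓕 t)
      | succ i =>
        have : A = {ω | mergeIdx (fun n => τ n ω) (fun n => σ n ω) n = (i, j) ∧ τ i ω ≤ t ∧ σ j ω ≤ t} ∩
            ({ω | τ (i + 1) ω ≤ σ (j + 1) ω} ∩ {ω | τ (i + 1) ω ≤ t}) := by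
          ext ω
          rw [hA, mem_ofPred_eq, mem_inter_iff, mem_ofPred_eq]
          constructor
          · rintro ⟨i', h, h'⟩
            obtain rfl : i = i' := by omega
            exact h'
          · intro h'
            exact ⟨i, rfl, h'⟩
        rw [this]
        exact (ih i j).inter (measurableSet_le_inter (hτ _) (hσ _) t)
    · cases j with
      | zero =>
        have : B = ∅ := by
          ext ω
          rw [hB, mem_ofPred_eq, mem_empty_iff_false, iff_false]
          rintro ⟨i', h, -⟩
          omega
        rw [this]; exact @MeasurableSet.empty _ (𝓕 t)
      | succ j =>
        have : B = {ω | mergeIdx (fun n => τ n ω) (fun n => σ n ω) n = (i, j) ∧ τ i ω ≤ t ∧ σ j ω ≤ t} ∩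
            ({ω | σ (j + 1) ω < τ (i + 1) ω} ∩ {ω | σ (j + 1) ω ≤ t}) := by
          ext ω
          rw [hB, mem_ofPred_eq, mem_inter_iff, mem_ofPred_eq]
          constructor
          · rintro ⟨i', h, h'⟩
            obtain rfl : j = i' := by omega
            exact h'
          · intro h'
            exact ⟨j, rfl, h'⟩
        rw [this]
        exact (ih i j).inter (measurableSet_lt_inter (hσ _) (hτ _) t)

namespace SimpleStrategy

variable (G H : SimpleStrategy 𝓕)

/-- The indices of the merged strategy. -/
def addIdx (n : ℕ) (ω : Ω) : ℕ × ℕ := mergeIdx (fun n => G.τ n ω) (fun n => H.τ n ω) n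

/-- The times of the merged strategy. -/
def addTime (n : ℕ) (ω : Ω) : WithTop ℝ≥0 := mergeTime (fun n => G.τ n ω) (fun n => H.τ n ω) n

open Classical in
/-- The positions of the merged strategy. -/
def addPos (n : ℕ) (ω : Ω) : ℝ :=
  if G.addTime H n ω = ⊤ then 0 else G.g (G.addIdx H n ω).1 ω + H.g (G.addIdx H n ω).2 ω

lemma addTime_monotone (ω : Ω) : Monotone fun n => G.addTime H n ω :=
  mergeTime_monotone (G.monotone ω) (H.monotone ω) (G.zero ω) (H.zero ω)

lemma addTime_le_iff (n : ℕ) (t : ℝ≥0) (ω : Ω) : G.addTime H n ω ≤ t ↔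
    G.τ (G.addIdx H n ω).1 ω ≤ t ∧ H.τ (G.addIdx H n ω).2 ω ≤ t := max_le_iff

lemma addIdx_mem_antidiagonal (n : ℕ) (ω : Ω) : G.addIdx H n ω ∈ Finset.HasAntidiagonal.antidiagonal n := by
  rw [Finset.HasAntidiagonal.mem_antidiagonal]
  exact mergeIdx_add n

/-- After `n` steps the two indices add up to `n`, so only finitely many index pairs have to be
distinguished. -/
lemma isStoppingTime_addTime (n : ℕ) : IsStoppingTime 𝓕 (G.addTime H n) := by
  intro t
  have : {ω | G.addTime H n ω ≤ t} = ⋃ p ∈ Finset.HasAntidiagonal.antidiagonal n,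
      {ω | G.addIdx H n ω = (p.1, p.2) ∧ G.τ p.1 ω ≤ t ∧ H.τ p.2 ω ≤ t} := by
    ext ω
    simp only [mem_iUnion, exists_prop]
    rw [mem_ofPred_eq, addTime_le_iff]
    constructor
    · intro h
      exact ⟨_, G.addIdx_mem_antidiagonal H n ω, rfl, h⟩
    · rintro ⟨p, -, h1, h2⟩
      rw [h1]; exact h2
  rw [this]
  exact Finset.measurableSet_biUnion _ fun p _ =>
    measurableSet_mergeIdx G.isStoppingTime H.isStoppingTime G.monotone H.monotone t n p.1 p.2

lemma locMeas_addPos (n : ℕ) : LocMeas 𝓕 (G.addTime H n) (G.addPos H n) := by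
  classical
  intro t
  have : {ω | G.addTime H n ω ≤ t}.indicator (G.addPos H n) = fun ω =>
      ∑ p ∈ Finset.HasAntidiagonal.antidiagonal n,
        {ω | G.addIdx H n ω = (p.1, p.2) ∧ G.τ p.1 ω ≤ t ∧ H.τ p.2 ω ≤ t}.indicator
        (fun ω => {ω | G.τ p.1 ω ≤ t}.indicator (G.g p.1) ω +
          {ω | H.τ p.2 ω ≤ t}.indicator (H.g p.2) ω) ω := by
    ext ω
    rw [Finset.sum_eq_single (G.addIdx H n ω)]
    · by_cases h : G.addTime H n ω ≤ t
      · have h' := (G.addTime_le_iff H n t ω).1 h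
        have hne : G.addTime H n ω ≠ ⊤ := ne_top_of_le_ne_top WithTop.coe_ne_top h
        rw [indicator_of_mem (by exact h), indicator_of_mem (by exact ⟨rfl, h'⟩),
          indicator_of_mem (by exact h'.1), indicator_of_mem (by exact h'.2), addPos, if_neg hne]
      · have h' := mt (G.addTime_le_iff H n t ω).2 h
        rw [indicator_of_notMem (by exact h), indicator_of_notMem (fun hh => h' hh.2)]
    · rintro p - hp
      exact indicator_of_notMem (fun hh => hp hh.1.symm) _
    · intro h
      exact absurd (G.addIdx_mem_antidiagonal H n ω) h
  rw [this]
  refine Finset.measurable_sum _ fun p _ => Measurable.indicator ?_ ?_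
  · exact (G.locMeas p.1 t).add (H.locMeas p.2 t)
  · exact measurableSet_mergeIdx G.isStoppingTime H.isStoppingTime G.monotone H.monotone t n p.1 p.2

lemma addPos_bounded (n : ℕ) : ∃ K : ℝ, ∀ ω, |G.addPos H n ω| ≤ K := by
  choose K hK using G.bounded
  choose L hL using H.bounded
  refine ⟨∑ i ∈ Finset.range (n + 1), |K i| + ∑ i ∈ Finset.range (n + 1), |L i|, fun ω => ?_⟩
  have hadd : (G.addIdx H n ω).1 + (G.addIdx H n ω).2 = n := mergeIdx_add n
  have h1 : |K (G.addIdx H n ω).1| ≤ ∑ i ∈ Finset.range (n + 1), |K i| :=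
    Finset.single_le_sum (f := fun i => |K i|) (fun _ _ => abs_nonneg _)
      (Finset.mem_range.2 (by omega))
  have h2 : |L (G.addIdx H n ω).2| ≤ ∑ i ∈ Finset.range (n + 1), |L i| :=
    Finset.single_le_sum (f := fun i => |L i|) (fun _ _ => abs_nonneg _)
      (Finset.mem_range.2 (by omega))
  rw [addPos]
  split_ifs
  · rw [abs_zero]; exact add_nonneg ((abs_nonneg _).trans h1) ((abs_nonneg _).trans h2)
  · exact (abs_add_le _ _).trans (add_le_add (((hK _ ω).trans (le_abs_self _)).trans h1)
      (((hL _ ω).trans (le_abs_self _)).trans h2))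

/-- The sum of two strategies with unbounded times. -/
def merge (hG : G.Unbounded) (hH : H.Unbounded) : SimpleStrategy 𝓕 :=
  ofLocMeas (G.c + H.c) (G.addTime H) (G.addPos H) (G.isStoppingTime_addTime H)
    (G.addTime_monotone H)
    (fun ω => by simp [addTime, mergeTime, mergeIdx, G.zero ω, H.zero ω])
    (fun ω => Or.inl fun T => exists_lt_mergeTime (G.monotone ω) (H.monotone ω) (hG ω T) (hH ω T))
    (G.addPos_bounded H) (G.locMeas_addPos H) (fun n ω h => if_pos h)

variable {G H}

lemma merge_integral (hG : G.Unbounded) (hH : H.Unbounded) (X : ℝ≥0 → Ω → ℝ) (t : ℝ≥0) (ω : Ω) :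
    (G.merge H hG hH).integral X t ω = G.integral X t ω + H.integral X t ω := by
  obtain ⟨N₁, h₁⟩ := (G.merge H hG hH).exists_integral_eq_sum ω t
  obtain ⟨N₂, h₂⟩ := exists_lt_mergeTime (G.monotone ω) (H.monotone ω) (hG ω t) (hH ω t)
  set N := max N₁ N₂ with hN
  set p := G.addIdx H N ω with hp
  have hlt : (t : WithTop ℝ≥0) < G.addTime H N ω :=
    h₂.trans_le (G.addTime_monotone H ω (le_max_right _ _))
  have hlt' : (t : WithTop ℝ≥0) < min (G.τ (p.1 + 1) ω) (H.τ (p.2 + 1) ω) := by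
    rw [hp, addIdx, ← mergeTime_succ (G.monotone ω) (H.monotone ω) (G.zero ω) (H.zero ω)]
    exact hlt.trans_le (G.addTime_monotone H ω (Nat.le_succ N))
  -- The last increment of `F` may be evaluated at the merged time `N` instead of its own next time,
  -- since both lie beyond `t`. This is the form of the unfinished terms in `sum_merge`.
  have aux : ∀ (F : SimpleStrategy 𝓕) (n : ℕ), (t : WithTop ℝ≥0) < F.τ (n + 1) ω →
      F.integral X t ω = F.c + (∑ i ∈ Finset.range n, F.g i ω * (X (cap t (F.τ (i + 1) ω)) ω -
        X (cap t (F.τ i ω)) ω) + F.g n ω * (X (cap t (G.addTime H N ω)) ω - X (cap t (F.τ n ω)) ω)) := by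
    intro F n hn
    rw [F.integral_eq_sum (T := t) (N := n + 1) (X := X) _ le_rfl, Finset.sum_range_succ]
    · rw [gain, cap_of_le hn.le, cap_of_le hlt.le]; rfl
    · intro m hm s hs
      have h1 : (s : WithTop ℝ≥0) ≤ F.τ m ω :=
        (WithTop.coe_le_coe.2 hs).trans (hn.le.trans (F.monotone ω hm))
      have h2 : (s : WithTop ℝ≥0) ≤ F.τ (m + 1) ω := h1.trans (F.monotone ω (Nat.le_succ m))
      simp [gain, cap_of_le h1, cap_of_le h2]
  rw [h₁ N (le_max_left _ _) X t le_rfl, aux G p.1 (hlt'.trans_le (min_le_left _ _)),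
    aux H p.2 (hlt'.trans_le (min_le_right _ _))]
  have key := sum_merge (G.monotone ω) (H.monotone ω) (G.zero ω) (H.zero ω)
    (fun u => X (cap t u) ω) (fun i => G.g i ω) (fun i => H.g i ω) N
  have hsum : ∑ n ∈ Finset.range N, (G.merge H hG hH).gain X n t ω =
      ∑ k ∈ Finset.range N, (G.g (G.addIdx H k ω).1 ω + H.g (G.addIdx H k ω).2 ω) *
        (X (cap t (G.addTime H (k + 1) ω)) ω - X (cap t (G.addTime H k ω)) ω) := by
    refine Finset.sum_congr rfl fun k _ => ?_
    change G.addPos H k ω * (X (cap t (G.addTime H (k + 1) ω)) ω - X (cap t (G.addTime H k ω)) ω) = _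
    by_cases h : G.addTime H k ω = ⊤
    · have h' : G.addTime H (k + 1) ω = ⊤ := top_le_iff.1 (h ▸ G.addTime_monotone H ω (Nat.le_succ k))
      simp [h, h']
    · rw [addPos, if_neg h]
  rw [hsum]
  have hc : (G.merge H hG hH).c = G.c + H.c := rfl
  rw [hc]
  have key' : ∑ k ∈ Finset.range N, (G.g (G.addIdx H k ω).1 ω + H.g (G.addIdx H k ω).2 ω) *
        (X (cap t (G.addTime H (k + 1) ω)) ω - X (cap t (G.addTime H k ω)) ω) =
      (∑ i ∈ Finset.range p.1, G.g i ω * (X (cap t (G.τ (i + 1) ω)) ω -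
        X (cap t (G.τ i ω)) ω) + G.g p.1 ω * (X (cap t (G.addTime H N ω)) ω -
        X (cap t (G.τ p.1 ω)) ω)) +
      (∑ i ∈ Finset.range p.2, H.g i ω * (X (cap t (H.τ (i + 1) ω)) ω -
        X (cap t (H.τ i ω)) ω) + H.g p.2 ω * (X (cap t (G.addTime H N ω)) ω -
        X (cap t (H.τ p.2 ω)) ω)) := key
  rw [key']
  ring

lemma merge_step (hG : G.Unbounded) (hH : H.Unbounded) (t : ℝ≥0) (ω : Ω) :
    (G.merge H hG hH).step t ω = G.step t ω + H.step t ω := by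
  obtain ⟨m, hm⟩ := exists_lt_mergeTime (G.monotone ω) (H.monotone ω) (hG ω t) (hH ω t)
  obtain ⟨n, -, h1, h2⟩ := exists_index (τ := fun n => G.addTime H n ω)
    (by simp [addTime, mergeTime, mergeIdx, G.zero ω, H.zero ω]) hm
  have h1' := (G.addTime_le_iff H n t ω).1 h1
  have h2' : (t : WithTop ℝ≥0) < min (G.τ ((G.addIdx H n ω).1 + 1) ω)
      (H.τ ((G.addIdx H n ω).2 + 1) ω) := by
    rw [addIdx, ← mergeTime_succ (G.monotone ω) (H.monotone ω) (G.zero ω) (H.zero ω)]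
    exact h2
  rw [(G.merge H hG hH).step_eq (n := n) h1 h2, G.step_eq h1'.1 (h2'.trans_le (min_le_left _ _)),
    H.step_eq h1'.2 (h2'.trans_le (min_le_right _ _))]
  exact if_neg (ne_top_of_le_ne_top WithTop.coe_ne_top h1)

variable (G H)

/-- The sum of two strategies. -/
def add : SimpleStrategy 𝓕 :=
  G.normalize.merge H.normalize G.normalize_unbounded H.normalize_unbounded

lemma add_integral (X : ℝ≥0 → Ω → ℝ) (t : ℝ≥0) (ω : Ω) :
    (G.add H).integral X t ω = G.integral X t ω + H.integral X t ω := by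
  rw [add, merge_integral, normalize_integral, normalize_integral]

lemma add_step (t : ℝ≥0) (ω : Ω) : (G.add H).step t ω = G.step t ω + H.step t ω := by
  rw [add, merge_step, normalize_step, normalize_step]

/-- The difference of two strategies. -/
def sub : SimpleStrategy 𝓕 := G.add (H.smul (-1))

lemma sub_c : (G.sub H).c = G.c - H.c := by
  change G.c + -1 * H.c = _
  ring

lemma sub_integral (X : ℝ≥0 → Ω → ℝ) (t : ℝ≥0) (ω : Ω) :
    (G.sub H).integral X t ω = G.integral X t ω - H.integral X t ω := by
  rw [sub, add_integral, smul_integral]; ring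

lemma sub_step (t : ℝ≥0) (ω : Ω) : (G.sub H).step t ω = G.step t ω - H.step t ω := by
  rw [sub, add_step, smul_step]; ring

end SimpleStrategy
end ModelFree
end

/-! ### Simple capital processes: adaptedness, continuity, trading on random intervals. -/

noncomputable section
namespace ModelFree

variable {Ω : Type*} [mΩ : MeasurableSpace Ω] {𝓕 : Filtration ℝ≥0 mΩ}

/-! ### Discretization of stopping times -/

lemma measurable_cap {τ : Ω → WithTop ℝ≥0} (hτ : IsStoppingTime 𝓕 τ) (t : ℝ≥0) :
    Measurable[𝓕 t] fun ω => cap t (τ ω) := by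
  refine @measurable_of_Iic _ _ _ _ _ (𝓕 t) _ _ _ _ fun s => ?_
  rcases le_total t s with h | h
  · convert @MeasurableSet.univ _ (𝓕 t)
    exact eq_univ_of_forall fun ω => (cap_le t (τ ω)).trans h
  · rcases h.eq_or_lt with rfl | h
    · convert @MeasurableSet.univ _ (𝓕 s)
      exact eq_univ_of_forall fun ω => (cap_le s (τ ω))
    · convert 𝓕.mono h.le _ (hτ s) using 1
      ext ω
      have h1 : cap t (τ ω) ≤ s ↔ min (t : WithTop ℝ≥0) (τ ω) ≤ s := by
        rw [← coe_cap]; exact WithTop.coe_le_coe.symm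
      have h2 : ¬ ((t : WithTop ℝ≥0) ≤ s) := not_le.2 (WithTop.coe_lt_coe.2 h)
      change cap t (τ ω) ≤ s ↔ τ ω ≤ s
      rw [h1, min_le_iff, or_iff_right h2]

/-- Approximation of `t ∧ τ` from above, within `[0, t]`, by times with countably many values. -/
lemma exists_cap_approx {β : Type*} [MeasurableSpace β] {Z : ℝ≥0 → Ω → β} (hZ : Adapted 𝓕 Z)
    {τ : Ω → WithTop ℝ≥0} (hτ : IsStoppingTime 𝓕 τ) (t : ℝ≥0) :
    ∃ D : ℕ → Ω → ℝ≥0, (∀ n, Measurable[𝓕 t] fun ω => Z (D n ω) ω) ∧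
      (∀ n ω, cap t (τ ω) ≤ D n ω ∧ D n ω ≤ t) ∧
      ∀ ω, Tendsto (fun n => D n ω) atTop (𝓝 (cap t (τ ω))) := by
  -- The next point of the grid of mesh `1 / (n + 1)` strictly after `cap t (τ ω)`, cut off at `t`.
  -- The cut-off prevents looking beyond `t`, and the countably many grid values reduce
  -- measurability to that of `Z` at fixed times.
  refine ⟨fun n ω => min t ((⌊((n : ℝ≥0) + 1) * cap t (τ ω)⌋₊ + 1) / (n + 1)), fun n => ?_, fun n ω => ⟨?_, min_le_left _ _⟩,
    fun ω => ?_⟩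
  · have hm : Measurable[𝓕 t] fun ω => ⌊((n : ℝ≥0) + 1) * cap t (τ ω)⌋₊ :=
      Nat.measurable_floor.comp (measurable_const.mul (measurable_cap hτ t))
    intro s hs
    have : (fun ω => Z (min t ((⌊((n : ℝ≥0) + 1) * cap t (τ ω)⌋₊ + 1) / (n + 1))) ω) ⁻¹' s =
        ⋃ k : ℕ, (fun ω => ⌊((n : ℝ≥0) + 1) * cap t (τ ω)⌋₊) ⁻¹' {k} ∩
          (Z (min t ((k + 1) / (n + 1)))) ⁻¹' s := by
      ext ω
      simp
    rw [this]
    exact MeasurableSet.iUnion fun k => (hm (measurableSet_singleton k)).inter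
      (𝓕.mono (min_le_left _ _) _ (hZ _ hs))
  · refine le_min (cap_le _ _) ?_
    rw [le_div_iff₀ (by positivity), mul_comm]
    exact (Nat.lt_floor_add_one _).le
  · set c := cap t (τ ω) with hc
    have h1 : Tendsto (fun n : ℕ => c + 1 / ((n : ℝ≥0) + 1)) atTop (𝓝 (c + 0)) :=
      tendsto_const_nhds.add tendsto_one_div_add_atTop_nhds_zero_nat
    rw [add_zero] at h1
    refine tendsto_of_tendsto_of_tendsto_of_le_of_le tendsto_const_nhds h1 (fun n => ?_) fun n => ?_
    · refine le_min (cap_le _ _) ?_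
      rw [le_div_iff₀ (by positivity), mul_comm]
      exact (Nat.lt_floor_add_one _).le
    · refine (min_le_right _ _).trans ?_
      have hf : (⌊((n : ℝ≥0) + 1) * c⌋₊ : ℝ≥0) ≤ ((n : ℝ≥0) + 1) * c := Nat.floor_le zero_le
      have hn : ((n : ℝ≥0) + 1) ≠ 0 := by positivity
      rw [div_le_iff₀ (by positivity)]
      calc _ ≤ ((n : ℝ≥0) + 1) * c + 1 := add_le_add_left hf 1
        _ = _ := by field_simp

lemma Adapted.comp_cap_of_continuous {Z : ℝ≥0 → Ω → ℝ} (hZ : Adapted 𝓕 Z)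
    (hc : ∀ ω, Continuous fun t => Z t ω) {τ : Ω → WithTop ℝ≥0} (hτ : IsStoppingTime 𝓕 τ) :
    Adapted 𝓕 fun t ω => Z (cap t (τ ω)) ω := by
  intro t
  obtain ⟨D, hD, -, hD'⟩ := exists_cap_approx hZ hτ t
  refine @measurable_of_tendsto_metrizable _ _ (𝓕 t) _ _ _ _ _ _ hD ?_
  rw [tendsto_pi_nhds]
  exact fun ω => ((hc ω).tendsto _).comp (hD' ω)

/-- A quantity known at `τ` times an increment after `τ` is adapted. -/
lemma LocMeas.mul_increment {τ : Ω → WithTop ℝ≥0} {g : Ω → ℝ} (hg : LocMeas 𝓕 τ g) {A B : Ω → ℝ}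
    {t : ℝ≥0} (hτ : IsStoppingTime 𝓕 τ)
    (hA : Measurable[𝓕 t] A) (h0 : ∀ ω, (t : WithTop ℝ≥0) < τ ω → A ω = 0) :
    Measurable[𝓕 t] fun ω => g ω * A ω := by
  have : (fun ω => g ω * A ω) = fun ω => {ω | τ ω ≤ t}.indicator g ω * A ω := by
    ext ω
    by_cases h : τ ω ≤ t
    · rw [indicator_of_mem (by exact h)]
    · rw [h0 ω (not_le.1 h), mul_zero, mul_zero]
  rw [this]
  exact (hg t).mul hA

namespace SimpleStrategy

variable (G : SimpleStrategy 𝓕)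

lemma adapted_integral {X : ℝ≥0 → Ω → ℝ}
    (hX : ∀ τ, IsStoppingTime 𝓕 τ → Adapted 𝓕 fun t ω => X (cap t (τ ω)) ω) :
    Adapted 𝓕 (G.integral X) := by
  intro t
  have hm : ∀ n : ℕ, Measurable[𝓕 t] fun ω => G.c + ∑ k ∈ Finset.range n, G.gain X k t ω := by
    intro n
    refine measurable_const.add (Finset.measurable_sum _ fun k _ => ?_)
    refine (G.locMeas k).mul_increment (A := fun ω => X (cap t (G.τ (k + 1) ω)) ω -
      X (cap t (G.τ k ω)) ω) (B := 0) (G.isStoppingTime k)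
      ((hX _ (G.isStoppingTime (k + 1)) t).sub (hX _ (G.isStoppingTime k) t)) fun ω h => ?_
    rw [cap_of_le h.le, cap_of_le (h.le.trans (G.monotone ω (Nat.le_succ k))), sub_self]
  refine @measurable_of_tendsto_metrizable _ _ (𝓕 t) _ _ _ _ _ _ hm ?_
  rw [tendsto_pi_nhds]
  intro ω
  obtain ⟨N, hN⟩ := G.exists_integral_eq_sum ω t
  refine tendsto_const_nhds.congr' ?_
  filter_upwards [eventually_ge_atTop N] with n hn
  exact hN n hn X t le_rfl

lemma continuous_cap_left (τ : WithTop ℝ≥0) : Continuous fun t => cap t τ := by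
  induction τ with
  | top => simpa using continuous_id'
  | coe s =>
    have : (fun t => cap t (s : WithTop ℝ≥0)) = fun t => min t s := funext fun t => cap_coe t s
    rw [this]
    exact continuous_id.min continuous_const

lemma continuousOn_integral {X : ℝ≥0 → Ω → ℝ} {ω : Ω} {T : ℝ≥0}
    (hX : ContinuousOn (fun t => X t ω) (Iic T)) :
    ContinuousOn (fun t => G.integral X t ω) (Iic T) := by
  obtain ⟨N, hN⟩ := G.exists_integral_eq_sum ω T
  have : ContinuousOn (fun t => G.c + ∑ k ∈ Finset.range N, G.gain X k t ω) (Iic T) := by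
    have hcap : ∀ τ : WithTop ℝ≥0, ContinuousOn (fun t => X (cap t τ) ω) (Iic T) := fun τ =>
      hX.comp (continuous_cap_left τ).continuousOn fun t ht => (cap_le t τ).trans ht
    refine continuousOn_const.add (continuousOn_finsetSum _ fun k _ => ?_)
    exact continuousOn_const.mul ((hcap _).sub (hcap _))
  exact this.congr fun t ht => hN N le_rfl X t ht

lemma integral_zero_time (X : ℝ≥0 → Ω → ℝ) (ω : Ω) : G.integral X 0 ω = G.c := by
  obtain ⟨N, hN⟩ := G.exists_integral_eq_sum ω 0
  have : ∀ τ : WithTop ℝ≥0, cap 0 τ = 0 := fun τ => le_antisymm (cap_le 0 τ) zero_le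
  rw [hN N le_rfl X 0 le_rfl]
  simp [gain, this]

variable (𝓕) in
/-- The strategy without trading. -/
def const (c : ℝ) : SimpleStrategy 𝓕 :=
  ofLocMeas c (fun _ _ => 0) (fun _ _ => 0) (fun _ => isStoppingTime_zero) (fun _ => monotone_const)
    (fun _ => rfl) (fun _ => Or.inr ⟨0, fun _ _ => rfl⟩) (fun _ => ⟨0, fun _ => by simp⟩)
    (fun _ => LocMeas.const isStoppingTime_zero 0) (fun _ _ _ => rfl)

lemma const_integral (c : ℝ) (X : ℝ≥0 → Ω → ℝ) (t : ℝ≥0) (ω : Ω) :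
    (const 𝓕 c).integral X t ω = c := by
  rw [integral]
  simp [const, ofLocMeas]

/-- The strategy traded, with the factor `g`, on `[a, b)` only. -/
def between {a b : Ω → WithTop ℝ≥0} {g : Ω → ℝ} (ha : IsStoppingTime 𝓕 a) (hb : IsStoppingTime 𝓕 b)
    (hg : LocMeas 𝓕 a g) (hgb : ∃ K : ℝ, ∀ ω, |g ω| ≤ K) : SimpleStrategy 𝓕 :=
  ofLocMeas 0
    -- Index `0` is spent on the mandatory time `0`, with position `0`; the times of `G`, clamped to
    -- `[a, b]`, follow with a shift by one.
    (fun n => match n with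
      | 0 => fun _ => 0
      | n + 1 => fun ω => min (max (G.τ n ω) (a ω)) (b ω))
    (fun n => match n with
      | 0 => fun _ => 0
      -- The strict inequality makes the position vanish where the clamped time is `⊤`, and ensures
      -- that the position is known at that time.
      | n + 1 => {ω | max (G.τ n ω) (a ω) < b ω}.indicator fun ω => g ω * G.g n ω)
    (fun n => match n with
      | 0 => isStoppingTime_zero
      | n + 1 => ((G.isStoppingTime n).max ha).min hb)
    (fun ω => monotone_nat_of_le_succ fun n => by
      cases n with
      | zero => exact bot_le
      | succ n => exact min_le_min (max_le_max (G.monotone ω (Nat.le_succ n)) le_rfl) le_rfl)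
    (fun _ => rfl)
    (fun ω => by
      by_cases h : ∃ n, G.Stuck n ω
      · obtain ⟨n, hn⟩ := h
        refine Or.inr ⟨n + 1, fun k hk => ?_⟩
        obtain ⟨j, rfl⟩ : ∃ j, k = j + 1 := ⟨k - 1, by omega⟩
        change min (max (G.τ j ω) (a ω)) (b ω) = min (max (G.τ n ω) (a ω)) (b ω)
        rw [hn j (by omega)]
      · have hU := (G.proper ω).resolve_right h
        by_cases hb : b ω = ⊤
        · refine Or.inl fun T => ?_
          obtain ⟨n, hn⟩ := hU T
          refine ⟨n + 1, ?_⟩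
          change (T : WithTop ℝ≥0) < min (max (G.τ n ω) (a ω)) (b ω)
          rw [hb, min_eq_left le_top]
          exact hn.trans_le (le_max_left _ _)
        · lift b ω to ℝ≥0 using hb with r hr
          obtain ⟨n, hn⟩ := hU r
          refine Or.inr ⟨n + 1, fun k hk => ?_⟩
          have key : ∀ j, n ≤ j → min (max (G.τ j ω) (a ω)) (r : WithTop ℝ≥0) = r := fun j hj =>
            min_eq_right ((hn.le.trans (G.monotone ω hj)).trans (le_max_left _ _))
          obtain ⟨j, rfl⟩ : ∃ j, k = j + 1 := ⟨k - 1, by omega⟩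
          change min (max (G.τ j ω) (a ω)) (b ω) = min (max (G.τ n ω) (a ω)) (b ω)
          rw [← hr, key j (by omega), key n le_rfl])
    (fun n => match n with
      | 0 => ⟨0, fun _ => by simp⟩
      | n + 1 => by
        obtain ⟨K, hK⟩ := hgb
        obtain ⟨L, hL⟩ := G.bounded n
        refine ⟨K * L, fun ω => ?_⟩
        have hp : |g ω * G.g n ω| ≤ K * L := by
          rw [abs_mul]
          exact mul_le_mul (hK ω) (hL ω) (abs_nonneg _) ((abs_nonneg _).trans (hK ω))
        by_cases h : ω ∈ {ω | max (G.τ n ω) (a ω) < b ω}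
        · simp only [indicator_of_mem h]; exact hp
        · simp only [indicator_of_notMem h, abs_zero]; exact (abs_nonneg _).trans hp)
    (fun n => match n with
      | 0 => LocMeas.const isStoppingTime_zero 0
      | n + 1 => by
        have hm := (G.isStoppingTime n).max ha
        exact (((hg.mono hm fun ω => le_max_right _ _).mul
          ((G.locMeas n).mono hm fun ω => le_max_left _ _) hm)).indicator_lt_min hm hb)
    (fun n => match n with
      | 0 => fun _ _ => rfl
      | n + 1 => fun ω h => by
        refine indicator_of_notMem ?_ _
        intro h'
        change max (G.τ n ω) (a ω) < b ω at h'
        exact absurd ((min_eq_left h'.le).symm.trans h) h'.ne_top)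

lemma between_integral {a b : Ω → WithTop ℝ≥0} {g : Ω → ℝ} (ha : IsStoppingTime 𝓕 a)
    (hb : IsStoppingTime 𝓕 b) (hg : LocMeas 𝓕 a g) (hgb : ∃ K : ℝ, ∀ ω, |g ω| ≤ K)
    (hab : ∀ ω, a ω ≤ b ω) (X : ℝ≥0 → Ω → ℝ) (t : ℝ≥0) (ω : Ω) :
    (G.between ha hb hg hgb).integral X t ω =
      g ω * (G.integral X (cap t (b ω)) ω - G.integral X (cap t (a ω)) ω) := by
  obtain ⟨N₁, h₁⟩ := (G.between ha hb hg hgb).exists_integral_eq_sum ω t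
  obtain ⟨N₂, h₂⟩ := G.exists_integral_eq_sum ω t
  set N := max N₁ N₂
  rw [h₁ (N + 1) ((le_max_left _ _).trans (Nat.le_succ _)) X t le_rfl,
    h₂ N (le_max_right _ _) X _ (cap_le _ _), h₂ N (le_max_right _ _) X _ (cap_le _ _),
    Finset.sum_range_succ', add_sub_add_left_eq_sub, ← Finset.sum_sub_distrib, Finset.mul_sum]
  have h0 : (G.between ha hb hg hgb).gain X 0 t ω = 0 := by
    rw [gain]; exact zero_mul _
  have hc : (G.between ha hb hg hgb).c = 0 := rfl
  rw [h0, hc, zero_add, add_zero]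
  refine Finset.sum_congr rfl fun n _ => ?_
  have hmono := G.monotone ω (Nat.le_succ n)
  simp only [gain, cap_cap]
  change {ω | max (G.τ n ω) (a ω) < b ω}.indicator (fun ω => g ω * G.g n ω) ω *
    (X (cap t (min (max (G.τ (n + 1) ω) (a ω)) (b ω))) ω -
      X (cap t (min (max (G.τ n ω) (a ω)) (b ω))) ω) = _
  -- Clamping to `[a, b]` as a sum of two cut-offs: it splits the clamped increment into the part
  -- before `b` minus the part before `a`.
  have key : ∀ u : WithTop ℝ≥0, X (cap t (min (max u (a ω)) (b ω))) ω =
      X (cap t (min (b ω) u)) ω - X (cap t (min (a ω) u)) ω + X (cap t (a ω)) ω := by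
    intro u
    rcases le_total u (a ω) with h | h
    · rw [max_eq_right h, min_eq_left (hab ω), min_eq_right h, min_eq_right (h.trans (hab ω))]
      ring
    · rw [max_eq_left h, min_eq_left h, min_comm]; ring
  by_cases h : max (G.τ n ω) (a ω) < b ω
  · rw [indicator_of_mem (by exact h), key, key]; ring
  -- Beyond `b` both clamped times equal `b`. By `key` their equality says precisely that the
  -- right-hand side vanishes.
  · rw [indicator_of_notMem (by exact h), zero_mul]
    have h' := not_lt.1 h
    have e : X (cap t (min (max (G.τ (n + 1) ω) (a ω)) (b ω))) ω =
      X (cap t (min (max (G.τ n ω) (a ω)) (b ω))) ω := by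
      rw [min_eq_right h', min_eq_right (h'.trans (max_le_max hmono le_rfl))]
    rw [key, key] at e
    linear_combination (-(g ω * G.g n ω)) * e

end SimpleStrategy

/-! ### Simple capital processes -/

namespace MartingaleSpace

variable {d : ℕ} {𝓜 : MartingaleSpace Ω d}

lemma measurable_S_cap (j : Fin d) {τ : Ω → WithTop ℝ≥0} (hτ : IsStoppingTime 𝓜.𝓕 τ) :
    Adapted 𝓜.𝓕 fun t ω => 𝓜.S j (cap t (τ ω)) ω :=
  Adapted.comp_cap_of_continuous (𝓜.measurable_S j) (𝓜.continuous_S j) hτ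

namespace IsSimpleCapital

variable {K L : ℝ≥0 → Ω → ℝ}

lemma const [NeZero d] (c : ℝ) : 𝓜.IsSimpleCapital fun _ _ => c := by
  -- Some basic martingale has to carry the capital; this is where `d ≥ 1` enters.
  refine ⟨fun j => SimpleStrategy.const 𝓜.𝓕 (if j = 0 then c else 0), fun t ω => ?_⟩
  simp [SimpleStrategy.const_integral]

lemma add (hK : 𝓜.IsSimpleCapital K) (hL : 𝓜.IsSimpleCapital L) :
    𝓜.IsSimpleCapital fun t ω => K t ω + L t ω := by
  obtain ⟨G, hG⟩ := hK
  obtain ⟨H, hH⟩ := hL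
  refine ⟨fun j => (G j).add (H j), fun t ω => ?_⟩
  beta_reduce
  rw [hG, hH, ← Finset.sum_add_distrib]
  exact Finset.sum_congr rfl fun j _ => ((G j).add_integral (H j) _ _ _).symm

lemma const_mul (a : ℝ) (hK : 𝓜.IsSimpleCapital K) : 𝓜.IsSimpleCapital fun t ω => a * K t ω := by
  obtain ⟨G, hG⟩ := hK
  refine ⟨fun j => (G j).smul a, fun t ω => ?_⟩
  beta_reduce
  rw [hG, Finset.mul_sum]
  exact Finset.sum_congr rfl fun j _ => ((G j).smul_integral a _ _ _).symm

/-- The capital process of trading `g` times `K` on `[a, b)`. -/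
lemma increment (hK : 𝓜.IsSimpleCapital K) {a b : Ω → WithTop ℝ≥0} {g : Ω → ℝ}
    (ha : IsStoppingTime 𝓜.𝓕 a) (hb : IsStoppingTime 𝓜.𝓕 b) (hab : ∀ ω, a ω ≤ b ω)
    (hg : LocMeas 𝓜.𝓕 a g) (hgb : ∃ C : ℝ, ∀ ω, |g ω| ≤ C) :
    𝓜.IsSimpleCapital fun t ω => g ω * (K (cap t (b ω)) ω - K (cap t (a ω)) ω) := by
  obtain ⟨G, hG⟩ := hK
  refine ⟨fun j => (G j).between ha hb hg hgb, fun t ω => ?_⟩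
  beta_reduce
  rw [hG, hG, ← Finset.sum_sub_distrib, Finset.mul_sum]
  exact Finset.sum_congr rfl fun j _ => ((G j).between_integral ha hb hg hgb hab _ _ _).symm

lemma exists_zero_eq (hK : 𝓜.IsSimpleCapital K) : ∃ c, ∀ ω, K 0 ω = c := by
  obtain ⟨G, hG⟩ := hK
  exact ⟨∑ j, (G j).c, fun ω => by simp [hG, SimpleStrategy.integral_zero_time]⟩

lemma stopAt [NeZero d] (hK : 𝓜.IsSimpleCapital K) {τ : Ω → WithTop ℝ≥0}
    (hτ : IsStoppingTime 𝓜.𝓕 τ) :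
    𝓜.IsSimpleCapital fun t ω => K (cap t (τ ω)) ω := by
  obtain ⟨c, hc⟩ := hK.exists_zero_eq
  have := (const (𝓜 := 𝓜) c).add (hK.increment isStoppingTime_zero hτ (fun _ => bot_le)
    (LocMeas.const isStoppingTime_zero 1) ⟨1, fun _ => by simp⟩)
  convert this using 4 with t ω
  simp [hc]

lemma continuous (hK : 𝓜.IsSimpleCapital K) (ω : Ω) : Continuous fun t => K t ω := by
  obtain ⟨G, hG⟩ := hK
  simp only [hG]
  refine continuous_finsetSum _ fun j _ => continuous_iff_continuousAt.2 fun t => ?_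
  exact ((G j).continuousOn_integral (T := t + 1) (𝓜.continuous_S j ω).continuousOn).continuousAt
    (Iic_mem_nhds (lt_add_one t))

lemma adapted (hK : 𝓜.IsSimpleCapital K) : Adapted 𝓜.𝓕 K := by
  obtain ⟨G, hG⟩ := hK
  intro t
  have : K t = fun ω => ∑ j, (G j).integral (𝓜.S j) t ω := funext fun ω => hG t ω
  rw [this]
  exact Finset.measurable_sum _ fun j _ =>
    (G j).adapted_integral (fun τ hτ => measurable_S_cap j hτ) t

end IsSimpleCapital
end MartingaleSpace
end ModelFree
end

/-! ### The calculus of supermartingales, instant enforcement and upper expectation. -/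

noncomputable section
namespace ModelFree

variable {Ω : Type*} [mΩ : MeasurableSpace Ω]

namespace MartingaleSpace

variable {d : ℕ} {𝓜 : MartingaleSpace Ω d}

/-! ### Nonnegative supermartingales -/

namespace IsNonnegSupermartingale

variable {V W : ℝ≥0 → Ω → ℝ≥0∞}

lemma const [NeZero d] {c : ℝ≥0∞} (hc : c ≠ ⊤) : 𝓜.IsNonnegSupermartingale fun _ _ => c := by
  have := IsNonnegSupermartingale.simple _ (IsSimpleCapital.const (𝓜 := 𝓜) c.toReal)
    fun _ _ => ENNReal.toReal_nonneg
  simpa only [ENNReal.ofReal_toReal hc] using this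

/-- Induction on the first summand with the second fixed: a simple capital process may be attached
to any member of the class, and adding the fixed value `W t ω` commutes with `liminf`. -/
lemma add_process (hV : 𝓜.IsNonnegSupermartingale V) (hW : 𝓜.IsNonnegSupermartingale W) :
    𝓜.IsNonnegSupermartingale fun t ω => V t ω + W t ω := by
  induction hV with
  | simple K hK h0 =>
    refine .add W K _ hW hK fun t ω => ?_
    rw [EReal.coe_ennreal_add, EReal.coe_ennreal_ofReal, max_eq_left (h0 t ω), add_comm]
  | add V K Z hV hK hZ ih =>
    refine .add _ K _ ih hK fun t ω => ?_
    rw [EReal.coe_ennreal_add, hZ, EReal.coe_ennreal_add, add_right_comm]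
  | liminf V hV ih =>
    convert IsNonnegSupermartingale.liminf _ ih using 3 with t ω
    exact ((Monotone.map_liminf_of_continuousAt (f := fun x : ℝ≥0∞ => x + W t ω)
      (fun _ _ h => add_le_add_left h _) _ (continuous_add_const _).continuousAt
      isCobounded_ge_of_top isBounded_ge_of_bot))

lemma const_mul {a : ℝ≥0∞} (ha : a ≠ ⊤) (hV : 𝓜.IsNonnegSupermartingale V) :
    𝓜.IsNonnegSupermartingale fun t ω => a * V t ω := by
  induction hV with
  | simple K hK h0 =>
    have := IsNonnegSupermartingale.simple _ (hK.const_mul a.toReal)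
      fun t ω => mul_nonneg ENNReal.toReal_nonneg (h0 t ω)
    simpa only [ENNReal.ofReal_mul ENNReal.toReal_nonneg, ENNReal.ofReal_toReal ha] using this
  | add V K Z hV hK hZ ih =>
    refine .add _ _ _ ih (hK.const_mul a.toReal) fun t ω => ?_
    rw [EReal.coe_ennreal_mul, hZ, EReal.coe_ennreal_mul, EReal.coe_mul,
      EReal.coe_ennreal_toReal ha]
    exact EReal.left_distrib_of_nonneg_of_ne_top (EReal.coe_ennreal_nonneg a) (by simpa using ha) _ _
  | liminf V hV ih =>
    convert IsNonnegSupermartingale.liminf _ ih using 3 with t ω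
    exact (ENNReal.liminf_const_mul_of_ne_top ha).symm

lemma finset_sum [NeZero d] {ι : Type*} {V : ι → ℝ≥0 → Ω → ℝ≥0∞} (s : Finset ι)
    (hV : ∀ i, 𝓜.IsNonnegSupermartingale (V i)) :
    𝓜.IsNonnegSupermartingale fun t ω => ∑ i ∈ s, V i t ω := by
  classical
  induction s using Finset.induction_on with
  | empty => simpa using const (𝓜 := 𝓜) ENNReal.zero_ne_top
  | insert i s hi ih =>
    simp only [Finset.sum_insert hi]
    exact (hV i).add_process ih

lemma tsum [NeZero d] {V : ℕ → ℝ≥0 → Ω → ℝ≥0∞} (hV : ∀ n, 𝓜.IsNonnegSupermartingale (V n)) :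
    𝓜.IsNonnegSupermartingale fun t ω => ∑' n, V n t ω := by
  simp only [ENNReal.tsum_eq_liminf_sum_nat]
  exact .liminf _ fun n => finset_sum _ hV

lemma stopAt [NeZero d] (hV : 𝓜.IsNonnegSupermartingale V) {τ : Ω → WithTop ℝ≥0}
    (hτ : IsStoppingTime 𝓜.𝓕 τ) : 𝓜.IsNonnegSupermartingale fun t ω => V (cap t (τ ω)) ω := by
  induction hV with
  | simple K hK h0 => exact .simple _ (hK.stopAt hτ) fun t ω => h0 _ ω
  | add V K Z hV hK hZ ih => exact .add _ _ _ ih (hK.stopAt hτ) fun t ω => hZ _ ω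
  | liminf V hV ih => exact .liminf _ ih

lemma adapted (hV : 𝓜.IsNonnegSupermartingale V) : Adapted 𝓜.𝓕 V := by
  induction hV with
  | simple K hK h0 => exact fun t => (hK.adapted t).ennreal_ofReal
  | add V K Z hV hK hZ ih =>
    intro t
    have : Z t = fun ω => ((V t ω : EReal) + (K t ω : EReal)).toENNReal := by
      ext ω
      rw [← hZ, EReal.toENNReal_coe]
    rw [this]
    exact measurable_ereal_toENNReal.comp
      ((measurable_coe_ennreal_ereal.comp (ih t)).add (measurable_coe_real_ereal.comp (hK.adapted t)))
  | liminf V hV ih => exact fun t => Measurable.liminf fun n => ih n t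

lemma exists_zero_eq (hV : 𝓜.IsNonnegSupermartingale V) : ∃ x, ∀ ω, V 0 ω = x := by
  rcases isEmpty_or_nonempty Ω with h | ⟨⟨ω₀⟩⟩
  · exact ⟨0, fun ω => h.elim ω⟩
  refine ⟨V 0 ω₀, fun ω => ?_⟩
  have := hV.adapted 0 (measurableSet_singleton (V 0 ω₀))
  rw [𝓜.trivial_zero, MeasurableSpace.measurableSet_bot_iff] at this
  rcases this with h | h
  · exact absurd (show ω₀ ∈ V 0 ⁻¹' {V 0 ω₀} from rfl) (by simp [h])
  · have : ω ∈ V 0 ⁻¹' {V 0 ω₀} := by simp [h]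
    exact this

end IsNonnegSupermartingale

/-! ### Instant enforcement -/

lemma Wie.mono {E F : Set (ℝ≥0 × Ω)} (hE : 𝓜.Wie E) (h : E ⊆ F) : 𝓜.Wie F := by
  obtain ⟨V, hV, h0, h1⟩ := hE
  exact ⟨V, hV, h0, fun t ω hn => h1 t ω fun hm => hn (h hm)⟩

/-- `{V < ∞}` holds w.i.e. if `V` is a nonnegative supermartingale with finite initial value. -/
lemma IsNonnegSupermartingale.wie_lt_top [NeZero d] {V : ℝ≥0 → Ω → ℝ≥0∞}
    (hV : 𝓜.IsNonnegSupermartingale V) {x : ℝ≥0∞} (hx : x ≠ ⊤) (h0 : ∀ ω, V 0 ω ≤ x) :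
    𝓜.Wie {p | V p.1 p.2 < ⊤} := by
  rcases isEmpty_or_nonempty Ω with h | ⟨⟨ω₀⟩⟩
  · exact ⟨V, hV, fun ω => h.elim ω, fun _ ω => h.elim ω⟩
  obtain ⟨y, hy⟩ := hV.exists_zero_eq
  have hyt : y ≠ ⊤ := ne_top_of_le_ne_top hx (hy ω₀ ▸ h0 ω₀)
  have h1 : y + 1 ≠ 0 := by simp
  have h2 : y + 1 ≠ ⊤ := by simp [hyt]
  -- Adding `1` before normalizing permits `y = 0`.
  refine ⟨fun t ω => (y + 1)⁻¹ * (V t ω + 1),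
    (hV.add_process (.const ENNReal.one_ne_top)).const_mul (ENNReal.inv_ne_top.2 h1), fun ω => ?_,
    fun t ω h => ?_⟩
  · change (y + 1)⁻¹ * (V 0 ω + 1) = 1
    rw [hy, ENNReal.inv_mul_cancel h1 h2]
  · have : V t ω = ⊤ := by simpa using h
    change (y + 1)⁻¹ * (V t ω + 1) = ⊤
    rw [this, top_add, ENNReal.mul_top (ENNReal.inv_ne_zero.2 h2)]

/-- With weights `2⁻⁽ⁿ⁺¹⁾` the sum of the enforcing supermartingales still starts at `1`, and it is
infinite as soon as one summand is. All almost-sure style reasoning below rests on this countable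
stability. -/
lemma exists_enforcing_sequence (E : ℕ → Set (ℝ≥0 × Ω)) (hE : ∀ n, 𝓜.Wie (E n)) [NeZero d] :
    𝓜.Wie (⋂ n, E n) := by
  choose V hV h0 h1 using hE
  have hc : ∀ n : ℕ, ((2 : ℝ≥0∞)⁻¹ ^ (n + 1)) ≠ ⊤ := fun n => by simp
  refine ⟨fun t ω => ∑' n, (2 : ℝ≥0∞)⁻¹ ^ (n + 1) * V n t ω, .tsum fun n => (hV n).const_mul (hc n),
    fun ω => ?_, fun t ω h => ?_⟩
  · simp only [h0, mul_one]
    exact ENNReal.tsum_two_zpow_neg_add_one ▸ tsum_congr fun n => by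
      rw [← ENNReal.rpow_natCast, ← ENNReal.rpow_intCast]
      push_cast
      rw [neg_sub_left, ENNReal.rpow_neg, ENNReal.inv_rpow, add_comm]
  · obtain ⟨n, hn⟩ : ∃ n, (t, ω) ∉ E n := by simpa using h
    refine ENNReal.tsum_eq_top_of_eq_top ⟨n, ?_⟩
    rw [h1 n t ω hn, ENNReal.mul_top (by simp)]

variable (𝓜) in
/-- The filter of the properties that hold w.i.e. -/
def wie [NeZero d] : Filter (ℝ≥0 × Ω) where
  sets := {E | 𝓜.Wie E}
  univ_sets := ⟨fun _ _ => 1, .const ENNReal.one_ne_top, fun _ => rfl,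
    fun _ _ h => absurd (mem_univ _) h⟩
  sets_of_superset h h' := h.mono h'
  inter_sets {E F} h h' := by
    refine (exists_enforcing_sequence (fun n => if n = 0 then E else F) fun n => ?_).mono
      fun p hp => ?_
    · split_ifs
      exacts [h, h']
    · rw [mem_iInter] at hp
      exact ⟨by simpa using hp 0, by simpa using hp 1⟩

variable {Y Y' : ℝ≥0 → Ω → ℝ≥0∞}

lemma exists_of_upperExp_lt {c : ℝ≥0∞} (h : 𝓜.upperExp Y < c) :
    ∃ V x, 𝓜.IsNonnegSupermartingale V ∧ (∀ ω, V 0 ω = x) ∧ x < c ∧ ∀ t ω, Y t ω ≤ V t ω := by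
  obtain ⟨x, ⟨V, hV, h0, h1⟩, hx⟩ := sInf_lt_iff.1 h
  exact ⟨V, x, hV, h0, hx, h1⟩

lemma upperExp_le {c : ℝ≥0∞} {V : ℝ≥0 → Ω → ℝ≥0∞} (hV : 𝓜.IsNonnegSupermartingale V)
    (h0 : ∀ ω, V 0 ω ≤ c) (h : ∀ t ω, Y t ω ≤ V t ω) : 𝓜.upperExp Y ≤ c := by
  rcases isEmpty_or_nonempty Ω with hΩ | ⟨⟨ω₀⟩⟩
  · exact sInf_le ⟨V, hV, fun ω => hΩ.elim ω, h⟩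
  · obtain ⟨y, hy⟩ := hV.exists_zero_eq
    exact le_trans (sInf_le ⟨V, hV, hy, h⟩) (hy ω₀ ▸ h0 ω₀)

variable [NeZero d]

lemma eventually_wie {P : ℝ≥0 × Ω → Prop} : (∀ᶠ p in 𝓜.wie, P p) ↔ 𝓜.Wie {p | P p} := Iff.rfl

lemma eventually_wie_all {P : ℕ → ℝ≥0 × Ω → Prop} :
    (∀ᶠ p in 𝓜.wie, ∀ n, P n p) ↔ ∀ n, ∀ᶠ p in 𝓜.wie, P n p := by
  refine ⟨fun h n => h.mono fun p hp => hp n, fun h => ?_⟩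
  refine (exists_enforcing_sequence (fun n => {p | P n p}) fun n => h n).mono fun p hp n => ?_
  exact mem_iInter.1 hp n

/-- Stopping the enforcing supermartingale at `τ` enforces the property at the stopped time. -/
lemma eventually_wie_stop {P : ℝ≥0 × Ω → Prop} (h : ∀ᶠ p in 𝓜.wie, P p) {τ : Ω → WithTop ℝ≥0}
    (hτ : IsStoppingTime 𝓜.𝓕 τ) : ∀ᶠ p in 𝓜.wie, P (cap p.1 (τ p.2), p.2) := by
  obtain ⟨V, hV, h0, h1⟩ := h
  refine ⟨_, hV.stopAt hτ, fun ω => ?_, fun t ω hn => h1 _ ω hn⟩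
  rw [show cap 0 (τ ω) = 0 from le_antisymm (cap_le 0 _) zero_le, h0]

/-! ### The upper expectation -/

/-- A bound that holds w.i.e. suffices for an upper expectation. -/
lemma upperExp_le_of_wie {c : ℝ≥0∞} {V : ℝ≥0 → Ω → ℝ≥0∞} (hV : 𝓜.IsNonnegSupermartingale V)
    (h0 : ∀ ω, V 0 ω ≤ c) (h : ∀ᶠ p in 𝓜.wie, Y p.1 p.2 ≤ V p.1 p.2) : 𝓜.upperExp Y ≤ c := by
  obtain ⟨U, hU, hU0, hU1⟩ := h
  refine ENNReal.le_of_forall_pos_le_add fun ε hε _ => ?_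
  -- The enforcing `U`, scaled by `ε`, is infinite wherever the bound fails and costs only `ε`.
  refine upperExp_le (hV.add_process (hU.const_mul (a := ε) ENNReal.coe_ne_top)) (fun ω => ?_)
    fun t ω => ?_
  · simpa [hU0] using h0 ω
  · by_cases hm : (t, ω) ∈ {p : ℝ≥0 × Ω | Y p.1 p.2 ≤ V p.1 p.2}
    · exact (show Y t ω ≤ V t ω from hm).trans le_self_add
    · rw [hU1 t ω hm, ENNReal.mul_top (by exact_mod_cast hε.ne'), add_top]
      exact le_top

lemma upperExp_mono (h : ∀ᶠ p in 𝓜.wie, Y p.1 p.2 ≤ Y' p.1 p.2) :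
    𝓜.upperExp Y ≤ 𝓜.upperExp Y' := by
  refine le_of_forall_gt fun (c : ℝ≥0∞) hc => ?_
  obtain ⟨V, x, hV, h0, hx, h1⟩ := exists_of_upperExp_lt hc
  refine lt_of_le_of_lt (upperExp_le_of_wie hV (fun ω => (h0 ω).le) ?_) hx
  exact h.mono fun p hp => hp.trans (h1 _ _)

lemma upperExp_const_mul_le {a : ℝ≥0∞} (ha : a ≠ ⊤) :
    (𝓜.upperExp fun t ω => a * Y t ω) ≤ a * 𝓜.upperExp Y := by
  rcases eq_or_ne a 0 with rfl | ha0
  · simp only [zero_mul]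
    exact upperExp_le (.const ENNReal.zero_ne_top) (fun _ => le_rfl) fun _ _ => le_rfl
  rw [mul_comm, ← ENNReal.div_le_iff_le_mul (Or.inl ha0) (Or.inl ha)]
  refine le_of_forall_gt fun c hc => ?_
  obtain ⟨V, x, hV, h0, hx, h1⟩ := exists_of_upperExp_lt hc
  refine lt_of_le_of_lt ?_ hx
  rw [ENNReal.div_le_iff_le_mul (Or.inl ha0) (Or.inl ha), mul_comm]
  exact upperExp_le (hV.const_mul ha) (fun ω => by rw [h0]) fun t ω => mul_le_mul_right (h1 t ω) a

lemma upperExp_tsum_le {Y : ℕ → ℝ≥0 → Ω → ℝ≥0∞} :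
    (𝓜.upperExp fun t ω => ∑' n, Y n t ω) ≤ ∑' n, 𝓜.upperExp (Y n) := by
  rcases eq_or_ne (∑' n, 𝓜.upperExp (Y n)) ⊤ with h | h
  · rw [h]; exact le_top
  refine ENNReal.le_of_forall_pos_le_add fun ε hε _ => ?_
  obtain ⟨δ, hδ, hδ'⟩ := ENNReal.exists_pos_sum_of_countable (ε := ε)
    (by exact_mod_cast hε.ne') ℕ
  have hlt : ∀ n, 𝓜.upperExp (Y n) < 𝓜.upperExp (Y n) + δ n := fun n =>
    ENNReal.lt_add_right (ENNReal.ne_top_of_tsum_ne_top h n) (by exact_mod_cast (hδ n).ne')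
  choose V x hV h0 hx h1 using fun n => exists_of_upperExp_lt (hlt n)
  refine (upperExp_le (.tsum hV) (c := ∑' n, (𝓜.upperExp (Y n) + δ n)) (fun ω => ?_)
    fun t ω => ENNReal.tsum_le_tsum fun n => h1 n t ω).trans ?_
  · exact ENNReal.tsum_le_tsum fun n => (h0 n ω).trans_le (hx n).le
  · rw [ENNReal.tsum_add]
    exact add_le_add le_rfl hδ'.le

lemma upperExp_add_le :
    (𝓜.upperExp fun t ω => Y t ω + Y' t ω) ≤ 𝓜.upperExp Y + 𝓜.upperExp Y' := by
  rcases eq_or_ne (𝓜.upperExp Y) ⊤ with h | h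
  · rw [h, top_add]; exact le_top
  rcases eq_or_ne (𝓜.upperExp Y') ⊤ with h' | h'
  · rw [h', add_top]; exact le_top
  refine ENNReal.le_of_forall_pos_le_add fun ε hε _ => ?_
  have hε2 : (ε / 2 : ℝ≥0∞) ≠ 0 := by simpa using hε.ne'
  obtain ⟨V, x, hV, h0, hx, h1⟩ := exists_of_upperExp_lt (ENNReal.lt_add_right h hε2)
  obtain ⟨V', x', hV', h0', hx', h1'⟩ := exists_of_upperExp_lt (ENNReal.lt_add_right h' hε2)
  refine (upperExp_le (hV.add_process hV') (c := x + x') (fun ω => by rw [h0, h0'])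
    fun t ω => add_le_add (h1 t ω) (h1' t ω)).trans ?_
  refine (add_le_add hx.le hx'.le).trans (le_of_eq ?_)
  rw [add_add_add_comm, ENNReal.add_halves]

lemma eventually_lt_top_of_upperExp (h : 𝓜.upperExp Y ≠ ⊤) : ∀ᶠ p in 𝓜.wie, Y p.1 p.2 < ⊤ := by
  obtain ⟨V, x, hV, h0, hx, h1⟩ := exists_of_upperExp_lt h.lt_top
  exact (hV.wie_lt_top hx.ne fun ω => (h0 ω).le).mono fun p hp => (h1 _ _).trans_lt hp

/-- Borel–Cantelli. -/
lemma eventually_tsum_lt_top {Y : ℕ → ℝ≥0 → Ω → ℝ≥0∞} (h : ∑' n, 𝓜.upperExp (Y n) ≠ ⊤) :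
    ∀ᶠ p in 𝓜.wie, ∑' n, Y n p.1 p.2 < ⊤ :=
  eventually_lt_top_of_upperExp (ne_top_of_le_ne_top h upperExp_tsum_le)

lemma eventually_tendsto_zero {Y : ℕ → ℝ≥0 → Ω → ℝ≥0∞} (h : ∑' n, 𝓜.upperExp (Y n) ≠ ⊤) :
    ∀ᶠ p in 𝓜.wie, Tendsto (fun n => Y n p.1 p.2) atTop (𝓝 0) := by
  filter_upwards [eventually_tsum_lt_top h] with p hp
  exact ENNReal.tendsto_atTop_zero_of_tsum_ne_top hp.ne

lemma eventually_eq_zero_of_upperExp (h : 𝓜.upperExp Y = 0) : ∀ᶠ p in 𝓜.wie, Y p.1 p.2 = 0 := by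
  have := eventually_tsum_lt_top (𝓜 := 𝓜) (Y := fun _ => Y) (by simp [h])
  filter_upwards [this] with p hp
  by_contra hne
  exact hp.ne (ENNReal.tsum_const_eq_top_of_ne_zero hne)

/-- Fatou's lemma. -/
lemma upperExp_le_of_liminf {Z : ℕ → ℝ≥0 → Ω → ℝ≥0∞} {c : ℕ → ℝ≥0∞} {c₀ : ℝ≥0∞}
    (hc : ∀ n, c n ≠ ⊤) (hlim : Tendsto c atTop (𝓝 c₀)) (hZ : ∀ n, 𝓜.upperExp (Z n) ≤ c n)
    (h : ∀ᶠ p in 𝓜.wie, Y p.1 p.2 ≤ liminf (fun n => Z n p.1 p.2) atTop) :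
    𝓜.upperExp Y ≤ c₀ := by
  -- The infimum in `upperExp` need not be attained; the slack `1 / (n + 1)` disappears in the
  -- limit.
  have hlt : ∀ n : ℕ, 𝓜.upperExp (Z n) < c n + (n + 1 : ℝ≥0∞)⁻¹ := fun n =>
    (hZ n).trans_lt (ENNReal.lt_add_right (hc n) (by simp))
  choose V x hV h0 hx h1 using fun n => exists_of_upperExp_lt (hlt n)
  refine upperExp_le_of_wie (.liminf V hV) (fun ω => ?_) ?_
  · have hl : Tendsto (fun n : ℕ => c n + (n + 1 : ℝ≥0∞)⁻¹) atTop (𝓝 (c₀ + 0)) := by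
      refine hlim.add ?_
      exact_mod_cast (tendsto_add_atTop_iff_nat 1).2 ENNReal.tendsto_inv_nat_nhds_zero
    rw [add_zero] at hl
    rw [← hl.liminf_eq]
    exact liminf_le_liminf (Eventually.of_forall fun n => (h0 n ω).trans_le (hx n).le)
  · filter_upwards [h] with p hp
    exact hp.trans (liminf_le_liminf (Eventually.of_forall fun n => h1 n _ _))

end MartingaleSpace
end ModelFree
end

/-! ### Real martingales and their closure properties. -/

noncomputable section
namespace ModelFree

variable {Ω : Type*} [mΩ : MeasurableSpace Ω]

/-! ### Uniform convergence on initial intervals -/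

lemma tendsto_iSup_abs_iff {y : ℕ → ℝ≥0 → ℝ} {z : ℝ≥0 → ℝ} {t : ℝ≥0} :
    Tendsto (fun n => ⨆ s ≤ t, ((z s : EReal) - (y n s : EReal)).abs) atTop (𝓝 0) ↔
      TendstoUniformlyOn y z atTop (Iic t) := by
  rw [Metric.tendstoUniformlyOn_iff, ENNReal.tendsto_nhds_zero]
  simp only [← EReal.coe_sub, EReal.abs_def, iSup_le_iff, ← Real.dist_eq]
  constructor
  · intro h ε hε
    filter_upwards [h (ENNReal.ofReal (ε / 2)) (by simpa using hε)] with n hn s hs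
    have := (ENNReal.ofReal_le_ofReal_iff (by positivity)).1 (hn s hs)
    linarith
  · intro h ε hε
    rcases eq_or_ne ε ⊤ with rfl | hε'
    · exact Eventually.of_forall fun _ _ _ => le_top
    · filter_upwards [h ε.toReal (ENNReal.toReal_pos hε.ne' hε')] with n hn s hs
      exact ENNReal.ofReal_le_of_le_toReal (hn s hs).le

lemma EReal.ne_of_abs_sub_coe_lt_top {x : EReal} {r : ℝ} (h : (x - r).abs < ⊤) :
    x ≠ ⊥ ∧ x ≠ ⊤ := by
  constructor <;> rintro rfl <;> simp at h

/-! ### Sums of increments along a locally finite sequence of times -/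

lemma exists_forall_lt_of_finite {τ : ℕ → WithTop ℝ≥0} {t : ℝ≥0} (h : {n | τ n ≤ t}.Finite) :
    ∃ K, ∀ n, K ≤ n → (t : WithTop ℝ≥0) < τ n := by
  obtain ⟨N, hN⟩ := h.bddAbove
  refine ⟨N + 1, fun n hn => ?_⟩
  by_contra hcon
  have := hN (show n ∈ {n | τ n ≤ t} from not_lt.1 hcon)
  omega

lemma cap_succ_eq_cap {τ : ℕ → WithTop ℝ≥0} (hmono : Monotone τ) {s t : ℝ≥0} {n : ℕ}
    (h : (t : WithTop ℝ≥0) < τ n) (hs : s ≤ t) : cap s (τ (n + 1)) = cap s (τ n) := by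
  have h2 : (s : WithTop ℝ≥0) ≤ τ n := (WithTop.coe_le_coe.2 hs).trans h.le
  rw [cap_of_le h2, cap_of_le (h2.trans (hmono (Nat.le_succ n)))]

lemma tsum_increments_eq_sum {τ : ℕ → WithTop ℝ≥0} (hmono : Monotone τ) {s t : ℝ≥0} {K : ℕ}
    (hK : ∀ n, K ≤ n → (t : WithTop ℝ≥0) < τ n) (hs : s ≤ t) (g : ℕ → ℝ) (f : ℝ≥0 → ℝ) :
    ∑' n, g n * (f (cap s (τ (n + 1))) - f (cap s (τ n))) =
      ∑ n ∈ Finset.range K, g n * (f (cap s (τ (n + 1))) - f (cap s (τ n))) := by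
  refine tsum_eq_sum fun n hn => ?_
  rw [cap_succ_eq_cap hmono (hK n (by simpa using hn)) hs, sub_self, mul_zero]

/-- Only finitely many increments before `t` are nonzero, so for large `k` neither the truncation of
the sum nor the clamp at `±k` is active. This is what admits unbounded positions in `RM.integral`.
-/
lemma eventually_sum_clamp_eq_tsum {τ : ℕ → WithTop ℝ≥0} (hmono : Monotone τ) {t : ℝ≥0}
    (hfin : {n | τ n ≤ t}.Finite) (g : ℕ → ℝ) (f : ℝ≥0 → ℝ) :
    ∀ᶠ k : ℕ in atTop, ∀ s ≤ t, ∑ n ∈ Finset.range k,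
      max (-(k : ℝ)) (min (g n) k) * (f (cap s (τ (n + 1))) - f (cap s (τ n))) =
        ∑' n, g n * (f (cap s (τ (n + 1))) - f (cap s (τ n))) := by
  obtain ⟨K, hK⟩ := exists_forall_lt_of_finite hfin
  obtain ⟨M, hM⟩ := exists_nat_ge (∑ n ∈ Finset.range K, |g n|)
  filter_upwards [eventually_ge_atTop (max M K)] with k hk s hs
  rw [tsum_increments_eq_sum hmono (K := k) (fun n hn => hK n (by omega)) hs]
  refine Finset.sum_congr rfl fun n _ => ?_
  by_cases hn : K ≤ n
  · rw [cap_succ_eq_cap hmono (hK n hn) hs, sub_self, mul_zero, mul_zero]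
  · have h1 : |g n| ≤ k := by
      refine ((Finset.single_le_sum (f := fun n => |g n|) (fun _ _ => abs_nonneg _)
        (Finset.mem_range.2 (by omega))).trans hM).trans ?_
      exact_mod_cast (le_max_left _ _).trans hk
    rw [abs_le] at h1
    rw [min_eq_left h1.2, max_eq_right h1.1]

namespace MartingaleSpace

variable {d : ℕ} {𝓜 : MartingaleSpace Ω d} [NeZero d]

lemma realPart_coe (x : ℝ≥0 → Ω → ℝ) : realPart (fun t ω => (x t ω : EReal)) = x := rfl

lemma wie_of_forall {P : ℝ≥0 × Ω → Prop} (h : ∀ p, P p) : 𝓜.Wie {p | P p} :=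
  eventually_wie.1 (Eventually.of_forall h)

variable (𝓜) in
/-- Real processes converge locally uniformly w.i.e. -/
def LocUnif (y : ℕ → ℝ≥0 → Ω → ℝ) (z : ℝ≥0 → Ω → ℝ) : Prop :=
  ∀ᶠ p in 𝓜.wie, TendstoUniformlyOn (fun n s => y n s p.2) (fun s => z s p.2) atTop (Iic p.1)

lemma locUnif_iff {y : ℕ → ℝ≥0 → Ω → ℝ} {z : ℝ≥0 → Ω → ℝ} :
    𝓜.LocUnif y z ↔
      𝓜.TendstoLocUnifWie (fun n t ω => (y n t ω : EReal)) fun t ω => (z t ω : EReal) := by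
  simp only [LocUnif, TendstoLocUnifWie, tendsto_iSup_abs_iff, eventually_wie]

variable (𝓜) in
/-- Real martingales. -/
def RM (x : ℝ≥0 → Ω → ℝ) : Prop := 𝓜.IsMartingale fun t ω => (x t ω : EReal)

lemma IsMartingale.adapted {X : ℝ≥0 → Ω → EReal} (hX : 𝓜.IsMartingale X) : Adapted 𝓜.𝓕 X := by
  cases hX with
  | simple K hK => exact fun t => measurable_coe_real_ereal.comp (hK.adapted t)
  | lim X Z hX hZ hreal hlim => exact hZ

lemma RM.adapted {x : ℝ≥0 → Ω → ℝ} (hx : 𝓜.RM x) : Adapted 𝓜.𝓕 x := fun t =>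
  measurable_ereal_toReal.comp (IsMartingale.adapted hx t)

/-- A value at finite distance from a real one is real, and local uniform convergence gives this on
all of `[0, t]` at once. Replacing infinite values by `0` thus changes nothing w.i.e., and the rest
of the proof can work with real processes. -/
lemma IsMartingale.realPart_aux {X : ℝ≥0 → Ω → EReal} (hX : 𝓜.IsMartingale X) :
    (∀ᶠ p in 𝓜.wie, ∀ s ≤ p.1, (realPart X s p.2 : EReal) = X s p.2) ∧ 𝓜.RM (realPart X) := by
  induction hX with
  | simple K hK =>
    refine ⟨Eventually.of_forall fun p s _ => by simp [realPart], ?_⟩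
    simpa [RM, realPart] using IsMartingale.simple K hK
  | lim X Z hX hZ hreal hlim ih =>
    have h1 : ∀ᶠ p in 𝓜.wie, ∀ n, ∀ s ≤ p.1, (realPart (X n) s p.2 : EReal) = X n s p.2 :=
      eventually_wie_all.2 fun n => (ih n).1
    have h2 : ∀ᶠ p in 𝓜.wie, Tendsto (fun n => ⨆ s ≤ p.1, (Z s p.2 - X n s p.2).abs) atTop (𝓝 0) :=
      hlim
    have h3 : ∀ᶠ p in 𝓜.wie, ∀ s ≤ p.1, (realPart Z s p.2 : EReal) = Z s p.2 := by
      filter_upwards [h1, h2] with p h1 h2 s hs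
      obtain ⟨n, hn⟩ := (h2.eventually_lt_const (zero_lt_one)).exists
      have h4 : (Z s p.2 - X n s p.2).abs < ⊤ :=
        ((le_iSup₂ (f := fun s (_ : s ≤ p.1) => (Z s p.2 - X n s p.2).abs) s hs).trans_lt hn).trans
          ENNReal.one_lt_top
      rw [← h1 n s hs] at h4
      have h5 := EReal.ne_of_abs_sub_coe_lt_top h4
      exact EReal.coe_toReal h5.2 h5.1
    refine ⟨h3, IsMartingale.lim (fun n t ω => (realPart (X n) t ω : EReal)) _ (fun n => (ih n).2)
      (fun t => measurable_coe_real_ereal.comp (measurable_ereal_toReal.comp (hZ t)))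
      (wie_of_forall fun p => ⟨EReal.coe_ne_bot _, EReal.coe_ne_top _⟩) ?_⟩
    change ∀ᶠ p in 𝓜.wie, _
    filter_upwards [h1, h2, h3] with p h1 h2 h3
    refine h2.congr fun n => iSup_congr fun s => iSup_congr fun hs => ?_
    rw [h1 n s hs, h3 s hs]

lemma IsMartingale.eventually_coe_realPart {X : ℝ≥0 → Ω → EReal} (hX : 𝓜.IsMartingale X) :
    ∀ᶠ p in 𝓜.wie, ∀ s ≤ p.1, (realPart X s p.2 : EReal) = X s p.2 := hX.realPart_aux.1

lemma IsMartingale.realPart {X : ℝ≥0 → Ω → EReal} (hX : 𝓜.IsMartingale X) :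
    𝓜.RM (realPart X) := hX.realPart_aux.2

/-- The constant sequence `x` converges locally uniformly w.i.e. to `X`. -/
lemma RM.isMartingale {X : ℝ≥0 → Ω → EReal} {x : ℝ≥0 → Ω → ℝ} (hx : 𝓜.RM x)
    (hX : Adapted 𝓜.𝓕 X) (h : ∀ᶠ p in 𝓜.wie, ∀ s ≤ p.1, X s p.2 = x s p.2) :
    𝓜.IsMartingale X := by
  refine .lim (fun _ t ω => (x t ω : EReal)) X (fun _ => hx) hX ?_ ?_
  · refine h.mono fun p hp => ?_
    change X p.1 p.2 ≠ ⊥ ∧ X p.1 p.2 ≠ ⊤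
    rw [hp p.1 le_rfl]
    exact ⟨EReal.coe_ne_bot _, EReal.coe_ne_top _⟩
  · change ∀ᶠ p in 𝓜.wie, _
    filter_upwards [h] with p hp
    refine tendsto_const_nhds.congr fun n => ?_
    symm
    rw [ENNReal.iSup_eq_zero]
    intro s
    rw [ENNReal.iSup_eq_zero]
    intro hs
    rw [hp s hs, ← EReal.coe_sub, sub_self]
    simp

/-- The induction principle of the class transferred to real processes, by passing to real parts
along the whole approximating sequence. -/
lemma RM.induction {P : (ℝ≥0 → Ω → ℝ) → Prop} (simple : ∀ K, 𝓜.IsSimpleCapital K → P K)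
    (lim : ∀ (y : ℕ → ℝ≥0 → Ω → ℝ) z, (∀ n, 𝓜.RM (y n)) → (∀ n, P (y n)) → 𝓜.RM z →
      𝓜.LocUnif y z → P z) {x : ℝ≥0 → Ω → ℝ} (hx : 𝓜.RM x) : P x := by
  have key : ∀ X, 𝓜.IsMartingale X → P (ModelFree.realPart X) := by
    intro X hX
    induction hX with
    | simple K hK => exact simple K hK
    | lim X Z hX hZ hreal hlim ih =>
      refine lim _ _ (fun n => (hX n).realPart) ih (IsMartingale.lim X Z hX hZ hreal hlim).realPart ?_
      have h1 : ∀ᶠ p in 𝓜.wie, ∀ n, ∀ s ≤ p.1, (ModelFree.realPart (X n) s p.2 : EReal) = X n s p.2 :=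
        eventually_wie_all.2 fun n => (hX n).eventually_coe_realPart
      filter_upwards [h1, (IsMartingale.lim X Z hX hZ hreal hlim).eventually_coe_realPart,
        show ∀ᶠ p in 𝓜.wie, _ from hlim] with p h1 h2 h3
      rw [← tendsto_iSup_abs_iff]
      refine Tendsto.congr (fun n => iSup_congr fun s => iSup_congr fun hs => ?_) h3
      rw [h1 n s hs, h2 s hs]
  exact key _ hx

lemma RM.of_simple {K : ℝ≥0 → Ω → ℝ} (hK : 𝓜.IsSimpleCapital K) : 𝓜.RM K := .simple K hK

lemma RM.const (c : ℝ) : 𝓜.RM fun _ _ => c := .of_simple (.const c)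

lemma RM.eventually_continuousOn {x : ℝ≥0 → Ω → ℝ} (hx : 𝓜.RM x) :
    ∀ᶠ p in 𝓜.wie, ContinuousOn (fun s => x s p.2) (Iic p.1) := by
  refine RM.induction (P := fun x => ∀ᶠ p in 𝓜.wie, ContinuousOn (fun s => x s p.2) (Iic p.1))
    (fun K hK => ?_) (fun y z _ ih _ hyz => ?_) hx
  · exact Eventually.of_forall fun p => (hK.continuous p.2).continuousOn
  · filter_upwards [hyz, eventually_wie_all.2 ih] with p h1 h2
    exact h1.continuousOn (Frequently.of_forall h2)

lemma exists_eq_of_measurable_zero {β : Type*} [MeasurableSpace β] [MeasurableSingletonClass β]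
    [Nonempty β] {f : Ω → β} (hf : Measurable[𝓜.𝓕 0] f) : ∃ x, ∀ ω, f ω = x := by
  rcases isEmpty_or_nonempty Ω with h | ⟨⟨ω₀⟩⟩
  · exact ⟨Classical.arbitrary β, fun ω => h.elim ω⟩
  refine ⟨f ω₀, fun ω => ?_⟩
  have := hf (measurableSet_singleton (f ω₀))
  rw [𝓜.trivial_zero, MeasurableSpace.measurableSet_bot_iff] at this
  rcases this with h | h
  · exact absurd (show ω₀ ∈ f ⁻¹' {f ω₀} from rfl) (by simp [h])
  · have : ω ∈ f ⁻¹' {f ω₀} := by simp [h]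
    exact this

lemma RM.exists_zero_eq {x : ℝ≥0 → Ω → ℝ} (hx : 𝓜.RM x) : ∃ c, ∀ ω, x 0 ω = c :=
  exists_eq_of_measurable_zero (hx.adapted 0)

/-! ### Completeness -/

variable [hA : Fact 𝓜.AssumptionA]

/-- Completeness from Assumption A: if `N` is the exceptional set at time `t`, then `{t} × (N ∩ A)`
is instantly blockable for every `A`, so each subset of `N` belongs to `𝓕 t`. Values of `F` on `N`
are therefore harmless. -/
lemma measurable_of_tendsto_wie {β : Type*} [TopologicalSpace β] [TopologicalSpace.PseudoMetrizableSpace β]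
    [MeasurableSpace β] [BorelSpace β] [Zero β] {t : ℝ≥0} {f : ℕ → Ω → β} {F : Ω → β}
    (hf : ∀ n, Measurable[𝓜.𝓕 t] (f n))
    (h : ∀ᶠ p in 𝓜.wie, p.1 = t → Tendsto (fun n => f n p.2) atTop (𝓝 (F p.2))) :
    Measurable[𝓜.𝓕 t] F := by
  set N : Set Ω := {ω | ¬ Tendsto (fun n => f n ω) atTop (𝓝 (F ω))} with hN
  have key : ∀ A : Set Ω, MeasurableSet[𝓜.𝓕 t] (N ∩ A) := by
    intro A
    have := hA.out t {p | p.1 = t ∧ p.2 ∈ N ∩ A} (h.mono fun p hp hp' => hp'.2.1 (hp hp'.1))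
    convert this using 1
    ext ω
    constructor
    · intro h
      exact ⟨t, le_rfl, rfl, h⟩
    · rintro ⟨s, -, -, h⟩
      exact h
  have hNm : MeasurableSet[𝓜.𝓕 t] N := by simpa using key univ
  have h1 : Measurable[𝓜.𝓕 t] (Nᶜ.indicator F) := by
    refine @measurable_of_tendsto_metrizable _ _ (𝓜.𝓕 t) _ _ _ _ _ _
      (fun n => (hf n).indicator hNm.compl) ?_
    rw [tendsto_pi_nhds]
    intro ω
    by_cases hω : ω ∈ N
    · simp only [indicator_of_notMem (show ω ∉ Nᶜ from not_not.2 hω)]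
      exact tendsto_const_nhds
    · simp only [indicator_of_mem (show ω ∈ Nᶜ from hω)]
      exact not_not.1 hω
  intro s hs
  have : F ⁻¹' s = (N ∩ F ⁻¹' s) ∪ (Nᶜ ∩ (Nᶜ.indicator F) ⁻¹' s) := by
    ext ω
    by_cases hω : ω ∈ N
    · simp [hω]
    · simp [hω, indicator]
  rw [this]
  exact (key _).union (hNm.compl.inter (h1 hs))

lemma adapted_of_tendsto_wie {β : Type*} [TopologicalSpace β] [TopologicalSpace.PseudoMetrizableSpace β]
    [MeasurableSpace β] [BorelSpace β] [Zero β] {y : ℕ → ℝ≥0 → Ω → β} {z : ℝ≥0 → Ω → β}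
    (hy : ∀ n, Adapted 𝓜.𝓕 (y n))
    (h : ∀ᶠ p in 𝓜.wie, Tendsto (fun n => y n p.1 p.2) atTop (𝓝 (z p.1 p.2))) :
    Adapted 𝓜.𝓕 z := fun t =>
  measurable_of_tendsto_wie (fun n => hy n t) (h.mono fun p hp h => h ▸ hp)

/-- A set that agrees w.i.e. with a measurable set is measurable. -/
lemma measurableSet_of_eventually_iff {t : ℝ≥0} {A B : Set Ω} (hB : MeasurableSet[𝓜.𝓕 t] B)
    (h : ∀ᶠ p in 𝓜.wie, p.1 = t → (p.2 ∈ A ↔ p.2 ∈ B)) : MeasurableSet[𝓜.𝓕 t] A := by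
  classical
  have h1 : Measurable[𝓜.𝓕 t] (A.indicator (fun _ => (1 : ℝ))) := by
    refine measurable_of_tendsto_wie (f := fun _ => B.indicator (fun _ => (1 : ℝ)))
      (fun _ => measurable_const.indicator hB) (h.mono fun p hp hpt => ?_)
    refine tendsto_const_nhds.congr fun _ => ?_
    by_cases hm : p.2 ∈ B
    · rw [indicator_of_mem hm, indicator_of_mem ((hp hpt).2 hm)]
    · rw [indicator_of_notMem hm, indicator_of_notMem (mt (hp hpt).1 hm)]
  convert h1 (measurableSet_singleton 1) using 1
  ext ω
  by_cases hm : ω ∈ A <;> simp [hm]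

/-! ### Closure properties of martingales -/

namespace RM

variable {x y : ℝ≥0 → Ω → ℝ}

/-- Adaptedness of the limit, which the definition of the class demands separately, comes for free
from completeness. -/
lemma of_locUnif {y : ℕ → ℝ≥0 → Ω → ℝ} {z : ℝ≥0 → Ω → ℝ} (hy : ∀ n, 𝓜.RM (y n))
    (h : 𝓜.LocUnif y z) : 𝓜.RM z := by
  have hz : Adapted 𝓜.𝓕 z := adapted_of_tendsto_wie (fun n => (hy n).adapted)
    (h.mono fun p hp => hp.tendsto_at (mem_Iic.2 le_rfl))
  exact IsMartingale.lim _ _ hy (fun t => measurable_coe_real_ereal.comp (hz t))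
    (wie_of_forall fun p => ⟨EReal.coe_ne_bot _, EReal.coe_ne_top _⟩) (locUnif_iff.1 h)

lemma of_eventually_eq {y : ℕ → ℝ≥0 → Ω → ℝ} {z : ℝ≥0 → Ω → ℝ} (hy : ∀ n, 𝓜.RM (y n))
    (h : ∀ᶠ p in 𝓜.wie, ∀ᶠ n in atTop, ∀ s ≤ p.1, y n s p.2 = z s p.2) : 𝓜.RM z := by
  refine of_locUnif hy (h.mono fun p hp => ?_)
  rw [Metric.tendstoUniformlyOn_iff]
  intro ε hε
  filter_upwards [hp] with n hn s hs
  rwa [hn s hs, dist_self]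

lemma congr (hx : 𝓜.RM x) (h : ∀ᶠ p in 𝓜.wie, ∀ s ≤ p.1, x s p.2 = y s p.2) : 𝓜.RM y :=
  of_eventually_eq (fun _ => hx) (h.mono fun _ hp => Eventually.of_forall fun _ => hp)

lemma add (hx : 𝓜.RM x) (hy : 𝓜.RM y) : 𝓜.RM fun t ω => x t ω + y t ω := by
  refine RM.induction (P := fun x => 𝓜.RM fun t ω => x t ω + y t ω) (fun K hK => ?_)
    (fun u z hu ih hz huz => ?_) hx
  · refine RM.induction (P := fun y => 𝓜.RM fun t ω => K t ω + y t ω) (fun L hL => ?_)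
      (fun u z hu ih hz huz => ?_) hy
    · exact of_simple (hK.add hL)
    · refine of_locUnif ih (huz.mono fun p hp => ?_)
      rw [Metric.tendstoUniformlyOn_iff] at hp ⊢
      simpa using hp
  · refine of_locUnif ih (huz.mono fun p hp => ?_)
    rw [Metric.tendstoUniformlyOn_iff] at hp ⊢
    simpa using hp

lemma const_mul (a : ℝ) (hx : 𝓜.RM x) : 𝓜.RM fun t ω => a * x t ω := by
  refine RM.induction (P := fun x => 𝓜.RM fun t ω => a * x t ω) (fun K hK => ?_)
    (fun u z hu ih hz huz => ?_) hx
  · exact of_simple (hK.const_mul a)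
  · refine of_locUnif ih (huz.mono fun p hp => ?_)
    exact (uniformContinuous_const_smul a).comp_tendstoUniformlyOn hp

lemma neg (hx : 𝓜.RM x) : 𝓜.RM fun t ω => - x t ω := by
  simpa using hx.const_mul (-1)

lemma sub (hx : 𝓜.RM x) (hy : 𝓜.RM y) : 𝓜.RM fun t ω => x t ω - y t ω := by
  simpa [sub_eq_add_neg] using hx.add hy.neg

lemma finset_sum {ι : Type*} (s : Finset ι) {f : ι → ℝ≥0 → Ω → ℝ} (hf : ∀ i, 𝓜.RM (f i)) :
    𝓜.RM fun t ω => ∑ i ∈ s, f i t ω := by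
  classical
  induction s using Finset.induction_on with
  | empty => simpa using const (𝓜 := 𝓜) 0
  | insert i s hi ih =>
    simp only [Finset.sum_insert hi]
    exact (hf i).add ih

lemma increment (hx : 𝓜.RM x) {a b : Ω → WithTop ℝ≥0} {g : Ω → ℝ} (ha : IsStoppingTime 𝓜.𝓕 a)
    (hb : IsStoppingTime 𝓜.𝓕 b) (hab : ∀ ω, a ω ≤ b ω) (hg : LocMeas 𝓜.𝓕 a g)
    (hgb : ∃ C : ℝ, ∀ ω, |g ω| ≤ C) :
    𝓜.RM fun t ω => g ω * (x (cap t (b ω)) ω - x (cap t (a ω)) ω) := by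
  refine RM.induction (P := fun x => 𝓜.RM fun t ω => g ω * (x (cap t (b ω)) ω - x (cap t (a ω)) ω))
    (fun K hK => ?_) (fun u z hu ih hz huz => ?_) hx
  · exact of_simple (hK.increment ha hb hab hg hgb)
  · refine of_locUnif ih (huz.mono fun p hp => ?_)
    have hcap : ∀ τ : WithTop ℝ≥0, TendstoUniformlyOn (fun n s => u n (cap s τ) p.2)
        (fun s => z (cap s τ) p.2) atTop (Iic p.1) := fun τ =>
      (hp.comp fun s => cap s τ).mono fun s hs => (cap_le s τ).trans hs
    exact (uniformContinuous_const_smul (g p.2)).comp_tendstoUniformlyOn ((hcap _).sub (hcap _))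

lemma stopAt (hx : 𝓜.RM x) {τ : Ω → WithTop ℝ≥0} (hτ : IsStoppingTime 𝓜.𝓕 τ) :
    𝓜.RM fun t ω => x (cap t (τ ω)) ω := by
  obtain ⟨c, hc⟩ := hx.exists_zero_eq
  have := (const (𝓜 := 𝓜) c).add (hx.increment isStoppingTime_zero hτ (fun _ => bot_le)
    (LocMeas.const isStoppingTime_zero 1) ⟨1, fun _ => by simp⟩)
  convert this using 3 with t ω
  simp [hc]

/-- Integrals of possibly unbounded step processes. -/
lemma integral (hx : 𝓜.RM x) {τ : ℕ → Ω → WithTop ℝ≥0} {g : ℕ → Ω → ℝ}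
    (hτ : ∀ n, IsStoppingTime 𝓜.𝓕 (τ n)) (hmono : ∀ ω, Monotone fun n => τ n ω)
    (hfin : ∀ᶠ p in 𝓜.wie, {n | τ n p.2 ≤ p.1}.Finite) (hg : ∀ n, LocMeas 𝓜.𝓕 (τ n) (g n)) :
    𝓜.RM fun t ω => ∑' n, g n ω * (x (cap t (τ (n + 1) ω)) ω - x (cap t (τ n ω)) ω) := by
  refine of_eventually_eq (y := fun k t ω => ∑ n ∈ Finset.range k,
    max (-(k : ℝ)) (min (g n ω) k) * (x (cap t (τ (n + 1) ω)) ω - x (cap t (τ n ω)) ω))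
    (fun k => finset_sum _ fun n => ?_) ?_
  · refine hx.increment (hτ n) (hτ (n + 1)) (fun ω => hmono ω (Nat.le_succ n))
      ((hg n).comp (hτ n) (fun u => max (-(k : ℝ)) (min u k))
        (measurable_const.max (measurable_id.min measurable_const))) ⟨k, fun ω => ?_⟩
    have hk : (0 : ℝ) ≤ k := k.cast_nonneg
    exact abs_le.2 ⟨le_max_left _ _, max_le (by linarith) (min_le_right _ _)⟩
  · filter_upwards [hfin] with p hp
    exact eventually_sum_clamp_eq_tsum (hmono p.2) hp (fun n => g n p.2) fun s => x s p.2

lemma strategy (hx : 𝓜.RM x) (G : SimpleStrategy 𝓜.𝓕) : 𝓜.RM (G.integral x) := by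
  have h : 𝓜.RM (G.normalize.integral x) := by
    refine (const (𝓜 := 𝓜) G.normalize.c).add (hx.integral (g := G.normalize.g)
      G.normalize.isStoppingTime G.normalize.monotone (Eventually.of_forall fun p => ?_)
      G.normalize.locMeas)
    obtain ⟨n, hn⟩ := G.normalize_unbounded p.2 p.1
    refine (finite_lt_nat n).subset fun k hk => ?_
    by_contra hcon
    exact absurd (hn.trans_le (G.normalize.monotone p.2 (not_lt.1 hcon))) (not_lt.2 hk)
  have e : G.normalize.integral x = G.integral x := by
    ext t ω
    exact G.normalize_integral x t ω
  rwa [e] at h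

end RM

end MartingaleSpace
end ModelFree
end

/-! ### Hitting times and the supermartingale property. -/

noncomputable section
namespace ModelFree

variable {Ω : Type*} [mΩ : MeasurableSpace Ω]

/-! ### Hitting times of continuous processes -/

/-- The first time at which `|z| ≥ c`. -/
def hit (z : ℝ≥0 → Ω → ℝ) (c : ℝ) : Ω → WithTop ℝ≥0 := hittingAfter z {r | c ≤ |r|} 0

lemma abs_lt_of_lt_hit {z : ℝ≥0 → Ω → ℝ} {c : ℝ} {s : ℝ≥0} {ω : Ω}
    (h : (s : WithTop ℝ≥0) < hit z c ω) : |z s ω| < c :=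
  not_le.1 fun hcon => notMem_of_lt_hittingAfter h zero_le hcon

lemma hit_lt_iff {z : ℝ≥0 → Ω → ℝ} {c : ℝ} {t : ℝ≥0} {ω : Ω} :
    hit z c ω < t ↔ ∃ s < t, c ≤ |z s ω| := by
  rw [hit, hittingAfter_lt_iff]
  simp

lemma le_hit {z : ℝ≥0 → Ω → ℝ} {c : ℝ} {t : ℝ≥0} {ω : Ω} (h : ∀ s < t, |z s ω| < c) :
    (t : WithTop ℝ≥0) ≤ hit z c ω := by
  rw [← not_lt, hit_lt_iff]
  rintro ⟨s, hs, hs'⟩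
  exact absurd (h s hs) (not_lt.2 hs')

/-- A continuous path stays in the closed ball up to the hitting time. -/
lemma abs_le_of_le_hit {z : ℝ≥0 → Ω → ℝ} {c : ℝ} {t s : ℝ≥0} {ω : Ω}
    (hc : ContinuousOn (fun s => z s ω) (Iic t)) (h0 : |z 0 ω| ≤ c) (hs : s ≤ t)
    (h : (s : WithTop ℝ≥0) ≤ hit z c ω) : |z s ω| ≤ c := by
  rcases eq_or_ne s 0 with rfl | hs0
  · exact h0
  have h1 : Tendsto (fun u => |z u ω|) (𝓝[<] s) (𝓝 |z s ω|) :=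
    ((hc s hs).mono_left (nhdsWithin_mono s fun u hu => hu.le.trans hs)).abs
  have : (𝓝[<] s).NeBot := nhdsLT_neBot_of_exists_lt ⟨0, pos_iff_ne_zero.2 hs0⟩
  refine le_of_tendsto h1 ?_
  filter_upwards [self_mem_nhdsWithin] with u hu
  exact (abs_lt_of_lt_hit ((WithTop.coe_lt_coe.2 hu).trans_le h)).le

/-- By compactness a level is reached on `[0, t]` if and only if it is approached along a dense
sequence. This replaces an uncountable union by countable operations. -/
lemma exists_abs_ge_iff {f : ℝ≥0 → ℝ} {c : ℝ} {t : ℝ≥0} (hf : ContinuousOn f (Iic t)) :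
    (∃ s ≤ t, c ≤ |f s|) ↔
      ∀ k : ℕ, ∃ i, c - 1 / (k + 1) < |f (TopologicalSpace.denseSeq (Iic t) i)| := by
  constructor
  · rintro ⟨s, hs, hs'⟩ k
    have hopen : IsOpen {u : Iic t | c - 1 / ((k : ℝ) + 1) < |f u|} :=
      isOpen_lt continuous_const (continuousOn_iff_continuous_domRestrict.1 hf).abs
    have hk : (0 : ℝ) < 1 / ((k : ℝ) + 1) := by positivity
    obtain ⟨i, hi⟩ := (TopologicalSpace.denseRange_denseSeq (Iic t)).exists_mem_open hopen
      ⟨⟨s, hs⟩, by change c - 1 / ((k : ℝ) + 1) < |f s|; linarith⟩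
    exact ⟨i, hi⟩
  · intro h
    have hK : IsCompact (Iic t) := by rw [← Icc_bot]; exact isCompact_Icc
    obtain ⟨s, hs, hmax⟩ := hK.exists_isMaxOn ⟨t, mem_Iic.2 le_rfl⟩ hf.abs
    refine ⟨s, hs, ?_⟩
    have hlim : Tendsto (fun k : ℕ => c - 1 / ((k : ℝ) + 1)) atTop (𝓝 (c - 0)) :=
      tendsto_const_nhds.sub tendsto_one_div_add_atTop_nhds_zero_nat
    rw [sub_zero] at hlim
    refine le_of_tendsto hlim (Eventually.of_forall fun k => ?_)
    obtain ⟨i, hi⟩ := h k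
    exact hi.le.trans (hmax (TopologicalSpace.denseSeq (Iic t) i).2)

namespace MartingaleSpace

variable {d : ℕ} {𝓜 : MartingaleSpace Ω d} [NeZero d]

/-- The enforcing supermartingale equals `1` at time `0`, so there is no exceptional path at that
time. -/
lemma eventually_wie_zero {P : ℝ≥0 × Ω → Prop} (h : ∀ᶠ p in 𝓜.wie, P p) (ω : Ω) : P (0, ω) := by
  obtain ⟨V, hV, h0, h1⟩ := h
  by_contra hcon
  exact ENNReal.one_ne_top ((h0 ω).symm.trans (h1 0 ω hcon))

variable [hA : Fact 𝓜.AssumptionA] [hR : 𝓜.𝓕.IsRightContinuous]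

/-- By right-continuity of the filtration only `{hit < t}` has to be examined. It is a union of
events of reaching the level by some earlier `r`, and each of these agrees w.i.e. with a set formed
from countably many times. -/
lemma isStoppingTime_hit {z : ℝ≥0 → Ω → ℝ} (hz : Adapted 𝓜.𝓕 z)
    (hc : ∀ᶠ p in 𝓜.wie, ContinuousOn (fun s => z s p.2) (Iic p.1)) (c : ℝ) :
    IsStoppingTime 𝓜.𝓕 (hit z c) := by
  refine isStoppingTime_of_measurableSet_lt_of_isRightContinuous fun t => ?_
  have key : ∀ r : ℝ≥0, MeasurableSet[𝓜.𝓕 r] {ω | ∃ s ≤ r, c ≤ |z s ω|} := by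
    intro r
    refine measurableSet_of_eventually_iff (B := ⋂ k : ℕ, ⋃ i,
      {ω | c - 1 / ((k : ℝ) + 1) < |z (TopologicalSpace.denseSeq (Iic r) i) ω|}) ?_ ?_
    · refine MeasurableSet.iInter fun k => MeasurableSet.iUnion fun i => ?_
      have h1 : Measurable[𝓜.𝓕 r] (z (TopologicalSpace.denseSeq (Iic r) i)) :=
        (hz _).mono (𝓜.𝓕.mono (TopologicalSpace.denseSeq (Iic r) i).2) le_rfl
      exact h1 (isOpen_lt continuous_const continuous_abs :
        IsOpen {u : ℝ | c - 1 / ((k : ℝ) + 1) < |u|}).measurableSet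
    · filter_upwards [hc] with p hp hpr
      subst hpr
      refine (exists_abs_ge_iff hp).trans ?_
      simp
  have : {ω | hit z c ω < t} = ⋃ n : ℕ, ⋃ (_ : t * (n / (n + 1)) < t),
      {ω | ∃ s ≤ t * (n / (n + 1)), c ≤ |z s ω|} := by
    ext ω
    simp only [mem_iUnion, exists_prop]
    change hit z c ω < t ↔ ∃ n : ℕ, t * (n / (n + 1)) < t ∧ ∃ s ≤ t * (n / (n + 1)), c ≤ |z s ω|
    rw [hit_lt_iff]
    constructor
    · rintro ⟨s, hs, hs'⟩
      have hl : Tendsto (fun n : ℕ => t * ((n : ℝ≥0) / (n + 1))) atTop (𝓝 (t * 1)) :=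
        tendsto_const_nhds.mul (tendsto_natCast_div_add_atTop 1)
      rw [mul_one] at hl
      obtain ⟨n, hn⟩ := (hl.eventually_const_lt hs).exists
      refine ⟨n, ?_, s, hn.le, hs'⟩
      have ht : 0 < t := zero_le.trans_lt hs
      refine mul_lt_of_lt_one_right ht ?_
      rw [div_lt_one (by positivity)]
      exact lt_add_one _
    · rintro ⟨n, hn, s, hs, hs'⟩
      exact ⟨s, hs.trans_lt hn, hs'⟩
  rw [this]
  exact MeasurableSet.iUnion fun n => MeasurableSet.iUnion fun h => 𝓜.𝓕.mono h.le _ (key _)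

/-! ### The supermartingale property of martingales -/

lemma RM.isStoppingTime_hit {x : ℝ≥0 → Ω → ℝ} (hx : 𝓜.RM x) (c : ℝ) :
    IsStoppingTime 𝓜.𝓕 (hit x c) :=
  MartingaleSpace.isStoppingTime_hit hx.adapted hx.eventually_continuousOn c

/-- Martingales that, with a nonnegative supermartingale, stay nonnegative up to a stopping time,
are dominated, with it, by a nonnegative supermartingale with nearly the same initial value. -/
lemma RM.exists_supermartingale {x : ℝ≥0 → Ω → ℝ} (hx : 𝓜.RM x) {τ : Ω → WithTop ℝ≥0}
    (hτ : IsStoppingTime 𝓜.𝓕 τ) {V : ℝ≥0 → Ω → ℝ≥0∞} (hV : 𝓜.IsNonnegSupermartingale V)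
    (h : ∀ᶠ p in 𝓜.wie, ENNReal.ofReal (-x (cap p.1 (τ p.2)) p.2) ≤ V p.1 p.2) {ε : ℝ} (hε : 0 < ε) :
    ∃ W, 𝓜.IsNonnegSupermartingale W ∧
      (∀ ω, W 0 ω ≤ ((V 0 ω : EReal) + ((x 0 ω + ε : ℝ) : EReal)).toENNReal) ∧
      ∀ᶠ p in 𝓜.wie, ((V p.1 p.2 : EReal) + (x (cap p.1 (τ p.2)) p.2 : EReal)).toENNReal ≤ W p.1 p.2 := by
  revert τ V ε
  refine RM.induction (P := fun x => ∀ {τ : Ω → WithTop ℝ≥0} (_ : IsStoppingTime 𝓜.𝓕 τ)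
    {V : ℝ≥0 → Ω → ℝ≥0∞} (_ : 𝓜.IsNonnegSupermartingale V)
    (_ : ∀ᶠ p in 𝓜.wie, ENNReal.ofReal (-x (cap p.1 (τ p.2)) p.2) ≤ V p.1 p.2) {ε : ℝ}
    (_ : 0 < ε), ∃ W, 𝓜.IsNonnegSupermartingale W ∧
      (∀ ω, W 0 ω ≤ ((V 0 ω : EReal) + ((x 0 ω + ε : ℝ) : EReal)).toENNReal) ∧
      ∀ᶠ p in 𝓜.wie, ((V p.1 p.2 : EReal) + (x (cap p.1 (τ p.2)) p.2 : EReal)).toENNReal ≤ W p.1 p.2)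
    (fun K hK τ hτ V hV h ε hε => ?_) (fun y z hy ih hz hyz τ hτ V hV h ε hε => ?_) hx
  · obtain ⟨U, hU, hU0, hU1⟩ := h
    -- The lower bound is assumed only w.i.e., whereas the class demands nonnegativity everywhere;
    -- `ε U` repairs the exceptions at cost `ε`.
    have hV' := hV.add_process (hU.const_mul (a := ENNReal.ofReal ε) ENNReal.ofReal_ne_top)
    have hnn : ∀ t ω, (0 : EReal) ≤ ((V t ω + ENNReal.ofReal ε * U t ω : ℝ≥0∞) : EReal) +
        (K (cap t (τ ω)) ω : EReal) := by
      intro t ω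
      by_cases hm : (t, ω) ∈ {p : ℝ≥0 × Ω | ENNReal.ofReal (-K (cap p.1 (τ p.2)) p.2) ≤ V p.1 p.2}
      · have h1 : (ENNReal.ofReal (-K (cap t (τ ω)) ω) : EReal) ≤
            ((V t ω + ENNReal.ofReal ε * U t ω : ℝ≥0∞) : EReal) :=
          EReal.coe_ennreal_le_coe_ennreal_iff.2 ((show _ ≤ V t ω from hm).trans le_self_add)
        rw [EReal.coe_ennreal_ofReal] at h1
        have h2 : ((-K (cap t (τ ω)) ω : ℝ) : EReal) ≤ (max (-K (cap t (τ ω)) ω) 0 : ℝ) :=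
          EReal.coe_le_coe_iff.2 (le_max_left _ _)
        calc (0 : EReal) = ((-K (cap t (τ ω)) ω : ℝ) : EReal) + (K (cap t (τ ω)) ω : EReal) := by
              rw [← EReal.coe_add]; simp
          _ ≤ _ := add_le_add_left (h2.trans h1) _
      · rw [hU1 t ω hm, ENNReal.mul_top (by simpa using hε), add_top, EReal.coe_ennreal_top,
          EReal.top_add_coe]
        exact le_top
    refine ⟨_, .add _ _ (fun t ω => (((V t ω + ENNReal.ofReal ε * U t ω : ℝ≥0∞) : EReal) +
        (K (cap t (τ ω)) ω : EReal)).toENNReal) hV' (hK.stopAt hτ)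
        fun t ω => EReal.coe_toENNReal (hnn t ω), fun ω => ?_, Eventually.of_forall fun p => ?_⟩
    · refine EReal.toENNReal_le_toENNReal ?_
      rw [hU0, mul_one, show cap 0 (τ ω) = 0 from le_antisymm (cap_le 0 _) zero_le,
        EReal.coe_ennreal_add, EReal.coe_ennreal_ofReal, max_eq_left hε.le, EReal.coe_add, add_assoc,
        add_comm (K 0 ω : EReal)]
    · refine EReal.toENNReal_le_toENNReal (add_le_add_left ?_ _)
      exact EReal.coe_ennreal_le_coe_ennreal_iff.2 le_self_add
  · rcases isEmpty_or_nonempty Ω with hΩ | ⟨⟨ω₀⟩⟩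
    · exact ⟨V, hV, fun ω => hΩ.elim ω, Eventually.of_forall fun p => hΩ.elim p.2⟩
    -- Three amounts `η` are spent: one on the constant added to `V`, one on the initial discrepancy
    -- between `y n` and `z`, one on the induction hypothesis.
    set η := ε / 4 with hη
    have hη0 : 0 < η := by positivity
    have hsub : ∀ n, 𝓜.RM fun t ω => y n t ω - z t ω := fun n => (hy n).sub hz
    -- Up to `ρ n` the approximant differs from `z` by at most `η`, so `V + η` can bear its losses
    -- and the induction hypothesis applies to the process stopped at `ρ n`.
    set ρ : ℕ → Ω → WithTop ℝ≥0 := fun n => hit (fun t ω => y n t ω - z t ω) η with hρ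
    have hρs : ∀ n, IsStoppingTime 𝓜.𝓕 (ρ n) := fun n => (hsub n).isStoppingTime_hit η
    obtain ⟨N, hN⟩ : ∃ N, ∀ n, N ≤ n → ∀ ω, |y n 0 ω - z 0 ω| ≤ η := by
      have h1 := Metric.tendstoUniformlyOn_iff.1 (eventually_wie_zero hyz ω₀) η hη0
      obtain ⟨N, hN⟩ := eventually_atTop.1 h1
      refine ⟨N, fun n hn ω => ?_⟩
      obtain ⟨c, hc⟩ := (hsub n).exists_zero_eq
      have h2 := hN n hn 0 (mem_Iic.2 le_rfl)
      rw [dist_comm, Real.dist_eq] at h2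
      have h3 := hc ω
      have h4 := hc ω₀
      rw [h3, ← h4]
      exact h2.le
    have hcond : ∀ n, N ≤ n → ∀ᶠ p in 𝓜.wie,
        ENNReal.ofReal (-y n (cap p.1 (min (τ p.2) (ρ n p.2))) p.2) ≤
          V (cap p.1 (ρ n p.2)) p.2 + ENNReal.ofReal η := by
      intro n hn
      filter_upwards [eventually_wie_stop h (hρs n), (hsub n).eventually_continuousOn] with p h1 h2
      have h1' : ENNReal.ofReal (-z (cap (cap p.1 (ρ n p.2)) (τ p.2)) p.2) ≤
        V (cap p.1 (ρ n p.2)) p.2 := h1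
      rw [cap_cap, min_comm] at h1'
      have h3 := abs_le_of_le_hit h2 (hN n hn p.2) (cap_le p.1 (min (τ p.2) (ρ n p.2)))
        ((coe_cap_le _ _).trans (min_le_right _ _))
      refine le_trans ?_ (add_le_add_left h1' _)
      rw [abs_le] at h3
      exact (ENNReal.ofReal_le_ofReal (by linarith)).trans ENNReal.ofReal_add_le
    have hW := fun n => ih (n + N) (hτ.min (hρs (n + N)))
      ((hV.stopAt (hρs (n + N))).add_process (.const (ENNReal.ofReal_ne_top (r := η))))
      (hcond _ (by omega)) hη0
    choose W hWs hW0 hW1 using hW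
    refine ⟨_, .liminf W hWs, fun ω => ?_, ?_⟩
    · refine liminf_le_of_frequently_le' (Frequently.of_forall fun n => (hW0 n ω).trans ?_)
      refine EReal.toENNReal_le_toENNReal ?_
      rw [show cap 0 (ρ (n + N) ω) = 0 from le_antisymm (cap_le 0 _) zero_le,
        EReal.coe_ennreal_add, EReal.coe_ennreal_ofReal, max_eq_left hη0.le, add_assoc,
        ← EReal.coe_add]
      refine add_le_add_right (EReal.coe_le_coe_iff.2 ?_) _
      have := abs_le.1 (hN (n + N) (by omega) ω)
      linarith
    · filter_upwards [eventually_wie_all.2 hW1, hyz] with p h1 h2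
      refine le_liminf_of_le (by isBoundedDefault) ?_
      rw [Metric.tendstoUniformlyOn_iff] at h2
      filter_upwards [(tendsto_add_atTop_nat N).eventually (h2 η hη0)] with n hn
      -- Uniform convergence on `[0, t]` pushes `ρ n` beyond `t`, so that stopping at it becomes
      -- invisible in the limit inferior.
      have hle : (p.1 : WithTop ℝ≥0) ≤ ρ (n + N) p.2 := le_hit fun s hs => by
        have := hn s (mem_Iic.2 hs.le)
        rwa [dist_comm, Real.dist_eq] at this
      refine le_trans (EReal.toENNReal_le_toENNReal ?_) (h1 n)
      have e1 : cap p.1 (min (τ p.2) (ρ (n + N) p.2)) = cap p.1 (τ p.2) := by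
        rw [min_comm, ← cap_cap, cap_of_le hle]
      rw [e1, cap_of_le hle, EReal.coe_ennreal_add, EReal.coe_ennreal_ofReal, max_eq_left hη0.le,
        add_assoc, ← EReal.coe_add]
      refine add_le_add_right (EReal.coe_le_coe_iff.2 ?_) _
      have := hn (cap p.1 (τ p.2)) (mem_Iic.2 (cap_le _ _))
      rw [Real.dist_eq, abs_lt] at this
      linarith

/-- A nonnegative martingale bounds the upper expectation of what it dominates. -/
lemma RM.upperExp_le {x : ℝ≥0 → Ω → ℝ} (hx : 𝓜.RM x) {Y : ℝ≥0 → Ω → ℝ≥0∞}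
    (h0 : ∀ᶠ p in 𝓜.wie, 0 ≤ x p.1 p.2)
    (hY : ∀ᶠ p in 𝓜.wie, Y p.1 p.2 ≤ ENNReal.ofReal (x p.1 p.2)) {c : ℝ} (hc : ∀ ω, x 0 ω ≤ c) :
    𝓜.upperExp Y ≤ ENNReal.ofReal c := by
  refine ENNReal.le_of_forall_pos_le_add fun ε hε _ => ?_
  obtain ⟨W, hW, hW0, hW1⟩ := hx.exists_supermartingale isStoppingTime_top
    (.const ENNReal.zero_ne_top) (h0.mono fun p hp => by simpa using hp)
    (ε := ε) (by exact_mod_cast hε)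
  refine upperExp_le_of_wie hW (fun ω => (hW0 ω).trans ?_) ?_
  · rw [EReal.coe_ennreal_zero, zero_add, EReal.real_coe_toENNReal]
    refine (ENNReal.ofReal_le_ofReal (add_le_add_left (hc ω) _)).trans ?_
    exact ENNReal.ofReal_add_le.trans (by rw [ENNReal.ofReal_coe_nnreal])
  · filter_upwards [hY, hW1] with p h1 h2
    refine h1.trans (le_trans (le_of_eq ?_) h2)
    simp

end MartingaleSpace
end ModelFree
end

/-! ### Second moments: maximal inequality, completeness, bounds for simple integrals. -/

noncomputable section
namespace ModelFree

variable {Ω : Type*} [mΩ : MeasurableSpace Ω]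

lemma hit_le {z : ℝ≥0 → Ω → ℝ} {c : ℝ} {s : ℝ≥0} {ω : Ω} (h : c ≤ |z s ω|) : hit z c ω ≤ s :=
  hittingAfter_le_of_mem zero_le h

/-- The closed set of times in `[0, t]` at which the level is reached is compact; its least element
is the hitting time, so the level is attained there. -/
lemma exists_isLeast_abs_ge {z : ℝ≥0 → Ω → ℝ} {c : ℝ} {t s : ℝ≥0} {ω : Ω}
    (hc : ContinuousOn (fun s => z s ω) (Iic t)) (hs : s ≤ t) (h : c ≤ |z s ω|) :
    c ≤ |z (cap t (hit z c ω)) ω| := by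
  have hK : IsCompact (Iic t ∩ (fun s => |z s ω|) ⁻¹' Ici c) := by
    have : IsCompact (Iic t) := by rw [← Icc_bot]; exact isCompact_Icc
    exact this.of_isClosed_subset (hc.abs.preimage_isClosed_of_isClosed isClosed_Iic isClosed_Ici)
      inter_subset_left
  obtain ⟨m, hm, hmin⟩ := hK.exists_isLeast ⟨s, hs, h⟩
  have h1 : hit z c ω = m := by
    refine le_antisymm (hit_le hm.2) (le_hit fun u hu => ?_)
    by_contra hcon
    exact absurd (hmin ⟨hu.le.trans hm.1, not_lt.1 hcon⟩) (not_le.2 hu)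
  rw [h1, cap_coe, min_eq_right hm.1]
  exact hm.2

namespace MartingaleSpace

variable {d : ℕ} {𝓜 : MartingaleSpace Ω d} [NeZero d] [hA : Fact 𝓜.AssumptionA]
  [hR : 𝓜.𝓕.IsRightContinuous]

/-! ### Second moment bounds -/

variable (𝓜) in
/-- The second moment of `z` at all stopping times is at most `c`. -/
def L2Bound (z : ℝ≥0 → Ω → ℝ) (c : ℝ) : Prop :=
  ∀ ρ : Ω → WithTop ℝ≥0, IsStoppingTime 𝓜.𝓕 ρ →
    𝓜.upperExp (fun t ω => ENNReal.ofReal ((z (cap t (ρ ω)) ω) ^ 2)) ≤ ENNReal.ofReal c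

/-- The mechanism behind every second moment bound below: `c + W`, stopped, is a nonnegative
martingale with initial value `c`. -/
lemma L2Bound.of_RM {z W : ℝ≥0 → Ω → ℝ} {c : ℝ} (hW : 𝓜.RM W) (hW0 : ∀ ω, W 0 ω = 0)
    (h : ∀ᶠ p in 𝓜.wie, z p.1 p.2 ^ 2 ≤ c + W p.1 p.2) : 𝓜.L2Bound z c := by
  intro ρ hρ
  have h1 := eventually_wie_stop h hρ
  refine ((RM.const c).add (hW.stopAt hρ)).upperExp_le (h1.mono fun p hp => (sq_nonneg _).trans hp)
    (h1.mono fun p hp => ENNReal.ofReal_le_ofReal hp) fun ω => ?_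
  rw [show cap 0 (ρ ω) = 0 from le_antisymm (cap_le 0 _) zero_le, hW0, add_zero]

lemma L2Bound.mono {z : ℝ≥0 → Ω → ℝ} {c c' : ℝ} (h : 𝓜.L2Bound z c) (hc : c ≤ c') :
    𝓜.L2Bound z c' := fun ρ hρ => (h ρ hρ).trans (ENNReal.ofReal_le_ofReal hc)

lemma L2Bound.of_tendsto {y : ℕ → ℝ≥0 → Ω → ℝ} {z : ℝ≥0 → Ω → ℝ} {c : ℕ → ℝ} {c₀ : ℝ}
    (h : ∀ n, 𝓜.L2Bound (y n) (c n)) (hc : Tendsto c atTop (𝓝 c₀))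
    (hy : ∀ᶠ p in 𝓜.wie, Tendsto (fun n => y n p.1 p.2) atTop (𝓝 (z p.1 p.2))) :
    𝓜.L2Bound z c₀ := by
  intro ρ hρ
  refine upperExp_le_of_liminf (fun n => ENNReal.ofReal_ne_top) (ENNReal.tendsto_ofReal hc)
    (fun n => h n ρ hρ) ?_
  filter_upwards [eventually_wie_stop hy hρ] with p hp
  exact (ENNReal.tendsto_ofReal (Tendsto.pow hp 2)).liminf_eq.ge

-- Chebyshev's inequality at the hitting time of `r`, where continuity gives `|z| ≥ r` if the level
-- is reached at all. Requiring `L2Bound` at all stopping times makes Doob's maximal inequality this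
-- simple.
open Classical in
lemma L2Bound.upperExp_sup_ge {z : ℝ≥0 → Ω → ℝ} {c : ℝ} (h : 𝓜.L2Bound z c) (hz : 𝓜.RM z)
    {r : ℝ} (hr : 0 < r) :
    𝓜.upperExp (fun t ω => if ∃ s ≤ t, r ≤ |z s ω| then 1 else 0) ≤ ENNReal.ofReal (c / r ^ 2) := by
  have h1 : (𝓜.upperExp fun t ω => ENNReal.ofReal (1 / r ^ 2) *
      ENNReal.ofReal ((z (cap t (hit z r ω)) ω) ^ 2)) ≤ ENNReal.ofReal (c / r ^ 2) := by
    refine (upperExp_const_mul_le ENNReal.ofReal_ne_top).trans ?_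
    rw [div_eq_mul_one_div c, mul_comm c, ENNReal.ofReal_mul (by positivity)]
    exact mul_le_mul_right (h _ (hz.isStoppingTime_hit r)) _
  refine (upperExp_mono ?_).trans h1
  filter_upwards [hz.eventually_continuousOn] with p hp
  split_ifs with hs
  · obtain ⟨s, hs, hs'⟩ := hs
    have h2 := exists_isLeast_abs_ge hp hs hs'
    rw [← ENNReal.ofReal_mul (by positivity)]
    refine ENNReal.one_le_ofReal.2 ?_
    rw [one_div, inv_mul_eq_div, le_div_iff₀ (by positivity), one_mul, ← sq_abs (z _ _)]
    exact pow_le_pow_left₀ hr.le h2 2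
  · exact zero_le

/-- A first moment bound for the maximal function. -/
lemma L2Bound.upperExp_iSup_le {z : ℝ≥0 → Ω → ℝ} {a : ℝ} (ha : 0 < a) (h : 𝓜.L2Bound z (a ^ 2))
    (hz : 𝓜.RM z) : 𝓜.upperExp (fun t ω => ⨆ s ≤ t, ENNReal.ofReal |z s ω|) ≤ ENNReal.ofReal (5 * a) := by
  classical
  -- Dyadic layers of the supremum: the part below `a` costs `a`, and layer `k` costs at most `a
  -- 2ᵏ⁺¹ · a² / (a 2ᵏ)² = 2 a 2⁻ᵏ`. The layers sum to `4 a`, which gives `5 a`.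
  set B : ℕ → ℝ≥0 → Ω → ℝ≥0∞ := fun k t ω => if ∃ s ≤ t, a * 2 ^ k ≤ |z s ω| then 1 else 0 with hB
  have h1 : ∀ t ω, ⨆ s ≤ t, ENNReal.ofReal |z s ω| ≤ ENNReal.ofReal a +
      ∑' k, ENNReal.ofReal (a * 2 ^ (k + 1)) * B k t ω := by
    intro t ω
    refine iSup₂_le fun s hs => ?_
    rcases lt_or_ge |z s ω| a with hlt | hge
    · exact (ENNReal.ofReal_le_ofReal hlt.le).trans le_self_add
    · obtain ⟨k, hk, hk'⟩ := exists_nat_pow_near (x := |z s ω| / a) (y := 2)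
        ((one_le_div ha).2 hge) one_lt_two
      rw [le_div_iff₀ ha, mul_comm] at hk
      rw [div_lt_iff₀ ha, mul_comm] at hk'
      refine le_trans ?_ (le_add_self (a := ∑' k, ENNReal.ofReal (a * 2 ^ (k + 1)) * B k t ω))
      refine le_trans ?_ (ENNReal.le_tsum k)
      rw [hB]
      dsimp only
      rw [if_pos ⟨s, hs, hk⟩, mul_one]
      exact ENNReal.ofReal_le_ofReal hk'.le
  refine (upperExp_mono (Y' := fun t ω => ENNReal.ofReal a +
    ∑' k, ENNReal.ofReal (a * 2 ^ (k + 1)) * B k t ω)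
    (Eventually.of_forall fun p => h1 p.1 p.2)).trans (upperExp_add_le.trans ?_)
  have h2 : 𝓜.upperExp (fun _ _ => ENNReal.ofReal a) ≤ ENNReal.ofReal a :=
    MartingaleSpace.upperExp_le (.const ENNReal.ofReal_ne_top) (fun _ => le_rfl) fun _ _ => le_rfl
  have hs : HasSum (fun k : ℕ => (1 / 2 : ℝ) ^ k * (2 * a)) (2 * (2 * a)) :=
    hasSum_geometric_two.mul_right (2 * a)
  have h3 : 𝓜.upperExp (fun t ω => ∑' k, ENNReal.ofReal (a * 2 ^ (k + 1)) * B k t ω) ≤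
      ENNReal.ofReal (2 * (2 * a)) := by
    refine upperExp_tsum_le.trans ?_
    rw [← hs.tsum_eq, ENNReal.ofReal_tsum_of_nonneg (fun _ => by positivity) hs.summable]
    refine ENNReal.tsum_le_tsum fun k => (upperExp_const_mul_le ENNReal.ofReal_ne_top).trans ?_
    refine (mul_le_mul_right (h.upperExp_sup_ge hz (r := a * 2 ^ k) (by positivity)) _).trans ?_
    rw [← ENNReal.ofReal_mul (by positivity)]
    refine ENNReal.ofReal_le_ofReal (le_of_eq ?_)
    rw [one_div, inv_pow]
    field_simp
    exact pow_succ 2 k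
  refine (add_le_add h2 h3).trans ?_
  rw [← ENNReal.ofReal_add ha.le (by positivity)]
  exact ENNReal.ofReal_le_ofReal (by linarith)

/-- The maximal inequality at level `√(δ j)` costs `a δ j`, which is summable; Borel–Cantelli does
the rest. -/
lemma eventually_abs_lt_of_L2Bound {z : ℕ → ℝ≥0 → Ω → ℝ} {a : ℝ} {δ : ℕ → ℝ} (hz : ∀ j, 𝓜.RM (z j))
    (hδ : ∀ j, 0 < δ j) (hs : Summable δ) (ha : 0 ≤ a) (h : ∀ j, 𝓜.L2Bound (z j) (a * δ j ^ 2)) :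
    ∀ᶠ p in 𝓜.wie, ∀ᶠ j in atTop, ∀ s ≤ p.1, |z j s p.2| < √(δ j) := by
  classical
  have h1 : ∑' j, 𝓜.upperExp (fun t ω => if ∃ s ≤ t, √(δ j) ≤ |z j s ω| then 1 else 0) ≠ ⊤ := by
    have h2 : ∑' j, ENNReal.ofReal (a * δ j) ≠ ⊤ := by
      rw [← ENNReal.ofReal_tsum_of_nonneg (fun j => mul_nonneg ha (hδ j).le) (hs.mul_left a)]
      exact ENNReal.ofReal_ne_top
    refine ne_top_of_le_ne_top h2 (ENNReal.tsum_le_tsum fun j => ?_)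
    refine ((h j).upperExp_sup_ge (hz j) (Real.sqrt_pos.2 (hδ j))).trans_eq ?_
    rw [Real.sq_sqrt (hδ j).le, pow_two, ← mul_assoc, mul_div_cancel_right₀ _ (hδ j).ne']
  filter_upwards [eventually_tendsto_zero h1] with p hp
  filter_upwards [hp.eventually_lt_const zero_lt_one] with j hj s hs
  by_contra hcon
  rw [if_pos ⟨s, hs, not_lt.1 hcon⟩] at hj
  exact lt_irrefl _ hj

/-! ### Completeness for second moments -/

variable (𝓜) in
/-- A localizing sequence of stopping times. -/
def Localizing (ρ : ℕ → Ω → WithTop ℝ≥0) : Prop :=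
  (∀ N, IsStoppingTime 𝓜.𝓕 (ρ N)) ∧ ∀ᶠ p in 𝓜.wie, ∃ N, (p.1 : WithTop ℝ≥0) ≤ ρ N p.2

/-- The Borel–Cantelli bound is applied to each of the countably many stopped processes; on a given
interval `[0, t]` some `ρ N` does not stop before `t`. -/
lemma locUnif_of_L2Bound {m : ℕ → ℝ≥0 → Ω → ℝ} {L : ℝ≥0 → Ω → ℝ} {ρ : ℕ → Ω → WithTop ℝ≥0}
    (hρ : 𝓜.Localizing ρ) {a : ℕ → ℝ} {δ : ℕ → ℝ} (ha : ∀ N, 0 ≤ a N) (hm : ∀ j, 𝓜.RM (m j))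
    (hL : 𝓜.RM L) (hδ : ∀ j, 0 < δ j) (hs : Summable δ)
    (h : ∀ N j, 𝓜.L2Bound (fun t ω => m j (cap t (ρ N ω)) ω - L (cap t (ρ N ω)) ω) (a N * δ j ^ 2)) :
    𝓜.LocUnif m L := by
  have h1 := eventually_wie_all.2 fun N => eventually_abs_lt_of_L2Bound
    (fun j => ((hm j).stopAt (hρ.1 N)).sub (hL.stopAt (hρ.1 N))) hδ hs (ha N) (h N)
  filter_upwards [h1, hρ.2] with p h1 ⟨N, hN⟩
  rw [Metric.tendstoUniformlyOn_iff]
  intro ε hε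
  have h2 : Tendsto (fun j => √(δ j)) atTop (𝓝 0) := by
    simpa using hs.tendsto_atTop_zero.sqrt
  filter_upwards [h1 N, h2.eventually_lt_const hε] with j hj hj' s hs
  have h3 := hj s hs
  rw [cap_of_le ((WithTop.coe_le_coe.2 hs).trans hN)] at h3
  rw [dist_comm, Real.dist_eq]
  exact h3.trans hj'

/-- Successive differences are eventually below `2⁻ʲ` uniformly on `[0, t]`, so the paths converge
geometrically. Fatou's lemma then carries the second moment bound over to the limit. -/
lemma exists_limit_of_L2Bound {m : ℕ → ℝ≥0 → Ω → ℝ} {ρ : ℕ → Ω → WithTop ℝ≥0}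
    (hρ : 𝓜.Localizing ρ) {a : ℕ → ℝ} (ha : ∀ N, 0 ≤ a N) (hm : ∀ j, 𝓜.RM (m j))
    (h : ∀ N i j, 𝓜.L2Bound (fun t ω => m i (cap t (ρ N ω)) ω - m j (cap t (ρ N ω)) ω)
      (a N * ((1 / 4) ^ i + (1 / 4) ^ j) ^ 2)) :
    ∃ L, 𝓜.RM L ∧ 𝓜.LocUnif m L ∧ ∀ N j,
      𝓜.L2Bound (fun t ω => m j (cap t (ρ N ω)) ω - L (cap t (ρ N ω)) ω)
        (a N * ((1 / 4) ^ j) ^ 2) := by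
  have hs4 : Summable fun j : ℕ => (1 / 4 : ℝ) ^ j :=
    summable_geometric_of_lt_one (by norm_num) (by norm_num)
  -- The factor `4` comes from `(4⁻⁽ʲ⁺¹⁾ + 4⁻ʲ)² ≤ 4 (4⁻ʲ)²`.
  have h1 := eventually_wie_all.2 fun N => eventually_abs_lt_of_L2Bound
    (z := fun j t ω => m (j + 1) (cap t (ρ N ω)) ω - m j (cap t (ρ N ω)) ω) (a := a N * 4)
    (δ := fun j => (1 / 4) ^ j)
    (fun j => ((hm (j + 1)).stopAt (hρ.1 N)).sub ((hm j).stopAt (hρ.1 N))) (fun j => by positivity)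
    hs4 (mul_nonneg (ha N) (by norm_num)) (fun j => (h N (j + 1) j).mono (by
      rw [mul_assoc]
      refine mul_le_mul_of_nonneg_left ?_ (ha N)
      have : (0 : ℝ) < (1 / 4) ^ j := by positivity
      rw [pow_succ (1 / 4 : ℝ) j]
      nlinarith))
  have hsqrt : ∀ j : ℕ, √((1 / 4 : ℝ) ^ j) = (1 / 2) ^ j := fun j => by
    rw [Real.sqrt_eq_iff_mul_self_eq (by positivity) (by positivity), ← mul_pow]; norm_num
  -- Where the sequence diverges the value is arbitrary; this is confined to an instantly blockable
  -- set and causes no problem with adaptedness, by completeness.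
  set L : ℝ≥0 → Ω → ℝ := fun t ω => limUnder atTop fun j => m j t ω with hL
  have hunif : 𝓜.LocUnif m L := by
    filter_upwards [h1, hρ.2] with p h1 ⟨N, hN⟩
    obtain ⟨J, hJ⟩ := eventually_atTop.1 (h1 N)
    have hstep : ∀ j, J ≤ j → ∀ s ≤ p.1, dist (m j s p.2) (m (j + 1) s p.2) ≤ (1 / 2) ^ j := by
      intro j hj s hs
      have := hJ j hj s hs
      rw [hsqrt, cap_of_le ((WithTop.coe_le_coe.2 hs).trans hN)] at this
      rw [dist_comm, Real.dist_eq]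
      exact this.le
    have hdist : ∀ s ≤ p.1, ∀ j, J ≤ j → dist (m j s p.2) (L s p.2) ≤ 2 * (1 / 2) ^ j := by
      intro s hs j hj
      have hcau : ∀ n, dist (m (n + j) s p.2) (m (n + 1 + j) s p.2) ≤ (1 / 2) ^ j * (1 / 2) ^ n := by
        intro n
        have := hstep (n + j) (by omega) s hs
        rw [pow_add, mul_comm] at this
        rwa [show n + 1 + j = n + j + 1 by omega]
      have hc := cauchySeq_of_le_geometric (1 / 2) ((1 / 2 : ℝ) ^ j) (by norm_num) hcau
      obtain ⟨l, hl⟩ := cauchySeq_tendsto_of_complete hc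
      have hl' : Tendsto (fun i => m i s p.2) atTop (𝓝 l) := (tendsto_add_atTop_iff_nat j).1 hl
      have hLl : L s p.2 = l := hl'.limUnder_eq
      have := dist_le_of_le_geometric_of_tendsto₀ (1 / 2) ((1 / 2 : ℝ) ^ j) (by norm_num) hcau hl
      rw [zero_add] at this
      rw [hLl]
      refine this.trans (le_of_eq ?_)
      ring
    rw [Metric.tendstoUniformlyOn_iff]
    intro ε hε
    have h2 : Tendsto (fun j : ℕ => 2 * (1 / 2 : ℝ) ^ j) atTop (𝓝 (2 * 0)) :=
      (tendsto_pow_atTop_nhds_zero_of_lt_one (by norm_num) (by norm_num)).const_mul 2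
    rw [mul_zero] at h2
    filter_upwards [eventually_ge_atTop J, h2.eventually_lt_const hε] with j hj hj' s hs
    rw [dist_comm]
    exact (hdist s hs j hj).trans_lt hj'
  have hLRM : 𝓜.RM L := .of_locUnif hm hunif
  refine ⟨L, hLRM, hunif, fun N j => ?_⟩
  have hc : Tendsto (fun i : ℕ => a N * ((1 / 4 : ℝ) ^ j + (1 / 4) ^ i) ^ 2) atTop
      (𝓝 (a N * ((1 / 4) ^ j + 0) ^ 2)) :=
    ((tendsto_const_nhds.add (tendsto_pow_atTop_nhds_zero_of_lt_one (by norm_num)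
      (by norm_num))).pow 2).const_mul _
  rw [add_zero] at hc
  refine L2Bound.of_tendsto (fun i => h N j i) hc ?_
  filter_upwards [eventually_wie_stop hunif (hρ.1 N)] with p hp
  exact tendsto_const_nhds.sub (hp.tendsto_at (mem_Iic.2 le_rfl))

/-! ### Values at stopping times -/

/-- The value of `x` at time `τ`. -/
def valueAt (x : ℝ≥0 → Ω → ℝ) (τ : Ω → WithTop ℝ≥0) (ω : Ω) : ℝ := x ((τ ω).untopD 0) ω

lemma valueAt_eq {x : ℝ≥0 → Ω → ℝ} {τ : Ω → WithTop ℝ≥0} {t : ℝ≥0} {ω : Ω} (h : τ ω ≤ t) :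
    valueAt x τ ω = x (cap t (τ ω)) ω := by
  have h1 := coe_cap_of_ge h
  rw [valueAt, ← h1]
  congr 1
  rw [WithTop.untopD_coe, h1]

lemma locMeas_valueAt_of_adapted {𝓕 : Filtration ℝ≥0 mΩ} {x : ℝ≥0 → Ω → ℝ} {τ : Ω → WithTop ℝ≥0}
    (hτ : IsStoppingTime 𝓕 τ) (hx : Adapted 𝓕 fun t ω => x (cap t (τ ω)) ω) :
    LocMeas 𝓕 τ (valueAt x τ) := by
  intro t
  have : {ω | τ ω ≤ t}.indicator (valueAt x τ) =
      {ω | τ ω ≤ t}.indicator fun ω => x (cap t (τ ω)) ω := by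
    ext ω
    by_cases h : τ ω ≤ t
    · rw [indicator_of_mem (by exact h), indicator_of_mem (by exact h), valueAt_eq h]
    · rw [indicator_of_notMem (by exact h), indicator_of_notMem (by exact h)]
  rw [this]
  exact (hx t).indicator (hτ t)

lemma RM.locMeas_valueAt {x : ℝ≥0 → Ω → ℝ} (hx : 𝓜.RM x) {τ : Ω → WithTop ℝ≥0}
    (hτ : IsStoppingTime 𝓜.𝓕 τ) : LocMeas 𝓜.𝓕 τ (valueAt x τ) :=
  locMeas_valueAt_of_adapted hτ (hx.stopAt hτ).adapted

end MartingaleSpace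

/-! ### The second moment of a simple integral -/

lemma SimpleStrategy.integral_sub {𝓕 : Filtration ℝ≥0 mΩ} (G : SimpleStrategy 𝓕)
    (X : ℝ≥0 → Ω → ℝ) {s s' : ℝ≥0} {n : ℕ} {ω : Ω} (h : G.τ n ω ≤ s) (hs : s ≤ s')
    (h' : (s' : WithTop ℝ≥0) ≤ G.τ (n + 1) ω) :
    G.integral X s' ω - G.integral X s ω = G.g n ω * (X s' ω - X s ω) := by
  obtain ⟨N, hN⟩ := G.exists_integral_eq_sum ω s'
  have hM := max_le_iff.1 (le_refl (max N (n + 1)))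
  rw [hN _ hM.1 X s' le_rfl, hN _ hM.1 X s hs, add_sub_add_left_eq_sub, ← Finset.sum_sub_distrib,
    Finset.sum_eq_single n]
  · have h1 := h.trans (WithTop.coe_le_coe.2 hs)
    have e : cap s' (G.τ n ω) = cap s (G.τ n ω) := by
      rw [← WithTop.coe_inj, coe_cap_of_ge h, coe_cap_of_ge h1]
    rw [SimpleStrategy.gain, SimpleStrategy.gain, cap_of_le h',
      cap_of_le ((WithTop.coe_le_coe.2 hs).trans h'), e]
    ring
  · intro k _ hk
    rw [SimpleStrategy.gain, SimpleStrategy.gain]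
    rcases lt_or_gt_of_ne hk with hlt | hgt
    · have h1 : G.τ (k + 1) ω ≤ s := (G.monotone ω (Nat.succ_le_of_lt hlt)).trans h
      have h2 : G.τ k ω ≤ s := (G.monotone ω hlt.le).trans h
      have e : ∀ τ : WithTop ℝ≥0, τ ≤ s → cap s' τ = cap s τ := fun τ hτ => by
        rw [← WithTop.coe_inj, coe_cap_of_ge hτ, coe_cap_of_ge (hτ.trans (WithTop.coe_le_coe.2 hs))]
      rw [e _ h1, e _ h2, sub_self]
    · have h1 : (s' : WithTop ℝ≥0) ≤ G.τ k ω := h'.trans (G.monotone ω (Nat.succ_le_of_lt hgt))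
      have h2 : (s' : WithTop ℝ≥0) ≤ G.τ (k + 1) ω := h1.trans (G.monotone ω (Nat.le_succ k))
      have h3 := (WithTop.coe_le_coe.2 hs).trans h1
      have h4 := (WithTop.coe_le_coe.2 hs).trans h2
      rw [cap_of_le h1, cap_of_le h2, cap_of_le h3, cap_of_le h4]
      ring
  · intro hn
    exact absurd (Finset.mem_range.2 (by omega)) hn

/-- Expand `ΔM² = 2 Mₙ ΔM + (ΔM)²`, bound `(ΔM)²` by `ε² (ΔA)²`, and write `(ΔA)² = Δ(A²) - 2 Aₙ
ΔA`. The term `ε² A²` telescopes, and what remains is a discrete integral against `A`. -/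
lemma sq_le_of_increments {A M g : ℕ → ℝ} {ε : ℝ} (hM0 : M 0 = 0)
    (hM : ∀ n, M (n + 1) - M n = g n * (A (n + 1) - A n))
    (hg : ∀ n, A (n + 1) ≠ A n → |g n| ≤ ε) (K : ℕ) :
    M K ^ 2 ≤ ε ^ 2 * (A K ^ 2 - A 0 ^ 2) +
      ∑ n ∈ Finset.range K, (2 * M n * g n - 2 * ε ^ 2 * A n) * (A (n + 1) - A n) := by
  induction K with
  | zero => simp [hM0]
  | succ n ih =>
    rw [Finset.sum_range_succ]
    have h1 : M (n + 1) = M n + g n * (A (n + 1) - A n) := by linarith [hM n]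
    have h2 : g n ^ 2 * (A (n + 1) - A n) ^ 2 ≤ ε ^ 2 * (A (n + 1) - A n) ^ 2 := by
      by_cases h : A (n + 1) = A n
      · simp [h]
      · have := hg n h
        exact mul_le_mul_of_nonneg_right (sq_le_sq' (by linarith [(abs_le.1 this).1])
          (abs_le.1 this).2) (sq_nonneg _)
    rw [h1]
    nlinarith

namespace MartingaleSpace

variable {d : ℕ} {𝓜 : MartingaleSpace Ω d} [NeZero d] [hA : Fact 𝓜.AssumptionA]
  [hR : 𝓜.𝓕.IsRightContinuous]

/-- The remainder in `sq_le_of_increments` is an integral of a step process against `x` stopped at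
`ρ`, hence a martingale started at `0`. Only the deterministic `ε² N²` survives. -/
lemma L2Bound.strategy_of_unbounded {x : ℝ≥0 → Ω → ℝ} (hx : 𝓜.RM x) {G : SimpleStrategy 𝓜.𝓕}
    (hG : G.Unbounded) (hG0 : G.c = 0) {ρ : Ω → WithTop ℝ≥0} (hρ : IsStoppingTime 𝓜.𝓕 ρ) {ε N : ℝ}
    (h : ∀ᶠ p in 𝓜.wie, ∀ s : ℝ≥0, s ≤ p.1 → (s : WithTop ℝ≥0) < ρ p.2 → |G.step s p.2| ≤ ε ∧ |x s p.2| ≤ N) :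
    𝓜.L2Bound (fun t ω => G.integral x (cap t (ρ ω)) ω) (ε ^ 2 * N ^ 2) := by
  set m := G.integral x with hm
  have hmRM : 𝓜.RM m := hx.strategy G
  have hm0 : ∀ ω, m 0 ω = 0 := fun ω => (G.integral_zero_time x ω).trans hG0
  have hfin : ∀ (t : ℝ≥0) ω, {n | G.τ n ω ≤ t}.Finite := by
    intro t ω
    obtain ⟨n, hn⟩ := hG ω t
    refine (finite_lt_nat n).subset fun k hk => ?_
    by_contra hcon
    exact absurd (hn.trans_le (G.monotone ω (not_lt.1 hcon))) (not_lt.2 hk)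
  have hpos : ∀ n, LocMeas 𝓜.𝓕 (G.τ n) fun ω =>
      2 * valueAt m (G.τ n) ω * G.g n ω - 2 * ε ^ 2 * valueAt x (G.τ n) ω := by
    intro n
    have hτ := G.isStoppingTime n
    have hc : ∀ c : ℝ, LocMeas 𝓜.𝓕 (G.τ n) fun _ => c := LocMeas.const hτ
    exact (((hc 2).mul (hmRM.locMeas_valueAt hτ) hτ).mul (G.locMeas n) hτ).sub
      ((hc (2 * ε ^ 2)).mul (hx.locMeas_valueAt hτ) hτ) hτ
  refine L2Bound.of_RM ((hx.stopAt hρ).integral G.isStoppingTime G.monotone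
    (Eventually.of_forall fun p => hfin p.1 p.2) hpos) (fun ω => ?_) ?_
  · have : ∀ τ : WithTop ℝ≥0, cap 0 τ = 0 := fun τ => le_antisymm (cap_le 0 τ) zero_le
    simp [this]
  filter_upwards [h, hx.eventually_continuousOn] with ⟨t, ω⟩ h hc
  simp only at h hc ⊢
  obtain ⟨K, hK⟩ := hG ω t
  set A : ℕ → ℝ := fun n => x (cap (cap t (G.τ n ω)) (ρ ω)) ω with hA
  set M : ℕ → ℝ := fun n => m (cap (cap t (G.τ n ω)) (ρ ω)) ω with hM
  -- From the first time of `G` past `t ∧ ρ` on, all sampled times coincide, so the corresponding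
  -- increments vanish.
  have hstuck : ∀ n, min (t : WithTop ℝ≥0) (ρ ω) ≤ G.τ n ω → ∀ k, n ≤ k →
      cap (cap t (G.τ k ω)) (ρ ω) = cap t (ρ ω) := by
    intro n hn k hk
    have := hn.trans (G.monotone ω hk)
    rw [← WithTop.coe_inj, coe_cap, coe_cap, coe_cap, min_right_comm, min_eq_left this]
  have key := sq_le_of_increments (A := A) (M := M) (g := fun n => G.g n ω) (ε := ε) ?_ ?_ ?_ K
  · have hAK : A K = x (cap t (ρ ω)) ω := by
      rw [hA]; dsimp only; rw [hstuck K ((min_le_left _ _).trans hK.le) K le_rfl]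
    have hMK : M K = m (cap t (ρ ω)) ω := by
      rw [hM]; dsimp only; rw [hstuck K ((min_le_left _ _).trans hK.le) K le_rfl]
    have hA0 : A 0 = x 0 ω := by
      rw [hA]
      dsimp only
      rw [G.zero, cap_zero, show cap 0 (ρ ω) = 0 from le_antisymm (cap_le 0 _) zero_le]
    -- The hypothesis speaks of times strictly before `ρ`. The value at `t ∧ ρ` is reached by left
    -- continuity unless this time is `0`, and then the difference is zero.
    have hbound : A K ^ 2 - A 0 ^ 2 ≤ N ^ 2 := by
      rw [hAK, hA0]
      by_cases h0 : ρ ω = 0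
      · rw [h0, cap_zero, sub_self]; positivity
      · rcases eq_or_ne (cap t (ρ ω)) 0 with h1 | h1
        · rw [h1, sub_self]; positivity
        · have h2 : |x (cap t (ρ ω)) ω| ≤ N := by
            have h3 : Tendsto (fun u => |x u ω|) (𝓝[<] cap t (ρ ω)) (𝓝 |x (cap t (ρ ω)) ω|) :=
              ((hc _ (cap_le t (ρ ω))).mono_left
                (nhdsWithin_mono _ fun u hu => hu.le.trans (cap_le t (ρ ω)))).abs
            have : (𝓝[<] cap t (ρ ω)).NeBot :=
              nhdsLT_neBot_of_exists_lt ⟨0, pos_iff_ne_zero.2 h1⟩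
            refine le_of_tendsto h3 ?_
            filter_upwards [self_mem_nhdsWithin] with u hu
            exact (h u (hu.le.trans (cap_le t (ρ ω)))
              ((WithTop.coe_lt_coe.2 hu).trans_le (coe_cap_le _ _))).2
          have h4 := sq_le_sq' (by linarith [(abs_le.1 h2).1]) (abs_le.1 h2).2
          linarith [sq_nonneg (x 0 ω)]
    rw [← hMK]
    refine key.trans (add_le_add (mul_le_mul_of_nonneg_left hbound (sq_nonneg ε)) (le_of_eq ?_))
    rw [tsum_eq_sum (s := Finset.range K)]
    · refine Finset.sum_congr rfl fun n _ => ?_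
      by_cases hn : min (t : WithTop ℝ≥0) (ρ ω) ≤ G.τ n ω
      · rw [hA]
        dsimp only
        rw [hstuck n hn n le_rfl, hstuck n hn (n + 1) (Nat.le_succ n), sub_self, mul_zero, mul_zero]
      · rw [not_le, lt_min_iff] at hn
        have e : cap (cap t (G.τ n ω)) (ρ ω) = cap t (G.τ n ω) :=
          cap_of_le ((coe_cap_le _ _).trans hn.2.le)
        rw [valueAt_eq hn.1.le, valueAt_eq hn.1.le, hA, hM]
        dsimp only
        rw [e]
    · intro n hn
      have hn' : K ≤ n := by simpa using hn
      have h1 := hstuck K ((min_le_left _ _).trans hK.le)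
      rw [h1 n hn', h1 (n + 1) (by omega), sub_self, mul_zero]
  · rw [hM]
    dsimp only
    rw [G.zero, cap_zero, show cap 0 (ρ ω) = 0 from le_antisymm (cap_le 0 _) zero_le, hm0]
  · intro n
    by_cases hn : min (t : WithTop ℝ≥0) (ρ ω) ≤ G.τ n ω
    · rw [hA, hM]
      dsimp only
      rw [hstuck n hn n le_rfl, hstuck n hn (n + 1) (Nat.le_succ n), sub_self, sub_self, mul_zero]
    · rw [not_le, lt_min_iff] at hn
      have e : cap (cap t (G.τ n ω)) (ρ ω) = cap t (G.τ n ω) :=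
        cap_of_le ((coe_cap_le _ _).trans hn.2.le)
      refine G.integral_sub x (n := n) ?_ ?_ ?_
      · rw [e, coe_cap_of_ge hn.1.le]
      · exact cap_mono (cap_mono le_rfl (G.monotone ω (Nat.le_succ n))) le_rfl
      · exact (WithTop.coe_le_coe.2 (cap_le _ _)).trans (coe_cap_le _ _)
  · intro n hne
    by_cases hn : min (t : WithTop ℝ≥0) (ρ ω) ≤ G.τ n ω
    · refine absurd ?_ hne
      rw [hA]
      dsimp only
      rw [hstuck n hn n le_rfl, hstuck n hn (n + 1) (Nat.le_succ n)]
    · rw [not_le, lt_min_iff] at hn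
      have hlt : G.τ n ω < G.τ (n + 1) ω := by
        refine lt_of_le_of_ne (G.monotone ω (Nat.le_succ n)) fun heq => hne ?_
        rw [hA]; dsimp only; rw [heq]
      have e := coe_cap_of_ge hn.1.le
      have hs : G.step (cap t (G.τ n ω)) ω = G.g n ω := G.step_eq e.ge (e.trans_lt hlt)
      rw [← hs]
      exact (h _ (cap_le _ _) (e.trans_lt hn.2)).1

/-- The second moment bound for simple integrals of small step processes. -/
lemma L2Bound.strategy {x : ℝ≥0 → Ω → ℝ} (hx : 𝓜.RM x) {G : SimpleStrategy 𝓜.𝓕}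
    (hG0 : G.c = 0) {ρ : Ω → WithTop ℝ≥0} (hρ : IsStoppingTime 𝓜.𝓕 ρ) {ε N : ℝ}
    (h : ∀ᶠ p in 𝓜.wie, ∀ s : ℝ≥0, s ≤ p.1 → (s : WithTop ℝ≥0) < ρ p.2 → |G.step s p.2| ≤ ε ∧ |x s p.2| ≤ N) :
    𝓜.L2Bound (fun t ω => G.integral x (cap t (ρ ω)) ω) (ε ^ 2 * N ^ 2) := by
  have := L2Bound.strategy_of_unbounded hx G.normalize_unbounded (show G.normalize.c = 0 from hG0) hρ
    (ε := ε) (N := N) (by simpa only [SimpleStrategy.normalize_step] using h)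
  simpa only [SimpleStrategy.normalize_integral] using this

end MartingaleSpace
end ModelFree
end

/-! ### Stopping times at which càdlàg processes have moved. -/

noncomputable section
namespace ModelFree

variable {Ω : Type*} [mΩ : MeasurableSpace Ω]

/-! ### Partitions along which two processes oscillate little -/

/-- The path `f` is càdlàg on `[0, t]` (without condition to the right of `t`). -/
def CadlagTo (f : ℝ≥0 → ℝ) (t : ℝ≥0) : Prop :=
  (∀ s < t, ContinuousWithinAt f (Ici s) s) ∧ ∀ s ≤ t, ∃ l, Tendsto f (𝓝[<] s) (𝓝 l)

lemma IsCadlag.cadlagTo {f : ℝ≥0 → ℝ} (h : IsCadlag f) (t : ℝ≥0) : CadlagTo f t :=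
  ⟨fun s _ => (h s).1, fun s _ => (h s).2⟩

lemma _root_.ContinuousOn.cadlagTo {f : ℝ≥0 → ℝ} {t : ℝ≥0} (h : ContinuousOn f (Iic t)) :
    CadlagTo f t :=
  ⟨fun _ hs => (h.continuousAt (Iic_mem_nhds hs)).continuousWithinAt,
    fun s hs => ⟨f s, (h s hs).mono_left (nhdsWithin_mono s fun _ hu => hu.le.trans hs)⟩⟩

namespace MartingaleSpace

variable {d : ℕ} {𝓜 : MartingaleSpace Ω d} [NeZero d] [hA : Fact 𝓜.AssumptionA]
  [hR : 𝓜.𝓕.IsRightContinuous]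

/-- The stopped time is approximated from the right within `[0, t]`. When it equals `t` all
approximations equal `t`, which is why right-continuity at `t` itself is not needed. -/
lemma adapted_stop_of_cadlagTo {z : ℝ≥0 → Ω → ℝ} (hz : Adapted 𝓜.𝓕 z)
    (hc : ∀ᶠ p in 𝓜.wie, CadlagTo (fun s => z s p.2) p.1) {τ : Ω → WithTop ℝ≥0}
    (hτ : IsStoppingTime 𝓜.𝓕 τ) : Adapted 𝓜.𝓕 fun t ω => z (cap t (τ ω)) ω := by
  intro t
  obtain ⟨D, hD, hD1, hD2⟩ := exists_cap_approx hz hτ t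
  refine measurable_of_tendsto_wie hD (hc.mono fun p hp hpt => ?_)
  subst hpt
  rcases (cap_le p.1 (τ p.2)).lt_or_eq with h | h
  · refine ((hp.1 _ h).tendsto).comp ?_
    exact tendsto_nhdsWithin_iff.2 ⟨hD2 p.2, Eventually.of_forall fun n => (hD1 n p.2).1⟩
  · refine tendsto_const_nhds.congr fun n => ?_
    have := hD1 n p.2
    dsimp only
    rw [h] at this ⊢
    rw [le_antisymm this.2 this.1]

/-- The pairs of values at distance more than `δ` from the values at `T`. -/
def Leaves (z w : ℝ≥0 → Ω → ℝ) (δ : ℝ) (T : Ω → WithTop ℝ≥0) (s : ℝ≥0) (ω : Ω) : Prop :=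
  T ω < s ∧ (δ < |z s ω - valueAt z T ω| ∨ δ < |w s ω - valueAt w T ω|)

/-- The first time after `T` at which one of the processes has moved by more than `δ`. -/
def leaveTime (z w : ℝ≥0 → Ω → ℝ) (δ : ℝ) (T : Ω → WithTop ℝ≥0) (ω : Ω) : WithTop ℝ≥0 :=
  sInf ((↑) '' {s : ℝ≥0 | Leaves z w δ T s ω})

lemma leaveTime_lt_iff {z w : ℝ≥0 → Ω → ℝ} {δ : ℝ} {T : Ω → WithTop ℝ≥0} {t : WithTop ℝ≥0} {ω : Ω} :
    leaveTime z w δ T ω < t ↔ ∃ s : ℝ≥0, (s : WithTop ℝ≥0) < t ∧ Leaves z w δ T s ω := by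
  rw [leaveTime, sInf_lt_iff]
  constructor
  · rintro ⟨_, ⟨s, hs, rfl⟩, h⟩
    exact ⟨s, h, hs⟩
  · rintro ⟨s, h, hs⟩
    exact ⟨s, ⟨s, hs, rfl⟩, h⟩

lemma le_leaveTime {z w : ℝ≥0 → Ω → ℝ} {δ : ℝ} {T : Ω → WithTop ℝ≥0} {ω : Ω} :
    T ω ≤ leaveTime z w δ T ω := by
  refine le_sInf ?_
  rintro _ ⟨s, hs, rfl⟩
  exact hs.1.le

/-- The strict inequalities in `Leaves` persist to the right of `s` by right-continuity, so a dense
sequence of times detects leaving before `t`. -/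
lemma isStoppingTime_leaveTime {z w : ℝ≥0 → Ω → ℝ} (hz : Adapted 𝓜.𝓕 z) (hw : Adapted 𝓜.𝓕 w)
    (hzc : ∀ᶠ p in 𝓜.wie, CadlagTo (fun s => z s p.2) p.1)
    (hwc : ∀ᶠ p in 𝓜.wie, CadlagTo (fun s => w s p.2) p.1) (δ : ℝ) {T : Ω → WithTop ℝ≥0}
    (hT : IsStoppingTime 𝓜.𝓕 T) : IsStoppingTime 𝓜.𝓕 (leaveTime z w δ T) := by
  refine isStoppingTime_of_measurableSet_lt_of_isRightContinuous fun t => ?_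
  set q := TopologicalSpace.denseSeq ℝ≥0 with hq
  refine measurableSet_of_eventually_iff (B := ⋃ (i : ℕ) (_ : q i < t), {ω | Leaves z w δ T (q i) ω})
    (MeasurableSet.iUnion fun i => MeasurableSet.iUnion fun hi => 𝓜.𝓕.mono hi.le _ ?_) ?_
  · set ind : (ℝ≥0 → Ω → ℝ) → Ω → ℝ := fun z => {ω | T ω ≤ q i}.indicator (valueAt z T) with hind
    have h1 : ∀ z, Adapted 𝓜.𝓕 z → (∀ᶠ p in 𝓜.wie, CadlagTo (fun s => z s p.2) p.1) →
        MeasurableSet[𝓜.𝓕 (q i)] {ω | δ < |z (q i) ω - ind z ω|} := by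
      intro z hz hzc
      have h2 : Measurable[𝓜.𝓕 (q i)] fun ω => z (q i) ω - ind z ω :=
        (hz (q i)).sub (locMeas_valueAt_of_adapted hT (adapted_stop_of_cadlagTo hz hzc hT) (q i))
      exact h2 (isOpen_lt continuous_const continuous_abs : IsOpen {u : ℝ | δ < |u|}).measurableSet
    convert (hT.measurableSet_lt (q i)).inter ((h1 z hz hzc).union (h1 w hw hwc)) using 1
    ext ω
    change (T ω < q i ∧ (δ < |z (q i) ω - valueAt z T ω| ∨ δ < |w (q i) ω - valueAt w T ω|)) ↔
      (T ω < q i ∧ (δ < |z (q i) ω - ind z ω| ∨ δ < |w (q i) ω - ind w ω|))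
    refine and_congr_right fun hlt => ?_
    have h3 : ∀ z, ind z ω = valueAt z T ω := fun z => indicator_of_mem (by exact hlt.le) _
    rw [h3, h3]
  · filter_upwards [hzc, hwc] with p hp hp' hpt
    subst hpt
    change leaveTime z w δ T p.2 < p.1 ↔ _
    rw [leaveTime_lt_iff]
    simp only [mem_iUnion, exists_prop]
    constructor
    · rintro ⟨s, hs, hs1, hs2⟩
      have hs' : s < p.1 := WithTop.coe_lt_coe.1 hs
      have key : ∀ᶠ u in 𝓝[≥] s, δ < |z u p.2 - valueAt z T p.2| ∨ δ < |w u p.2 - valueAt w T p.2| := by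
        rcases hs2 with h | h
        · exact (((hp.1 s hs').sub continuousWithinAt_const).abs.eventually_const_lt h).mono
            fun u hu => Or.inl hu
        · exact (((hp'.1 s hs').sub continuousWithinAt_const).abs.eventually_const_lt h).mono
            fun u hu => Or.inr hu
      have key2 := (key.filter_mono (nhdsWithin_mono s Ioi_subset_Ici_self))
      obtain ⟨u, hu, hu'⟩ := (mem_nhdsGT_iff_exists_Ioo_subset' hs').1 key2
      obtain ⟨_, ⟨i, rfl⟩, hi1, hi2⟩ := (TopologicalSpace.denseRange_denseSeq ℝ≥0).exists_between
        (lt_min (show s < u from hu) hs')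
      exact ⟨i, hi2.trans_le (min_le_right _ _), hs1.trans (WithTop.coe_lt_coe.2 hi1),
        hu' ⟨hi1, hi2.trans_le (min_le_left _ _)⟩⟩
    · rintro ⟨i, hi, h⟩
      exact ⟨q i, WithTop.coe_lt_coe.2 hi, h⟩

open Classical in
/-- The partition times; a time at which the paths move immediately is the last one. -/
def partTime (z w : ℝ≥0 → Ω → ℝ) (δ : ℝ) : ℕ → Ω → WithTop ℝ≥0
  | 0 => fun _ => 0
  | n + 1 => fun ω => if leaveTime z w δ (partTime z w δ n) ω ≤ partTime z w δ n ω then ⊤ else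
      leaveTime z w δ (partTime z w δ n) ω

open Classical in
lemma partTime_succ (z w : ℝ≥0 → Ω → ℝ) (δ : ℝ) (n : ℕ) (ω : Ω) : partTime z w δ (n + 1) ω =
    if leaveTime z w δ (partTime z w δ n) ω ≤ partTime z w δ n ω then ⊤ else
      leaveTime z w δ (partTime z w δ n) ω := rfl

lemma partTime_monotone (z w : ℝ≥0 → Ω → ℝ) (δ : ℝ) (ω : Ω) :
    Monotone fun n => partTime z w δ n ω := by
  refine monotone_nat_of_le_succ fun n => ?_
  rw [partTime_succ]
  split_ifs
  · exact le_top
  · exact le_leaveTime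

lemma partTime_isStoppingTime {z w : ℝ≥0 → Ω → ℝ} (hz : Adapted 𝓜.𝓕 z) (hw : Adapted 𝓜.𝓕 w)
    (hzc : ∀ᶠ p in 𝓜.wie, CadlagTo (fun s => z s p.2) p.1)
    (hwc : ∀ᶠ p in 𝓜.wie, CadlagTo (fun s => w s p.2) p.1) (δ : ℝ) (n : ℕ) :
    IsStoppingTime 𝓜.𝓕 (partTime z w δ n) := by
  induction n with
  | zero => exact isStoppingTime_zero
  | succ n ih =>
    have h := isStoppingTime_leaveTime hz hw hzc hwc δ ih
    intro t
    have : {ω | partTime z w δ (n + 1) ω ≤ t} = {ω | leaveTime z w δ (partTime z w δ n) ω ≤ t} \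
        ({ω | leaveTime z w δ (partTime z w δ n) ω ≤ partTime z w δ n ω} ∩
          {ω | leaveTime z w δ (partTime z w δ n) ω ≤ t}) := by
      ext ω
      rw [Set.mem_sdiff, mem_inter_iff]
      change partTime z w δ (n + 1) ω ≤ t ↔ leaveTime z w δ (partTime z w δ n) ω ≤ t ∧
        ¬ (leaveTime z w δ (partTime z w δ n) ω ≤ partTime z w δ n ω ∧
          leaveTime z w δ (partTime z w δ n) ω ≤ t)
      rw [partTime_succ]
      split_ifs with h1
      · exact ⟨fun h2 => absurd h2 (not_le.2 (WithTop.coe_lt_top t)), fun h2 => absurd ⟨h1, h2.1⟩ h2.2⟩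
      · exact ⟨fun h2 => ⟨h2, fun h3 => h1 h3.1⟩, fun h2 => h2.1⟩
    rw [this]
    exact (h t).diff (measurableSet_le_inter h ih t)

/-- If `s` lies strictly after the partition time, right-continuity there forbids leaving at once.
The next partition time is then the true leaving time, and a violation at `s` would place it at or
before `s`. -/
lemma abs_sub_le_of_mem_partition {z w : ℝ≥0 → Ω → ℝ} {δ : ℝ} (hδ : 0 < δ) {t : ℝ≥0} {ω : Ω}
    (hz : CadlagTo (fun s => z s ω) t) (hw : CadlagTo (fun s => w s ω) t) {n : ℕ} {s : ℝ≥0}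
    (hs : s ≤ t) (h : partTime z w δ n ω ≤ s) (h' : (s : WithTop ℝ≥0) < partTime z w δ (n + 1) ω) :
    |z s ω - valueAt z (partTime z w δ n) ω| ≤ δ ∧ |w s ω - valueAt w (partTime z w δ n) ω| ≤ δ := by
  set T := partTime z w δ n with hT
  rcases h.eq_or_lt with heq | hlt
  · have hv : ∀ z : ℝ≥0 → Ω → ℝ, valueAt z T ω = z s ω := fun z => by
      rw [valueAt, heq, WithTop.untopD_coe]
    rw [hv, hv, sub_self, sub_self, abs_zero]
    exact ⟨hδ.le, hδ.le⟩
  obtain ⟨r, hr⟩ : ∃ r : ℝ≥0, T ω = r :=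
    ⟨_, (WithTop.coe_untop _ (ne_top_of_lt hlt)).symm⟩
  have hrs : r < s := by rw [hr] at hlt; exact WithTop.coe_lt_coe.1 hlt
  have hv : ∀ z : ℝ≥0 → Ω → ℝ, valueAt z T ω = z r ω := fun z => by
    rw [valueAt, hr, WithTop.untopD_coe]
  have hmove : ¬ leaveTime z w δ T ω ≤ T ω := by
    have key : ∀ z : ℝ≥0 → Ω → ℝ, CadlagTo (fun s => z s ω) t →
        ∀ᶠ u in 𝓝[>] r, |z u ω - valueAt z T ω| < δ := by
      intro z hz
      have h1 : Tendsto (fun u => |z u ω - z r ω|) (𝓝[≥] r) (𝓝 |z r ω - z r ω|) :=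
        ((hz.1 r (hrs.trans_le hs)).sub continuousWithinAt_const).abs
      rw [sub_self, abs_zero] at h1
      rw [hv]
      exact (h1.eventually_lt_const hδ).filter_mono (nhdsWithin_mono r Ioi_subset_Ici_self)
    obtain ⟨u, hu, hu'⟩ := (mem_nhdsGT_iff_exists_Ioo_subset' hrs).1 ((key z hz).and (key w hw))
    rw [not_le, hr]
    refine (WithTop.coe_lt_coe.2 (show r < u from hu)).trans_le (not_lt.1 fun hcon => ?_)
    obtain ⟨v, hv1, hv2, hv3⟩ := leaveTime_lt_iff.1 hcon
    rw [hr] at hv2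
    have := hu' ⟨WithTop.coe_lt_coe.1 hv2, WithTop.coe_lt_coe.1 hv1⟩
    rcases hv3 with h3 | h3
    · exact absurd this.1 (not_lt.2 h3.le)
    · exact absurd this.2 (not_lt.2 h3.le)
  rw [partTime_succ, if_neg hmove] at h'
  by_contra hcon
  have h1 : leaveTime z w δ T ω ≤ s := by
    refine sInf_le ⟨s, ⟨hlt, ?_⟩, rfl⟩
    by_contra h2
    push Not at h2
    exact hcon h2
  exact absurd h' (not_lt.2 h1)

/-- Infinitely many partition times up to `t` would increase strictly to some `u ≤ t`. Both paths
have left limits at `u`, so just before `u` they move by less than `δ`, whereas each partition time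
requires later moves of more than `δ`. -/
lemma partTime_finite {z w : ℝ≥0 → Ω → ℝ} {δ : ℝ} (hδ : 0 < δ) {t : ℝ≥0} {ω : Ω}
    (hz : CadlagTo (fun s => z s ω) t) (hw : CadlagTo (fun s => w s ω) t) :
    {n | partTime z w δ n ω ≤ t}.Finite := by
  by_contra hinf
  have hall : ∀ n, partTime z w δ n ω ≤ t := by
    intro n
    by_contra hn
    refine hinf ((finite_lt_nat n).subset fun k hk => ?_)
    by_contra hcon
    exact hn ((partTime_monotone z w δ ω (not_lt.1 hcon)).trans hk)
  choose r hr using fun n => WithTop.ne_top_iff_exists.1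
    (ne_top_of_le_ne_top WithTop.coe_ne_top (hall n))
  have hrt : ∀ n, r n ≤ t := fun n => WithTop.coe_le_coe.1 ((hr n).le.trans (hall n))
  have hle : ∀ n, ¬ leaveTime z w δ (partTime z w δ n) ω ≤ partTime z w δ n ω := by
    intro n hn
    have := hall (n + 1)
    rw [partTime_succ, if_pos hn] at this
    exact absurd this (not_le.2 (WithTop.coe_lt_top t))
  have hsucc : ∀ n, ((r (n + 1) : ℝ≥0) : WithTop ℝ≥0) = leaveTime z w δ (partTime z w δ n) ω := by
    intro n
    rw [hr (n + 1), partTime_succ, if_neg (hle n)]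
  have hstrict : StrictMono r := strictMono_nat_of_lt_succ fun n => by
    have := not_le.1 (hle n)
    rw [← hsucc, ← hr n] at this
    exact WithTop.coe_lt_coe.1 this
  have hbdd : BddAbove (range r) := ⟨t, by rintro _ ⟨n, rfl⟩; exact hrt n⟩
  set u := ⨆ n, r n with hu
  have hlim : Tendsto r atTop (𝓝 u) := tendsto_atTop_ciSup hstrict.monotone hbdd
  have hru : ∀ n, r n < u := fun n => (hstrict (Nat.lt_succ_self n)).trans_le (le_ciSup hbdd _)
  have hut : u ≤ t := ciSup_le hrt
  have key : ∀ z : ℝ≥0 → Ω → ℝ, CadlagTo (fun s => z s ω) t →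
      ∃ l, ∃ v < u, ∀ s, v < s → s < u → |z s ω - l| < δ / 2 := by
    intro z hz
    obtain ⟨l, hl⟩ := hz.2 u hut
    refine ⟨l, ?_⟩
    have h1 : ∀ᶠ s in 𝓝[<] u, |z s ω - l| < δ / 2 := by
      have := (hl.sub_const l).abs
      rw [sub_self, abs_zero] at this
      exact this.eventually_lt_const (by positivity)
    obtain ⟨v, hv, hv'⟩ := (mem_nhdsLT_iff_exists_Ioo_subset' (hru 0)).1 h1
    exact ⟨v, hv, fun s h2 h3 => hv' ⟨h2, h3⟩⟩
  obtain ⟨l, v, hv, hl⟩ := key z hz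
  obtain ⟨l', v', hv', hl'⟩ := key w hw
  obtain ⟨n, hn⟩ := (hlim.eventually_const_lt (max_lt hv hv')).exists
  obtain ⟨s, hs1, hs2, hs3⟩ := leaveTime_lt_iff.1 ((hsucc n).ge.trans_lt (WithTop.coe_lt_coe.2 (hru (n + 1))))
  have hsu : s < u := WithTop.coe_lt_coe.1 hs1
  have hns : r n < s := by rw [← hr n] at hs2; exact WithTop.coe_lt_coe.1 hs2
  have h1 := hl s (((le_max_left v v').trans_lt hn).trans hns) hsu
  have h2 := hl (r n) ((le_max_left v v').trans_lt hn) (hru n)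
  have h1' := hl' s (((le_max_right v v').trans_lt hn).trans hns) hsu
  have h2' := hl' (r n) ((le_max_right v v').trans_lt hn) (hru n)
  rw [abs_lt] at h1 h2 h1' h2'
  rw [valueAt, valueAt, ← hr n, WithTop.untopD_coe, lt_abs, lt_abs] at hs3
  rcases hs3 with (h | h) | (h | h) <;> linarith

end MartingaleSpace
end ModelFree
end

/-! ### Covers and integrals of a martingale against itself. -/

noncomputable section
namespace ModelFree

variable {Ω : Type*} [mΩ : MeasurableSpace Ω]

/-! ### Truncated step processes -/

namespace SimpleStrategy

variable {𝓕 : Filtration ℝ≥0 mΩ}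

/-- The first `k` steps, with positions cut off at `±k`. -/
def trunc {τ : ℕ → Ω → WithTop ℝ≥0} {g : ℕ → Ω → ℝ} (hτ : ∀ n, IsStoppingTime 𝓕 (τ n))
    (hmono : ∀ ω, Monotone fun n => τ n ω) (h0 : ∀ ω, τ 0 ω = 0) (hg : ∀ n, LocMeas 𝓕 (τ n) (g n))
    (k : ℕ) : SimpleStrategy 𝓕 :=
  -- Freezing the times after index `k` makes the sequence eventually constant, so properness holds
  -- whatever `τ` does.
  ofLocMeas 0 (fun n => τ (min n k))
    (fun n => {ω | n < k ∧ τ n ω ≠ ⊤}.indicator fun ω => max (-(k : ℝ)) (min (g n ω) k))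
    (fun n => hτ _) (fun ω _ _ h => hmono ω (min_le_min h le_rfl)) (fun ω => by rw [Nat.zero_min, h0])
    (fun ω => Or.inr ⟨k, fun j hj => by rw [min_eq_right hj, min_self]⟩)
    (fun n => ⟨k, fun ω => by
      have hk : (0 : ℝ) ≤ k := k.cast_nonneg
      by_cases h : ω ∈ {ω | n < k ∧ τ n ω ≠ ⊤}
      · rw [indicator_of_mem h]
        exact abs_le.2 ⟨le_max_left _ _, max_le (by linarith) (min_le_right _ _)⟩
      · rw [indicator_of_notMem h, abs_zero]; exact hk⟩)
    (fun n t => by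
      by_cases hn : n < k
      · have h1 := (hg n).comp (hτ n) (fun u => max (-(k : ℝ)) (min u k))
          (measurable_const.max (measurable_id.min measurable_const)) t
        convert h1 using 1
        ext ω
        have e : τ (min n k) ω = τ n ω := by rw [min_eq_left hn.le]
        by_cases h : τ n ω ≤ t
        · have h2 : ω ∈ {ω | n < k ∧ τ n ω ≠ ⊤} := ⟨hn, ne_top_of_le_ne_top WithTop.coe_ne_top h⟩
          have h3 : ω ∈ {ω | τ (min n k) ω ≤ t} := e.trans_le h
          have h4 : ω ∈ {ω | τ n ω ≤ t} := h
          rw [indicator_of_mem h3, indicator_of_mem h2, indicator_of_mem h4]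
        · have h3 : ω ∉ {ω | τ (min n k) ω ≤ t} := fun h' => h (e.ge.trans h')
          have h4 : ω ∉ {ω | τ n ω ≤ t} := h
          rw [indicator_of_notMem h3, indicator_of_notMem h4]
      · convert @measurable_const _ _ _ (𝓕 t) (0 : ℝ) using 1
        ext ω
        have h2 : ω ∉ {ω | n < k ∧ τ n ω ≠ ⊤} := fun h => hn h.1
        by_cases h : ω ∈ {ω | τ (min n k) ω ≤ t}
        · rw [indicator_of_mem h, indicator_of_notMem h2]
        · rw [indicator_of_notMem h])
    (fun n ω h => by
      refine indicator_of_notMem ?_ _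
      rintro ⟨h1, h2⟩
      rw [min_eq_left h1.le] at h
      exact h2 h)

variable {τ : ℕ → Ω → WithTop ℝ≥0} {g : ℕ → Ω → ℝ} (hτ : ∀ n, IsStoppingTime 𝓕 (τ n))
    (hmono : ∀ ω, Monotone fun n => τ n ω) (h0 : ∀ ω, τ 0 ω = 0) (hg : ∀ n, LocMeas 𝓕 (τ n) (g n))
    (k : ℕ)

lemma trunc_integral (X : ℝ≥0 → Ω → ℝ) (t : ℝ≥0) (ω : Ω) : (trunc hτ hmono h0 hg k).integral X t ω =
    ∑ n ∈ Finset.range k, max (-(k : ℝ)) (min (g n ω) k) *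
      (X (cap t (τ (n + 1) ω)) ω - X (cap t (τ n ω)) ω) := by
  have e : (trunc hτ hmono h0 hg k).integral X t ω = 0 + ∑' n,
    {ω | n < k ∧ τ n ω ≠ ⊤}.indicator (fun ω => max (-(k : ℝ)) (min (g n ω) k)) ω *
      (X (cap t (τ (min (n + 1) k) ω)) ω - X (cap t (τ (min n k) ω)) ω) := rfl
  rw [e, zero_add, tsum_eq_sum (s := Finset.range k)]
  · refine Finset.sum_congr rfl fun n hn => ?_
    have hn' := Finset.mem_range.1 hn
    rw [min_eq_left (show n + 1 ≤ k from hn'), min_eq_left hn'.le]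
    by_cases h : τ n ω = ⊤
    · have h' : τ (n + 1) ω = ⊤ := top_le_iff.1 (h ▸ hmono ω (Nat.le_succ n))
      rw [h, h', sub_self, mul_zero, mul_zero]
    · rw [indicator_of_mem (show ω ∈ {ω | n < k ∧ τ n ω ≠ ⊤} from ⟨hn', h⟩)]
  · intro n hn
    rw [indicator_of_notMem (fun h => hn (Finset.mem_range.2 h.1)), zero_mul]

lemma trunc_step {n : ℕ} {s : ℝ≥0} {ω : Ω} (hn : n < k) (h : τ n ω ≤ s)
    (h' : (s : WithTop ℝ≥0) < τ (n + 1) ω) :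
    (trunc hτ hmono h0 hg k).step s ω = max (-(k : ℝ)) (min (g n ω) k) := by
  have e1 : (trunc hτ hmono h0 hg k).τ n ω = τ n ω := congrArg (τ · ω) (min_eq_left hn.le)
  have e2 : (trunc hτ hmono h0 hg k).τ (n + 1) ω = τ (n + 1) ω := congrArg (τ · ω) (min_eq_left hn)
  rw [step_eq _ (n := n) (e1.trans_le h) (h'.trans_eq e2.symm)]
  have h3 : ω ∈ {ω | n < k ∧ τ n ω ≠ ⊤} := ⟨hn, ne_top_of_le_ne_top WithTop.coe_ne_top h⟩
  exact indicator_of_mem h3 fun ω => max (-(k : ℝ)) (min (g n ω) k)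

end SimpleStrategy

namespace MartingaleSpace

variable {d : ℕ} {𝓜 : MartingaleSpace Ω d} [NeZero d]

/-! ### Covers -/

variable (𝓜) in
/-- A sequence of stopping times between which, w.i.e., `x` moves by at most `δ`. -/
structure Covers (σ : ℕ → Ω → WithTop ℝ≥0) (x : ℝ≥0 → Ω → ℝ) (δ : ℝ) : Prop where
  isStoppingTime : ∀ n, IsStoppingTime 𝓜.𝓕 (σ n)
  monotone : ∀ ω, Monotone fun n => σ n ω
  zero : ∀ ω, σ 0 ω = 0
  eventually_finite : ∀ᶠ p in 𝓜.wie, {n | σ n p.2 ≤ p.1}.Finite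
  eventually_le : ∀ᶠ p in 𝓜.wie, ∀ n (s : ℝ≥0), s ≤ p.1 → σ n p.2 ≤ s → s ≤ σ (n + 1) p.2 →
    |x s p.2 - valueAt x (σ n) p.2| ≤ δ

lemma IsMartingale.covers {X : ℝ≥0 → Ω → EReal} (hX : 𝓜.IsMartingale X)
    {σ : ℕ → Ω → WithTop ℝ≥0} {δ : ℝ} {E : Set (ℝ≥0 × Ω)} (hE : 𝓜.Wie E)
    (h : 𝓜.FinelyCovers σ X δ E) : 𝓜.Covers σ (ModelFree.realPart X) δ := by
  obtain ⟨h1, h2, h3, h4⟩ := h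
  have hE' : ∀ᶠ p in 𝓜.wie, p ∈ E := hE
  refine ⟨h1, h2, h3, hE'.mono fun p hp => (h4 p.1 p.2 hp).1, ?_⟩
  filter_upwards [hE', hX.eventually_coe_realPart] with ⟨t, ω⟩ hp hr n s hst hs hs'
  simp only at hr hst hs hs' ⊢
  have h5 := (h4 t ω hp).2 n
  have hst' : (s : WithTop ℝ≥0) ≤ t := WithTop.coe_le_coe.2 hst
  have hσt : σ n ω ≤ t := hs.trans hst'
  set A := {s : ℝ≥0 | min (σ n ω) t ≤ s ∧ (s : WithTop ℝ≥0) ≤ min (σ (n + 1) ω) t} with hA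
  have hm1 : s ∈ A := ⟨(min_le_left _ _).trans hs, le_min hs' hst'⟩
  have hm2 : cap t (σ n ω) ∈ A := by
    have e := coe_cap_of_ge hσt
    exact ⟨(min_le_left _ _).trans e.ge, le_min (e.le.trans (hs.trans hs')) (e.le.trans hσt)⟩
  have key : ∀ u ∈ A, ∀ v ∈ A, ModelFree.realPart X u ω - ModelFree.realPart X v ω ≤ δ := by
    intro u hu v hv
    have hut : u ≤ t := WithTop.coe_le_coe.1 (hu.2.trans (min_le_right _ _))
    have hvt : v ≤ t := WithTop.coe_le_coe.1 (hv.2.trans (min_le_right _ _))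
    have h6 : X u ω - X v ω ≤ δ :=
      (EReal.sub_le_sub (le_iSup₂ (f := fun s (_ : s ∈ A) => X s ω) u hu)
        (iInf₂_le (f := fun s (_ : s ∈ A) => X s ω) v hv)).trans h5
    rw [← hr u hut, ← hr v hvt, ← EReal.coe_sub] at h6
    exact EReal.coe_le_coe_iff.1 h6
  rw [valueAt_eq hσt, abs_le]
  have h7 := key s hm1 _ hm2
  have h8 := key _ hm2 s hm1
  constructor <;> linarith

/-- The partition with threshold `δ / 2` keeps the path within `δ / 2` of its value at the left
endpoint, so the oscillation is at most `δ`. The bound holds on half-open intervals and extends to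
the right endpoint by continuity. -/
lemma IsMartingale.exists_finelyCovers [hA : Fact 𝓜.AssumptionA] [hR : 𝓜.𝓕.IsRightContinuous]
    {X : ℝ≥0 → Ω → EReal} (hX : 𝓜.IsMartingale X) {δ : ℝ} (hδ : 0 < δ) :
    ∃ σ E, 𝓜.Wie E ∧ 𝓜.FinelyCovers σ X δ E := by
  set x := ModelFree.realPart X with hx
  have hxRM : 𝓜.RM x := hX.realPart
  have hc := hxRM.eventually_continuousOn
  have hcl := hc.mono fun p hp => hp.cadlagTo
  refine ⟨partTime x x (δ / 2), _, eventually_wie.1 (hc.and hX.eventually_coe_realPart),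
    partTime_isStoppingTime hxRM.adapted hxRM.adapted hcl hcl _, partTime_monotone _ _ _,
    fun _ => rfl, ?_⟩
  rintro t ω ⟨h1, h2⟩
  simp only at h1 h2
  refine ⟨partTime_finite (by positivity) h1.cadlagTo h1.cadlagTo, fun n => ?_⟩
  set T := partTime x x (δ / 2) with hT
  have key : ∀ s : ℝ≥0, min (T n ω) t ≤ s ∧ (s : WithTop ℝ≥0) ≤ min (T (n + 1) ω) t →
      |x s ω - x (cap t (T n ω)) ω| ≤ δ / 2 := by
    rintro s ⟨hs, hs'⟩
    have hst : s ≤ t := WithTop.coe_le_coe.1 (hs'.trans (min_le_right _ _))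
    have hcs : cap t (T n ω) ≤ s := by
      rw [← WithTop.coe_le_coe, coe_cap, min_comm]; exact hs
    rcases hcs.eq_or_lt with heq | hlt
    · rw [heq, sub_self, abs_zero]; positivity
    · have hTt : T n ω ≤ t := by
        by_contra hcon
        rw [not_le] at hcon
        rw [cap_of_le hcon.le] at hlt
        exact absurd hst (not_le.2 hlt)
      have h3 : Tendsto (fun u => |x u ω - x (cap t (T n ω)) ω|) (𝓝[<] s)
          (𝓝 |x s ω - x (cap t (T n ω)) ω|) :=
        (((h1 s hst).mono_left (nhdsWithin_mono s fun u hu => hu.le.trans hst)).sub_const _).abs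
      have : (𝓝[<] s).NeBot := nhdsLT_neBot_of_exists_lt ⟨_, hlt⟩
      refine le_of_tendsto h3 ?_
      filter_upwards [self_mem_nhdsWithin, Ioo_mem_nhdsLT hlt] with u hu hu'
      rw [← valueAt_eq (x := x) hTt]
      refine (abs_sub_le_of_mem_partition (by positivity) h1.cadlagTo h1.cadlagTo
        (hu.le.trans hst) ?_ ?_).1
      · exact (coe_cap_of_ge hTt).ge.trans (WithTop.coe_le_coe.2 hu'.1.le)
      · exact (WithTop.coe_lt_coe.2 hu).trans_le (hs'.trans (min_le_left _ _))
  have hle : ∀ s : ℝ≥0, s ∈ {s : ℝ≥0 | min (T n ω) t ≤ s ∧ (s : WithTop ℝ≥0) ≤ min (T (n + 1) ω) t} →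
      X s ω = (x s ω : EReal) := fun s hs =>
    (h2 s (WithTop.coe_le_coe.1 (hs.2.trans (min_le_right _ _)))).symm
  calc _ ≤ ((x (cap t (T n ω)) ω + δ / 2 : ℝ) : EReal) - ((x (cap t (T n ω)) ω - δ / 2 : ℝ) : EReal) := by
        refine EReal.sub_le_sub (iSup₂_le fun s hs => ?_) (le_iInf₂ fun s hs => ?_)
        · rw [hle s hs, EReal.coe_le_coe_iff]; linarith [(abs_le.1 (key s hs)).2]
        · rw [hle s hs, EReal.coe_le_coe_iff]; linarith [(abs_le.1 (key s hs)).1]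
    _ = _ := by rw [← EReal.coe_sub]; congr 1; ring

/-! ### The integral of a martingale against itself along a cover -/

/-- The sums `∑ₙ x_{σₙ} (x_{σₙ₊₁ ∧ t} - x_{σₙ ∧ t})`. -/
def coverIntegral (σ : ℕ → Ω → WithTop ℝ≥0) (x : ℝ≥0 → Ω → ℝ) (t : ℝ≥0) (ω : Ω) : ℝ :=
  ∑' n, valueAt x (σ n) ω * (x (cap t (σ (n + 1) ω)) ω - x (cap t (σ n ω)) ω)

lemma simpleQV_eq_sum {X : ℝ≥0 → Ω → EReal} {σ : ℕ → Ω → WithTop ℝ≥0} {s t : ℝ≥0} {ω : Ω} {K : ℕ}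
    (hmono : Monotone fun n => σ n ω) (hK : ∀ n, K ≤ n → (t : WithTop ℝ≥0) < σ n ω) (hs : s ≤ t) :
    (simpleQV σ X s ω : EReal) = ((∑ n ∈ Finset.range K,
      (ModelFree.realPart X (cap s (σ (n + 1) ω)) ω - ModelFree.realPart X (cap s (σ n ω)) ω) ^ 2 : ℝ) :
        EReal) := by
  have e1 : simpleQV σ X s ω = ENNReal.ofReal (∑ n ∈ Finset.range K,
      (ModelFree.realPart X (cap s (σ (n + 1) ω)) ω -
        ModelFree.realPart X (cap s (σ n ω)) ω) ^ 2) := by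
    rw [ENNReal.ofReal_sum_of_nonneg fun _ _ => sq_nonneg _]
    refine tsum_eq_sum fun n hn => ?_
    rw [stoppedProcess_eq, stoppedProcess_eq,
      cap_succ_eq_cap hmono (hK n (by simpa using hn)) hs, sub_self]
    simp
  rw [e1, EReal.coe_ennreal_ofReal, max_eq_left (Finset.sum_nonneg fun _ _ => sq_nonneg _)]

/-- Summation by parts for the simple quadratic variation. -/
lemma Covers.simpleQV_eq {X : ℝ≥0 → Ω → EReal} {σ : ℕ → Ω → WithTop ℝ≥0} {δ : ℝ}
    (h : 𝓜.Covers σ (ModelFree.realPart X) δ) :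
    ∀ᶠ p in 𝓜.wie, ∀ s ≤ p.1, (simpleQV σ X s p.2 : EReal) = ((ModelFree.realPart X s p.2 ^ 2 -
      ModelFree.realPart X 0 p.2 ^ 2 - 2 * coverIntegral σ (ModelFree.realPart X) s p.2 : ℝ) :
        EReal) := by
  filter_upwards [h.eventually_finite] with p hp s hs
  obtain ⟨K, hK⟩ := exists_forall_lt_of_finite hp
  rw [simpleQV_eq_sum (h.monotone p.2) hK hs]
  set x := ModelFree.realPart X with hx
  rw [coverIntegral, tsum_increments_eq_sum (h.monotone p.2) hK hs (fun n => valueAt x (σ n) p.2)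
    fun s => x s p.2, Finset.mul_sum]
  have e2 : ∑ n ∈ Finset.range K, (x (cap s (σ (n + 1) p.2)) p.2 ^ 2 - x (cap s (σ n p.2)) p.2 ^ 2) =
      x s p.2 ^ 2 - x 0 p.2 ^ 2 := by
    rw [Finset.sum_range_sub (f := fun n => x (cap s (σ n p.2)) p.2 ^ 2), h.zero, cap_zero,
      cap_of_le ((WithTop.coe_le_coe.2 hs).trans (hK K le_rfl).le)]
  rw [← e2, ← Finset.sum_sub_distrib]
  congr 1
  refine Finset.sum_congr rfl fun n _ => ?_
  by_cases hn : σ n p.2 ≤ s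
  · rw [valueAt_eq hn]; ring
  · rw [cap_succ_eq_cap (h.monotone p.2) (not_le.1 hn) le_rfl]; ring

/-- The simple quadratic variation along a cover is monotone up to an error. -/
lemma Covers.simpleQV_le {X : ℝ≥0 → Ω → EReal} {σ : ℕ → Ω → WithTop ℝ≥0} {δ : ℝ}
    (h : 𝓜.Covers σ (ModelFree.realPart X) δ) :
    ∀ᶠ p in 𝓜.wie, ∀ s ≤ p.1, ∀ s' ≤ p.1, s ≤ s' →
      (simpleQV σ X s p.2 : EReal) ≤ (simpleQV σ X s' p.2 : EReal) + ((δ ^ 2 : ℝ) : EReal) := by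
  filter_upwards [h.eventually_finite, h.eventually_le] with ⟨t, ω⟩ hp hle s hs s' hs' hss
  simp only at hp hle hs hs' ⊢
  obtain ⟨K, hK⟩ := exists_forall_lt_of_finite hp
  rw [simpleQV_eq_sum (h.monotone ω) hK hs, simpleQV_eq_sum (h.monotone ω) hK hs', ← EReal.coe_add,
    EReal.coe_le_coe_iff]
  set x := ModelFree.realPart X with hx
  -- Only the interval `n₀` containing `s` can contribute more at time `s` than at `s'`, and its
  -- increment up to `s` is at most `δ` in absolute value.
  obtain ⟨n₀, -, h1, h2⟩ := SimpleStrategy.exists_index (τ := fun n => σ n ω) (h.zero ω)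
    ((WithTop.coe_le_coe.2 hs).trans_lt (hK K le_rfl))
  have e : ∀ n, (x (cap s (σ (n + 1) ω)) ω - x (cap s (σ n ω)) ω) ^ 2 ≤
      (x (cap s' (σ (n + 1) ω)) ω - x (cap s' (σ n ω)) ω) ^ 2 + if n = n₀ then δ ^ 2 else 0 := by
    intro n
    have hcap : ∀ τ : WithTop ℝ≥0, τ ≤ s → cap s' τ = cap s τ := fun τ hτ => by
      rw [← WithTop.coe_inj, coe_cap_of_ge hτ, coe_cap_of_ge (hτ.trans (WithTop.coe_le_coe.2 hss))]
    rcases lt_trichotomy n n₀ with hn | rfl | hn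
    · rw [if_neg hn.ne, add_zero, hcap _ ((h.monotone ω (Nat.succ_le_of_lt hn)).trans h1),
        hcap _ ((h.monotone ω hn.le).trans h1)]
    · rw [if_pos rfl, cap_of_le h2.le, ← valueAt_eq (x := x) h1]
      have h3 := hle n s hs h1 h2.le
      have := sq_le_sq' (by linarith [(abs_le.1 h3).1]) (abs_le.1 h3).2
      linarith [sq_nonneg (x (cap s' (σ (n + 1) ω)) ω - x (cap s' (σ n ω)) ω)]
    · have h3 : (s : WithTop ℝ≥0) < σ n ω := h2.trans_le (h.monotone ω (Nat.succ_le_of_lt hn))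
      rw [if_neg hn.ne', cap_succ_eq_cap (h.monotone ω) h3 le_rfl, sub_self]
      simp only [ne_eq, OfNat.ofNat_ne_zero, not_false_eq_true, zero_pow, add_zero]
      positivity
  refine (Finset.sum_le_sum fun n _ => e n).trans ?_
  rw [Finset.sum_add_distrib]
  refine add_le_add_right ?_ _
  rw [Finset.sum_ite_eq']
  split_ifs
  exacts [le_rfl, sq_nonneg _]

variable [hA : Fact 𝓜.AssumptionA] [hR : 𝓜.𝓕.IsRightContinuous]

lemma Covers.coverIntegral_RM {σ : ℕ → Ω → WithTop ℝ≥0} {x : ℝ≥0 → Ω → ℝ} {δ : ℝ}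
    (h : 𝓜.Covers σ x δ) (hx : 𝓜.RM x) : 𝓜.RM (coverIntegral σ x) :=
  hx.integral h.isStoppingTime h.monotone h.eventually_finite
    fun n => hx.locMeas_valueAt (h.isStoppingTime n)

/-- Simple strategies approximating `coverIntegral`. -/
def Covers.strategy {σ : ℕ → Ω → WithTop ℝ≥0} {x : ℝ≥0 → Ω → ℝ} {δ : ℝ} (h : 𝓜.Covers σ x δ)
    (hx : 𝓜.RM x) (k : ℕ) : SimpleStrategy 𝓜.𝓕 :=
  SimpleStrategy.trunc h.isStoppingTime h.monotone h.zero
    (fun n => hx.locMeas_valueAt (h.isStoppingTime n)) k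

lemma RM.localizing_hit {x : ℝ≥0 → Ω → ℝ} (hx : 𝓜.RM x) : 𝓜.Localizing fun N : ℕ => hit x N := by
  refine ⟨fun N => hx.isStoppingTime_hit N, hx.eventually_continuousOn.mono fun p hp => ?_⟩
  have hK : IsCompact (Iic p.1) := by rw [← Icc_bot]; exact isCompact_Icc
  obtain ⟨C, hC⟩ := hK.exists_bound_of_continuousOn hp
  obtain ⟨N, hN⟩ := exists_nat_gt C
  exact ⟨N, le_hit fun s hs => (hC s (mem_Iic.2 hs.le)).trans_lt hN⟩

/-- Both sampled step processes follow `x`, to within `δ` and `δ'`, so their difference is at most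
`δ + δ'` and the second moment bound for simple integrals applies after truncation. -/
lemma Covers.l2Bound_sub {σ σ' : ℕ → Ω → WithTop ℝ≥0} {x : ℝ≥0 → Ω → ℝ} {δ δ' : ℝ}
    (h : 𝓜.Covers σ x δ) (h' : 𝓜.Covers σ' x δ') (hx : 𝓜.RM x) (N : ℕ) :
    𝓜.L2Bound (fun t ω => coverIntegral σ x (cap t (hit x N ω)) ω -
      coverIntegral σ' x (cap t (hit x N ω)) ω) ((δ + δ') ^ 2 * (N : ℝ) ^ 2) := by
  have hstep : ∀ {σ : ℕ → Ω → WithTop ℝ≥0} {δ : ℝ} (h : 𝓜.Covers σ x δ) (k : ℕ), N ≤ k →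
      ∀ᶠ p in 𝓜.wie, ∀ s : ℝ≥0, s ≤ p.1 → (s : WithTop ℝ≥0) < min (hit x N p.2) (σ k p.2) →
        |(h.strategy hx k).step s p.2 - x s p.2| ≤ δ := by
    intro σ δ h k hk
    filter_upwards [h.eventually_le] with p hp s hs hs'
    obtain ⟨n, hn, h1, h2⟩ := SimpleStrategy.exists_index (τ := fun n => σ n p.2) (h.zero p.2)
      (hs'.trans_le (min_le_right _ _))
    rw [Covers.strategy, SimpleStrategy.trunc_step _ _ _ _ k hn h1 h2]
    have h3 : |valueAt x (σ n) p.2| < N := by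
      rw [valueAt_eq h1]
      refine abs_lt_of_lt_hit (lt_of_le_of_lt ?_ (hs'.trans_le (min_le_left _ _)))
      exact WithTop.coe_le_coe.2 (cap_le _ _)
    have h4 : (N : ℝ) ≤ k := by exact_mod_cast hk
    rw [abs_lt] at h3
    -- Before the hitting time the sampled value is below `N ≤ k`, so the clamp at `±k` is inactive.
    rw [min_eq_left (by linarith), max_eq_right (by linarith), abs_sub_comm]
    exact hp n s hs h1 h2.le
  have hconv : ∀ {σ : ℕ → Ω → WithTop ℝ≥0} {δ : ℝ} (h : 𝓜.Covers σ x δ), ∀ᶠ p in 𝓜.wie,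
      ∀ᶠ k : ℕ in atTop, (p.1 : WithTop ℝ≥0) ≤ σ k p.2 ∧
        ∀ s ≤ p.1, (h.strategy hx k).integral x s p.2 = coverIntegral σ x s p.2 := by
    intro σ δ h
    filter_upwards [h.eventually_finite] with p hp
    obtain ⟨K, hK⟩ := exists_forall_lt_of_finite hp
    filter_upwards [eventually_ge_atTop K, eventually_sum_clamp_eq_tsum (h.monotone p.2) hp
      (fun n => valueAt x (σ n) p.2) fun s => x s p.2] with k hk hk'
    refine ⟨(hK k hk).le, fun s hs => ?_⟩
    rw [Covers.strategy, SimpleStrategy.trunc_integral]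
    exact hk' s hs
  -- Stop before either truncated strategy runs out of times; for large `k` only the hitting time
  -- matters on `[0, t]`.
  set ρ : ℕ → Ω → WithTop ℝ≥0 := fun k ω => min (hit x N ω) (min (σ (k + N) ω) (σ' (k + N) ω)) with hρ
  refine L2Bound.of_tendsto (y := fun k t ω => ((h.strategy hx (k + N)).sub (h'.strategy hx (k + N))).integral x
    (cap t (ρ k ω)) ω) (c := fun _ => (δ + δ') ^ 2 * (N : ℝ) ^ 2) (fun k => ?_) tendsto_const_nhds ?_
  · refine L2Bound.strategy hx ?_ ((hx.isStoppingTime_hit N).min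
      ((h.isStoppingTime _).min (h'.isStoppingTime _))) ?_
    · rw [SimpleStrategy.sub_c]
      exact sub_self _
    · filter_upwards [hstep h (k + N) (by omega), hstep h' (k + N) (by omega)] with p h1 h2 s hs hs'
      rw [lt_min_iff, lt_min_iff] at hs'
      refine ⟨?_, (abs_lt_of_lt_hit hs'.1).le⟩
      have h3 := h1 s hs (lt_min hs'.1 hs'.2.1)
      have h4 := h2 s hs (lt_min hs'.1 hs'.2.2)
      rw [SimpleStrategy.sub_step]
      rw [abs_le] at h3 h4 ⊢
      constructor <;> linarith
  · filter_upwards [hconv h, hconv h'] with p h1 h2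
    refine tendsto_const_nhds.congr' ?_
    filter_upwards [(tendsto_add_atTop_nat N).eventually h1, (tendsto_add_atTop_nat N).eventually h2]
      with k h3 h4
    have e : cap p.1 (ρ k p.2) = cap p.1 (hit x N p.2) := by
      rw [hρ]
      simp only
      rw [min_comm, ← cap_cap, cap_of_le (le_min h3.1 h4.1)]
    rw [e, SimpleStrategy.sub_integral, h3.2 _ (cap_le _ _), h4.2 _ (cap_le _ _)]

/-! ### Quadratic variation -/

end MartingaleSpace
end ModelFree
end

/-! ### Existence and basic properties of the quadratic variation. -/

noncomputable section
namespace ModelFree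

variable {Ω : Type*} [mΩ : MeasurableSpace Ω]

/-! ### Quadratic variation -/

namespace MartingaleSpace

variable {d : ℕ} {𝓜 : MartingaleSpace Ω d} [NeZero d] [hA : Fact 𝓜.AssumptionA]
  [hR : 𝓜.𝓕.IsRightContinuous]

lemma IsMartingale.exists_covers_seq {X : ℝ≥0 → Ω → EReal} (hX : 𝓜.IsMartingale X) :
    ∃ σ : ℕ → ℕ → Ω → WithTop ℝ≥0,
      (∀ j, ∃ E, 𝓜.Wie E ∧ 𝓜.FinelyCovers (σ j) X ((1 / 4) ^ j) E) ∧
        ∀ j, 𝓜.Covers (σ j) (ModelFree.realPart X) ((1 / 4) ^ j) := by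
  have h : ∀ j : ℕ, ∃ σ E, 𝓜.Wie E ∧ 𝓜.FinelyCovers σ X ((1 / 4) ^ j) E := fun j =>
    hX.exists_finelyCovers (by positivity)
  choose σ E hE hσ using h
  exact ⟨σ, fun j => ⟨E j, hE j, hσ j⟩, fun j => hX.covers (hE j) (hσ j)⟩

lemma summable_quarter_pow : Summable fun j : ℕ => (1 / 4 : ℝ) ^ j :=
  summable_geometric_of_lt_one (by norm_num) (by norm_num)

lemma tendsto_quarter_pow : Tendsto (fun j : ℕ => (1 / 4 : ℝ) ^ j) atTop (𝓝 0) :=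
  summable_quarter_pow.tendsto_atTop_zero

/-- Summation by parts writes the simple quadratic variation as `x² - x₀² - 2 ∑ x Δx`. One reference
sequence of covers produces the limit `L` of the sums, and any other admissible sequence is compared
with the reference sequence. -/
lemma IsMartingale.exists_isQuadVar {X : ℝ≥0 → Ω → EReal} (hX : 𝓜.IsMartingale X) :
    ∃ Q, 𝓜.IsQuadVar X Q := by
  obtain ⟨σ, -, hσ⟩ := hX.exists_covers_seq
  set x := ModelFree.realPart X with hx
  have hxRM : 𝓜.RM x := hX.realPart
  obtain ⟨L, hL, -, hL2⟩ := exists_limit_of_L2Bound (a := fun N : ℕ => (N : ℝ) ^ 2)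
    hxRM.localizing_hit (fun N => by positivity) (fun j => (hσ j).coverIntegral_RM hxRM)
    fun N i j => ((hσ i).l2Bound_sub (hσ j) hxRM N).mono (mul_comm _ _).le
  obtain ⟨c, hc⟩ := hxRM.exists_zero_eq
  refine ⟨fun t ω => x t ω ^ 2 - c ^ 2 - 2 * L t ω, fun t => ?_, ?_, fun δ σ' hδ hs hσ' => ?_⟩
  · exact (((hxRM.adapted t).pow_const 2).sub_const _).sub ((hL.adapted t).const_mul 2)
  · refine eventually_wie.1 ?_
    filter_upwards [hxRM.eventually_continuousOn, hL.eventually_continuousOn] with p h1 h2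
    exact ((h1.pow 2).sub continuousOn_const).sub (continuousOn_const.mul h2)
  have hC : ∀ m, 𝓜.Covers (σ' m) x (δ m) := fun m => by
    obtain ⟨E, hE, h⟩ := hσ' m
    exact hX.covers hE h
  have hunif : 𝓜.LocUnif (fun m => coverIntegral (σ' m) x) L := by
    refine locUnif_of_L2Bound (a := fun N : ℕ => (N : ℝ) ^ 2) hxRM.localizing_hit
      (fun N => by positivity) (fun m => (hC m).coverIntegral_RM hxRM) hL hδ hs fun N m => ?_
    -- The `m`th given cover is compared with the `j`th reference cover; letting `j → ∞` leaves the
    -- bound `δ m ² N²` against `L`.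
    have hlim : Tendsto (fun j : ℕ => (δ m + (1 / 4 : ℝ) ^ j) ^ 2 * (N : ℝ) ^ 2) atTop
        (𝓝 ((δ m + 0) ^ 2 * (N : ℝ) ^ 2)) :=
      ((tendsto_const_nhds.add tendsto_quarter_pow).pow 2).mul_const _
    rw [add_zero, mul_comm] at hlim
    have hρ := hxRM.isStoppingTime_hit N
    have hloc : 𝓜.LocUnif (fun j t ω => coverIntegral (σ j) x (cap t (hit x N ω)) ω)
        fun t ω => L (cap t (hit x N ω)) ω := by
      refine locUnif_of_L2Bound (ρ := fun _ _ => ⊤) (a := fun _ => (N : ℝ) ^ 2)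
        ⟨fun _ => isStoppingTime_top, Eventually.of_forall fun _ => ⟨0, le_top⟩⟩
        (fun _ => by positivity) (fun j => ((hσ j).coverIntegral_RM hxRM).stopAt hρ) (hL.stopAt hρ)
        (δ := fun j => (1 / 4) ^ j) (fun j => by positivity) summable_quarter_pow fun _ j => ?_
      simp only [cap_top]
      exact hL2 N j
    refine L2Bound.of_tendsto (fun j => (hC m).l2Bound_sub (hσ j) hxRM N) hlim ?_
    filter_upwards [hloc] with p hp
    exact tendsto_const_nhds.sub (hp.tendsto_at (mem_Iic.2 le_rfl))
  have h1 : ∀ᶠ p in 𝓜.wie, ∀ m, ∀ s ≤ p.1, (simpleQV (σ' m) X s p.2 : EReal) =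
      ((x s p.2 ^ 2 - c ^ 2 - 2 * coverIntegral (σ' m) x s p.2 : ℝ) : EReal) :=
    eventually_wie_all.2 fun m => (hC m).simpleQV_eq.mono fun p hp s hs => by
      rw [hp s hs, ← hx, hc]
  refine eventually_wie.1 ?_
  filter_upwards [h1, hunif] with ⟨t, ω⟩ h1 hunif
  simp only at h1 hunif ⊢
  have : (fun m => ⨆ s ≤ t, (((x s ω ^ 2 - c ^ 2 - 2 * L s ω : ℝ) : EReal) -
      (simpleQV (σ' m) X s ω : EReal)).abs) = fun m => ⨆ s ≤ t,
      (((x s ω ^ 2 - c ^ 2 - 2 * L s ω : ℝ) : EReal) -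
        ((x s ω ^ 2 - c ^ 2 - 2 * coverIntegral (σ' m) x s ω : ℝ) : EReal)).abs :=
    funext fun m => iSup_congr fun s => iSup_congr fun hs => by rw [h1 m s hs]
  rw [this, tendsto_iSup_abs_iff, Metric.tendstoUniformlyOn_iff]
  rw [Metric.tendstoUniformlyOn_iff] at hunif
  intro ε hε
  filter_upwards [hunif (ε / 2) (by positivity)] with m hm s hs
  have := hm s hs
  rw [Real.dist_eq] at this ⊢
  rw [show x s ω ^ 2 - c ^ 2 - 2 * L s ω - (x s ω ^ 2 - c ^ 2 - 2 * coverIntegral (σ' m) x s ω) =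
    -2 * (L s ω - coverIntegral (σ' m) x s ω) by ring, abs_mul]
  norm_num
  linarith

/-- Along fine covers with summable accuracies, the quadratic variation is a uniform limit. -/
lemma IsQuadVar.eventually_tendsto {X : ℝ≥0 → Ω → EReal} {P : ℝ≥0 → Ω → ℝ} (hP : 𝓜.IsQuadVar X P)
    {δ : ℕ → ℝ} {σ : ℕ → ℕ → Ω → WithTop ℝ≥0} (hδ : ∀ m, 0 < δ m) (hs : Summable δ)
    (hσ : ∀ m, ∃ E, 𝓜.Wie E ∧ 𝓜.FinelyCovers (σ m) X (δ m) E) {y : ℕ → ℝ≥0 → Ω → ℝ}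
    (hy : ∀ m, ∀ᶠ p in 𝓜.wie, ∀ s ≤ p.1, (simpleQV (σ m) X s p.2 : EReal) = y m s p.2) :
    𝓜.LocUnif y P := by
  rw [locUnif_iff]
  refine eventually_wie.1 ?_
  have h1 : ∀ᶠ p in 𝓜.wie, _ := hP.2.2 δ σ hδ hs hσ
  filter_upwards [h1, eventually_wie_all.2 hy] with ⟨t, ω⟩ h1 h2
  simp only at h1 h2 ⊢
  refine h1.congr fun m => iSup_congr fun s => iSup_congr fun hs => ?_
  rw [h2 m s hs]

variable {X : ℝ≥0 → Ω → EReal} {P P' : ℝ≥0 → Ω → ℝ}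

lemma IsQuadVar.locUnif (hX : 𝓜.IsMartingale X) (hP : 𝓜.IsQuadVar X P)
    {σ : ℕ → ℕ → Ω → WithTop ℝ≥0}
    (hσ : ∀ j, ∃ E, 𝓜.Wie E ∧ 𝓜.FinelyCovers (σ j) X ((1 / 4) ^ j) E) :
    𝓜.LocUnif (fun j t ω => ModelFree.realPart X t ω ^ 2 - ModelFree.realPart X 0 ω ^ 2 -
      2 * coverIntegral (σ j) (ModelFree.realPart X) t ω) P :=
  hP.eventually_tendsto (fun j => by positivity) summable_quarter_pow hσ fun m => by
    obtain ⟨E, hE, h⟩ := hσ m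
    exact (hX.covers hE h).simpleQV_eq

lemma IsQuadVar.eventually_continuousOn (hP : 𝓜.IsQuadVar X P) :
    ∀ᶠ p in 𝓜.wie, ContinuousOn (fun s => P s p.2) (Iic p.1) := hP.2.1

/-- Along the `j`th cover monotonicity fails by at most `(4⁻ʲ)²`, which vanishes in the limit. -/
lemma IsQuadVar.eventually_monotoneOn (hX : 𝓜.IsMartingale X) (hP : 𝓜.IsQuadVar X P) :
    ∀ᶠ p in 𝓜.wie, MonotoneOn (fun s => P s p.2) (Iic p.1) := by
  obtain ⟨σ, hσ, hC⟩ := hX.exists_covers_seq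
  filter_upwards [hP.locUnif hX hσ, eventually_wie_all.2 fun j => (hC j).simpleQV_le,
    eventually_wie_all.2 fun j => (hC j).simpleQV_eq] with p h1 h2 h3 s hs s' hs' hss
  have h4 : Tendsto (fun j : ℕ => ((1 / 4 : ℝ) ^ j) ^ 2) atTop (𝓝 (0 ^ 2)) :=
    tendsto_quarter_pow.pow 2
  have h5 := (h1.tendsto_at hs').add h4
  rw [zero_pow two_ne_zero, add_zero] at h5
  refine le_of_tendsto_of_tendsto' (h1.tendsto_at hs) h5 fun j => ?_
  have h6 := h2 j s hs s' hs' hss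
  rw [h3 j s hs, h3 j s' hs', ← EReal.coe_add, EReal.coe_le_coe_iff] at h6
  exact h6

lemma IsQuadVar.zero (hX : 𝓜.IsMartingale X) (hP : 𝓜.IsQuadVar X P) (ω : Ω) : P 0 ω = 0 := by
  obtain ⟨σ, hσ, hC⟩ := hX.exists_covers_seq
  have h1 := eventually_wie_zero (hP.locUnif hX hσ) ω
  refine tendsto_nhds_unique (h1.tendsto_at (mem_Iic.2 le_rfl)) ?_
  have : ∀ τ : WithTop ℝ≥0, cap 0 τ = 0 := fun τ => le_antisymm (cap_le 0 τ) zero_le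
  simp [coverIntegral, this]

lemma IsQuadVar.nonneg (hX : 𝓜.IsMartingale X) (hP : 𝓜.IsQuadVar X P) :
    ∀ᶠ p in 𝓜.wie, ∀ s ≤ p.1, 0 ≤ P s p.2 :=
  (hP.eventually_monotoneOn hX).mono fun p hp s hs =>
    (hP.zero hX p.2).ge.trans (hp (mem_Iic.2 zero_le) hs zero_le)

/-- By summation by parts this is the limit of the martingales `c² + 2 ∑ x Δx`. -/
lemma IsQuadVar.sq_sub_RM (hX : 𝓜.IsMartingale X) (hP : 𝓜.IsQuadVar X P) :
    𝓜.RM fun t ω => ModelFree.realPart X t ω ^ 2 - P t ω := by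
  obtain ⟨σ, hσ, hC⟩ := hX.exists_covers_seq
  obtain ⟨c, hc⟩ := hX.realPart.exists_zero_eq
  refine RM.of_locUnif (y := fun j t ω => c ^ 2 + 2 * coverIntegral (σ j) (ModelFree.realPart X) t ω)
    (fun j => (RM.const _).add (((hC j).coverIntegral_RM hX.realPart).const_mul 2)) ?_
  filter_upwards [hP.locUnif hX hσ] with p h
  rw [Metric.tendstoUniformlyOn_iff] at h ⊢
  intro ε hε
  filter_upwards [h ε hε] with j hj s hs
  have := hj s hs
  rw [Real.dist_eq, hc] at this
  rw [Real.dist_eq, abs_sub_comm]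
  convert this using 2
  ring

end MartingaleSpace

end ModelFree

end

/-! ### Pathwise Lebesgue–Stieltjes integration. -/

noncomputable section
namespace ModelFree

/-! ### Lebesgue–Stieltjes integrals against differences of monotone paths -/

/-- `μ` is the Stieltjes measure on `(0, t]` of the continuous nondecreasing path `p`. -/
structure IsStieltjes (μ : Measure ℝ≥0) (p : ℝ≥0 → ℝ) (t : ℝ≥0) : Prop where
  finite : IsFiniteMeasure μ
  nullSingleton : NullSingletonClass μ
  monotoneOn : MonotoneOn p (Iic t)
  continuousOn : ContinuousOn p (Iic t)
  real_Ioc : ∀ a b, a ≤ b → b ≤ t → μ.real (Ioc a b) = p b - p a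

lemma continuous_comp_min {p : ℝ≥0 → ℝ} {t : ℝ≥0} (hc : ContinuousOn p (Iic t)) :
    Continuous fun s => p (min s t) :=
  hc.comp_continuous (continuous_id.min continuous_const) fun s => min_le_right s t

/-- The path frozen after `t` is bounded, monotone and continuous on the whole half-line, so its
Stieltjes measure is finite and has no atoms. -/
lemma exists_isStieltjes {p : ℝ≥0 → ℝ} {t : ℝ≥0} (hm : MonotoneOn p (Iic t))
    (hc : ContinuousOn p (Iic t)) : ∃ μ, IsStieltjes μ p t := by
  have hcont := continuous_comp_min hc
  let f : StieltjesFunction ℝ≥0 :=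
    { toFun := fun s => p (min s t)
      mono' := fun a b h => hm (min_le_right a t) (min_le_right b t) (min_le_min_right t h)
      right_continuous' := fun x => hcont.continuousWithinAt }
  have hfin : IsFiniteMeasure f.measure := by
    refine f.isFiniteMeasure_of_forall_abs_le (C := max |p 0| |p t|) fun x => ?_
    exact abs_le_max_abs_abs (hm (mem_Iic.2 zero_le) (min_le_right x t) zero_le)
      (hm (min_le_right x t) (mem_Iic.2 le_rfl) (min_le_right x t))
  refine ⟨f.measure, hfin, ⟨fun a => ?_⟩, hm, hc, fun a b hab hb => ?_⟩
  · rw [StieltjesFunction.measure_singleton]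
    -- At `0` the left neighbourhood filter is trivial and the left limit is by convention the
    -- value, so there is no atom at the origin.
    have : Function.leftLim f a = f a := by
      rcases eq_or_ne (𝓝[<] a) ⊥ with h | h
      · exact leftLim_eq_of_eq_bot _ h
      · have : (𝓝[<] a).NeBot := ⟨h⟩
        exact leftLim_eq_of_tendsto (hcont.continuousWithinAt (s := Iio a) (x := a))
    rw [this, sub_self, ENNReal.ofReal_zero]
  · rw [measureReal_def, StieltjesFunction.measure_Ioc]
    change (ENNReal.ofReal (p (min b t) - p (min a t))).toReal = _
    rw [min_eq_left hb, min_eq_left (hab.trans hb), ENNReal.toReal_ofReal]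
    exact sub_nonneg.2 (hm (hab.trans hb) hb hab)

lemma isStieltjes_zero {t : ℝ≥0} : IsStieltjes 0 (fun _ => 0) t where
  finite := inferInstance
  nullSingleton := ⟨fun _ => rfl⟩
  monotoneOn := fun _ _ _ _ _ => le_rfl
  continuousOn := continuousOn_const
  real_Ioc := fun a b _ _ => by simp

variable {μ ν : Measure ℝ≥0} {p n q : ℝ≥0 → ℝ} {s t : ℝ≥0}

lemma IsStieltjes.boundedVariationOn (hμ : IsStieltjes μ p t) (hν : IsStieltjes ν n t)
    (hq : ∀ u ≤ t, q u = p u - n u) (hs : s ≤ t) :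
    BoundedVariationOn (fun u => q (min u s)) univ := by
  have key : ∀ {p : ℝ≥0 → ℝ}, MonotoneOn p (Iic t) →
      BoundedVariationOn (fun u => p (min u s)) univ := by
    intro p hp
    have h1 : eVariationOn (p ∘ fun u => min u s) univ ≤ eVariationOn p (Icc 0 s) :=
      eVariationOn.comp_le_of_monotoneOn p _ (fun a _ b _ h => min_le_min_right s h)
        fun u _ => ⟨zero_le, min_le_right _ _⟩
    have h2 : MonotoneOn p (Icc 0 s) := hp.mono fun u hu => hu.2.trans hs
    have h3 := (h2.eVariationOn_eq (left_mem_Icc.2 zero_le) (right_mem_Icc.2 zero_le)).le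
    rw [inter_self] at h3
    exact ne_top_of_le_ne_top ENNReal.ofReal_ne_top (h1.trans h3)
  have e : (fun u => q (min u s)) = fun u => p (min u s) - n (min u s) :=
    funext fun u => hq _ ((min_le_right _ _).trans hs)
  rw [e]
  refine ne_top_of_le_ne_top (ENNReal.add_ne_top.2 ⟨key hμ.monotoneOn, key hν.monotoneOn⟩)
    (iSup_le fun ⟨k, u, hu, hus⟩ => ?_)
  refine (Finset.sum_le_sum fun i _ => ?_).trans (Finset.sum_add_distrib.trans_le
    (add_le_add (eVariationOn.sum_le hu hus)
      (eVariationOn.sum_le hu hus)))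
  simp only [edist_dist, Real.dist_eq]
  rw [← ENNReal.ofReal_add (abs_nonneg _) (abs_nonneg _), sub_sub_sub_comm]
  exact ENNReal.ofReal_le_ofReal (abs_sub _ _)

/-- Both sides are determined by the initial intervals, a π-system. Continuity removes the right
limits in the measure of `(0, b]`, which leaves the difference of the two increments. -/
lemma IsStieltjes.vectorMeasure_restrict [IsFiniteMeasure μ] [IsFiniteMeasure ν]
    (hμ : IsStieltjes μ p t) (hν : IsStieltjes ν n t)
    (hq : ∀ u ≤ t, q u = p u - n u) (hs : s ≤ t)
    (h : BoundedVariationOn (fun u => q (min u s)) univ) :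
    h.vectorMeasure.restrict (Ioc 0 s) =
      (μ.restrict (Ioc 0 s)).toSignedMeasure - (ν.restrict (Ioc 0 s)).toSignedMeasure := by
  have hcont : Continuous fun u => q (min u s) := by
    refine continuous_comp_min ?_
    refine ((hμ.continuousOn.sub hν.continuousOn).mono (Iic_subset_Iic.2 hs)).congr fun u hu => ?_
    exact hq u (le_trans hu hs)
  have hr : Function.rightLim (fun u => q (min u s)) = fun u => q (min u s) := by
    ext a
    exact rightLim_eq_of_tendsto
      (hcont.continuousWithinAt (s := Ioi a) (x := a))
  have key : ∀ b ≤ s, h.vectorMeasure (Ioc 0 b) = μ.real (Ioc 0 b) - ν.real (Ioc 0 b) := by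
    intro b hb
    rw [h.vectorMeasure_Ioc zero_le, hr, hμ.real_Ioc 0 b zero_le (hb.trans hs),
      hν.real_Ioc 0 b zero_le (hb.trans hs)]
    simp only
    rw [min_eq_left hb, min_eq_left zero_le, hq b (hb.trans hs), hq 0 zero_le]
    ring
  have key' : ∀ A : Set ℝ≥0, MeasurableSet A → (∃ b ≤ s, A ∩ Ioc 0 s = Ioc 0 b) →
      h.vectorMeasure.restrict (Ioc 0 s) A = ((μ.restrict (Ioc 0 s)).toSignedMeasure -
        (ν.restrict (Ioc 0 s)).toSignedMeasure) A := by
    rintro A hA ⟨b, hb, e⟩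
    rw [VectorMeasure.restrict_apply _ measurableSet_Ioc hA, _root_.sub_apply,
      Measure.toSignedMeasure_apply_measurable hA, Measure.toSignedMeasure_apply_measurable hA,
      measureReal_restrict_apply hA, measureReal_restrict_apply hA, e, key b hb]
  refine VectorMeasure.ext_of_generateFrom (range Iic) ?_ ?_ isPiSystem_Iic ?_
  · rintro _ ⟨b, rfl⟩
    refine key' _ measurableSet_Iic ⟨min b s, min_le_right _ _, ?_⟩
    ext u
    simp only [mem_inter_iff, mem_Iic, mem_Ioc, le_min_iff]
    tauto
  · rw [← borel_eq_generateFrom_Iic]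
    exact BorelSpace.measurable_eq
  · exact key' _ .univ ⟨s, le_rfl, univ_inter _⟩

/-- The Lebesgue–Stieltjes integral against a difference of monotone paths. -/
lemma IsStieltjes.lsIntegral_eq (hμ : IsStieltjes μ p t) (hν : IsStieltjes ν n t)
    (hq : ∀ u ≤ t, q u = p u - n u) (hs : s ≤ t) {f : ℝ≥0 → ℝ} (hfμ : IntegrableOn f (Ioc 0 t) μ)
    (hfν : IntegrableOn f (Ioc 0 t) ν) :
    LSIntegrable f q s ∧
      lsIntegral f q s = (∫ u in Ioc 0 s, f u ∂μ) - ∫ u in Ioc 0 s, f u ∂ν := by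
  have := hμ.finite
  have := hν.finite
  have h := hμ.boundedVariationOn hν hq hs
  have e := hμ.vectorMeasure_restrict hν hq hs h
  have hfμ' := hfμ.mono_set (Ioc_subset_Ioc_right hs)
  have hfν' := hfν.mono_set (Ioc_subset_Ioc_right hs)
  have h1 : (μ.restrict (Ioc 0 s)).toSignedMeasure.Integrable f := by
    rw [VectorMeasure.Integrable, Measure.variation_toSignedMeasure]; exact hfμ'
  have h2 : (ν.restrict (Ioc 0 s)).toSignedMeasure.Integrable f := by
    rw [VectorMeasure.Integrable, Measure.variation_toSignedMeasure]; exact hfν'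
  have hl : ContinuousLinearMap.lsmul ℝ ℝ = (ContinuousLinearMap.lsmul ℝ ℝ (E := ℝ)).flip := by
    ext; simp
  refine ⟨⟨h, ?_⟩, ?_⟩
  · rw [VectorMeasure.IntegrableOn, e]
    exact h1.sub_vectorMeasure h2
  · rw [lsIntegral, dif_pos h, e, VectorMeasure.integral_sub_vectorMeasure h1 h2, hl,
      VectorMeasure.integral_toSignedMeasure, VectorMeasure.integral_toSignedMeasure]

lemma IsStieltjes.lsIntegral_eq_of_monotone (hμ : IsStieltjes μ p t) (hs : s ≤ t) {f : ℝ≥0 → ℝ}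
    (hfμ : IntegrableOn f (Ioc 0 t) μ) :
    LSIntegrable f p s ∧ lsIntegral f p s = ∫ u in Ioc 0 s, f u ∂μ := by
  have h := hμ.lsIntegral_eq (q := p) isStieltjes_zero (fun u _ => (sub_zero _).symm) hs hfμ
    (by rw [IntegrableOn, Measure.restrict_zero]; exact integrable_zero_measure)
  rwa [Measure.restrict_zero, integral_zero_measure, sub_zero] at h

lemma IsStieltjes.abs_setIntegral_le (hμ : IsStieltjes μ p t) {a b : ℝ≥0} (hab : a ≤ b)
    (hb : b ≤ t) {f : ℝ≥0 → ℝ} {K : ℝ} (hf : ∀ u ∈ Ioc a b, |f u| ≤ K) :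
    |∫ u in Ioc a b, f u ∂μ| ≤ K * (p b - p a) := by
  have := hμ.finite
  rw [← hμ.real_Ioc a b hab hb]
  exact norm_setIntegral_le_of_norm_le_const (measure_lt_top _ _)
    fun u hu => (Real.norm_eq_abs _).trans_le (hf u hu)

lemma IsStieltjes.setIntegral_sub (_hμ : IsStieltjes μ p t) {a b : ℝ≥0} (hab : a ≤ b)
    (hb : b ≤ t) {f : ℝ≥0 → ℝ} (hf : IntegrableOn f (Ioc 0 t) μ) :
    (∫ u in Ioc 0 b, f u ∂μ) - ∫ u in Ioc 0 a, f u ∂μ = ∫ u in Ioc a b, f u ∂μ := by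
  rw [← Ioc_union_Ioc_eq_Ioc zero_le hab, setIntegral_union (Ioc_disjoint_Ioc_of_le le_rfl)
    measurableSet_Ioc (hf.mono_set (Ioc_subset_Ioc_right (hab.trans hb)))
    (hf.mono_set (Ioc_subset_Ioc zero_le hb)), add_sub_cancel_left]

/-! ### Step paths -/

/-- `f` takes the value `g n` on `[τ n, τ (n + 1))`, up to time `t`. -/
structure IsStepPath (τ : ℕ → WithTop ℝ≥0) (g : ℕ → ℝ) (f : ℝ≥0 → ℝ) (t : ℝ≥0) : Prop where
  monotone : Monotone τ
  zero : τ 0 = 0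
  finite : {k | τ k ≤ t}.Finite
  eq : ∀ u ≤ t, ∀ k, τ k ≤ u → (u : WithTop ℝ≥0) < τ (k + 1) → f u = g k

variable {τ : ℕ → WithTop ℝ≥0} {g : ℕ → ℝ} {f : ℝ≥0 → ℝ}

lemma measurableSet_coe_Ico (a b : WithTop ℝ≥0) :
    MeasurableSet {u : ℝ≥0 | a ≤ u ∧ (u : WithTop ℝ≥0) < b} := by
  have : OrdConnected {u : ℝ≥0 | a ≤ u ∧ (u : WithTop ℝ≥0) < b} :=
    ⟨fun u hu v hv w hw => ⟨hu.1.trans (WithTop.coe_le_coe.2 hw.1),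
      (WithTop.coe_le_coe.2 hw.2).trans_lt hv.2⟩⟩
  exact this.measurableSet

lemma IsStepPath.eq_sum (hf : IsStepPath τ g f t) {K : ℕ}
    (hK : ∀ k, K ≤ k → (t : WithTop ℝ≥0) < τ k) {u : ℝ≥0} (hu : u ≤ t) :
    f u = ∑ k ∈ Finset.range K,
      {u : ℝ≥0 | τ k ≤ u ∧ (u : WithTop ℝ≥0) < τ (k + 1)}.indicator (fun _ => g k) u := by
  obtain ⟨k, hk, h1, h2⟩ := SimpleStrategy.exists_index hf.zero
    ((WithTop.coe_le_coe.2 hu).trans_lt (hK K le_rfl))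
  have hmem : u ∈ {u : ℝ≥0 | τ k ≤ u ∧ (u : WithTop ℝ≥0) < τ (k + 1)} := ⟨h1, h2⟩
  rw [hf.eq u hu k h1 h2, Finset.sum_eq_single k, indicator_of_mem hmem]
  · intro j _ hj
    refine indicator_of_notMem ?_ _
    rintro ⟨h3, h4⟩
    rcases lt_or_gt_of_ne hj with h | h
    · exact absurd (h4.trans_le (hf.monotone (Nat.succ_le_of_lt h))) (not_lt.2 h1)
    · exact absurd (h2.trans_le (hf.monotone (Nat.succ_le_of_lt h))) (not_lt.2 h3)
  · intro h
    exact absurd (Finset.mem_range.2 hk) h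

lemma IsStepPath.integrableOn (hf : IsStepPath τ g f t) [IsFiniteMeasure μ] :
    IntegrableOn f (Ioc 0 t) μ := by
  obtain ⟨K, hK⟩ := exists_forall_lt_of_finite hf.finite
  refine IntegrableOn.congr_fun (f := fun u => ∑ k ∈ Finset.range K,
    {u : ℝ≥0 | τ k ≤ u ∧ (u : WithTop ℝ≥0) < τ (k + 1)}.indicator (fun _ => g k) u) ?_
    (fun u hu => (hf.eq_sum hK hu.2).symm) measurableSet_Ioc
  refine Integrable.integrableOn (integrable_finsetSum _ fun k _ => ?_)
  exact (integrable_const _).indicator (measurableSet_coe_Ico _ _)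

/-- The step intervals are closed on the left, the Stieltjes intervals on the right. They differ at
most in the two endpoints, which carry no mass. -/
lemma IsStieltjes.integral_step (hμ : IsStieltjes μ p t) (hf : IsStepPath τ g f t) (hs : s ≤ t) :
    ∫ u in Ioc 0 s, f u ∂μ = ∑' k, g k * (p (cap s (τ (k + 1))) - p (cap s (τ k))) := by
  have := hμ.finite
  have := hμ.nullSingleton
  obtain ⟨K, hK⟩ := exists_forall_lt_of_finite hf.finite
  rw [tsum_increments_eq_sum hf.monotone hK hs g p,
    setIntegral_congr_fun measurableSet_Ioc fun u hu => hf.eq_sum hK (hu.2.trans hs),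
    integral_finsetSum _ fun k _ =>
      ((integrable_const (g k)).indicator (measurableSet_coe_Ico _ _)).integrableOn]
  refine Finset.sum_congr rfl fun k _ => ?_
  set a := cap s (τ k) with ha
  set b := cap s (τ (k + 1)) with hb
  have hbs : b ≤ s := cap_le _ _
  have hab : a ≤ b := cap_mono le_rfl (hf.monotone (Nat.le_succ k))
  rw [setIntegral_indicator (measurableSet_coe_Ico _ _), setIntegral_const, smul_eq_mul, mul_comm,
    ← hμ.real_Ioc a b hab (hbs.trans hs)]
  congr 1
  refine measureReal_congr ?_
  have hnull : μ {a, b} = 0 := (Set.toFinite _).measure_zero μ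
  filter_upwards [compl_mem_ae_iff.2 hnull] with u hu
  have hu' : u ≠ a ∧ u ≠ b := by
    simpa [not_or] using hu
  refine propext ⟨?_, ?_⟩
  · rintro ⟨h1, h2⟩
    have h3 : (a : WithTop ℝ≥0) = τ k :=
      coe_cap_of_ge (h2.1.trans (WithTop.coe_le_coe.2 h1.2))
    refine ⟨lt_of_le_of_ne (WithTop.coe_le_coe.1 (h3.trans_le h2.1)) hu'.1.symm, ?_⟩
    rw [← WithTop.coe_le_coe, hb, coe_cap]
    exact le_min (WithTop.coe_le_coe.2 h1.2) h2.2.le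
  · rintro ⟨h1, h2⟩
    have h3 : (a : WithTop ℝ≥0) = τ k := by
      refine coe_cap_of_ge ?_
      by_contra hcon
      have : a = s := cap_of_le (not_le.1 hcon).le
      exact absurd (h2.trans hbs) (not_le.2 (this ▸ h1))
    refine ⟨⟨lt_of_le_of_lt zero_le h1, h2.trans hbs⟩, ?_, ?_⟩
    · rw [← h3]; exact WithTop.coe_le_coe.2 h1.le
    · exact (WithTop.coe_lt_coe.2 (lt_of_le_of_ne h2 hu'.2)).trans_le (coe_cap_le _ _)

end ModelFree

end

/-! ### Integration by parts and criteria for a martingale to vanish. -/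

noncomputable section
namespace ModelFree

variable {Ω : Type*} [mΩ : MeasurableSpace Ω]

lemma SimpleStrategy.Unbounded.finite {𝓕 : Filtration ℝ≥0 mΩ} {G : SimpleStrategy 𝓕}
    (hG : G.Unbounded) (t : ℝ≥0) (ω : Ω) : {n | G.τ n ω ≤ t}.Finite := by
  obtain ⟨n, hn⟩ := hG ω t
  refine (finite_lt_nat n).subset fun k hk => ?_
  by_contra hcon
  exact absurd (hn.trans_le (G.monotone ω (not_lt.1 hcon))) (not_lt.2 hk)

lemma SimpleStrategy.integral_cap_succ {𝓕 : Filtration ℝ≥0 mΩ} (G : SimpleStrategy 𝓕)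
    (X : ℝ≥0 → Ω → ℝ) (t : ℝ≥0) (n : ℕ) (ω : Ω) :
    G.integral X (cap t (G.τ (n + 1) ω)) ω = G.integral X (cap t (G.τ n ω)) ω +
      G.g n ω * (X (cap t (G.τ (n + 1) ω)) ω - X (cap t (G.τ n ω)) ω) := by
  by_cases h : G.τ n ω ≤ t
  · rw [← G.integral_sub X (n := n) (coe_cap_of_ge h).ge
      (cap_mono le_rfl (G.monotone ω (Nat.le_succ n))) (coe_cap_le _ _)]
    ring
  · rw [not_le] at h
    rw [cap_of_le h.le, cap_of_le (h.le.trans (G.monotone ω (Nat.le_succ n)))]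
    ring

lemma SimpleStrategy.Unbounded.isStepPath {𝓕 : Filtration ℝ≥0 mΩ} {G : SimpleStrategy 𝓕}
    (hG : G.Unbounded) (t : ℝ≥0) (ω : Ω) :
    IsStepPath (fun n => G.τ n ω) (fun n => G.g n ω) (fun s => G.step s ω) t where
  monotone := G.monotone ω
  zero := G.zero ω
  finite := hG.finite t ω
  eq := fun _ _ _ h h' => G.step_eq h h'

lemma IsStepPath.mul {τ : ℕ → WithTop ℝ≥0} {g h : ℕ → ℝ} {f k : ℝ≥0 → ℝ} {t : ℝ≥0}
    (hf : IsStepPath τ g f t) (hk : IsStepPath τ h k t) :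
    IsStepPath τ (fun n => g n * h n) (fun s => f s * k s) t where
  monotone := hf.monotone
  zero := hf.zero
  finite := hf.finite
  eq := fun u hu n h1 h2 => by simp only [hf.eq u hu n h1 h2, hk.eq u hu n h1 h2]

namespace MartingaleSpace

variable {d : ℕ} {𝓜 : MartingaleSpace Ω d} [NeZero d] [hA : Fact 𝓜.AssumptionA]
  [hR : 𝓜.𝓕.IsRightContinuous]

/-! ### Products of simple integrals -/

/-- Integration by parts for two simple integrals along the same times. -/
lemma RM.integral_mul_sub {x y C : ℝ≥0 → Ω → ℝ} (hx : 𝓜.RM x) (hy : 𝓜.RM y)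
    (hC : 𝓜.RM fun t ω => x t ω * y t ω - C t ω) {Φ Ψ : SimpleStrategy 𝓜.𝓕} (hΦ : Φ.Unbounded)
    (hτ : ∀ n, Ψ.τ n = Φ.τ n) (hΦ0 : Φ.c = 0) :
    𝓜.RM fun t ω => Φ.integral x t ω * Ψ.integral y t ω -
      ∑' n, Φ.g n ω * Ψ.g n ω * (C (cap t (Φ.τ (n + 1) ω)) ω - C (cap t (Φ.τ n ω)) ω) := by
  set M := Φ.integral x with hM
  set N := Ψ.integral y with hN
  have hMRM : 𝓜.RM M := hx.strategy Φ
  have hNRM : 𝓜.RM N := hy.strategy Ψ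
  have hS := Φ.isStoppingTime
  have hg := Φ.locMeas
  have hh : ∀ n, LocMeas 𝓜.𝓕 (Φ.τ n) (Ψ.g n) := fun n => hτ n ▸ Ψ.locMeas n
  have hfin : ∀ᶠ p in 𝓜.wie, {n | Φ.τ n p.2 ≤ p.1}.Finite :=
    Eventually.of_forall fun p => hΦ.finite p.1 p.2
  -- With `ΔM = g Δx` and `ΔN = h Δy`, `Δ(MN) = M ΔN + N ΔM + g h Δx Δy`, and `Δx Δy = Δ(xy - C) +
  -- ΔC - x Δy - y Δx`. Apart from `g h ΔC`, the terms collect into integrals against `xy - C`, `y`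
  -- and `x`.
  have h1 := hC.integral hS Φ.monotone hfin fun n => (hg n).mul (hh n) (hS n)
  have h2 := hy.integral hS Φ.monotone hfin (g := fun n ω => Ψ.g n ω * valueAt M (Φ.τ n) ω -
    Φ.g n ω * Ψ.g n ω * valueAt x (Φ.τ n) ω) fun n =>
      ((hh n).mul (hMRM.locMeas_valueAt (hS n)) (hS n)).sub
        (((hg n).mul (hh n) (hS n)).mul (hx.locMeas_valueAt (hS n)) (hS n)) (hS n)
  have h3 := hx.integral hS Φ.monotone hfin (g := fun n ω => Φ.g n ω * valueAt N (Φ.τ n) ω -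
    Φ.g n ω * Ψ.g n ω * valueAt y (Φ.τ n) ω) fun n =>
      ((hg n).mul (hNRM.locMeas_valueAt (hS n)) (hS n)).sub
        (((hg n).mul (hh n) (hS n)).mul (hy.locMeas_valueAt (hS n)) (hS n)) (hS n)
  refine ((h1.add h2).add h3).congr (Eventually.of_forall ?_)
  rintro ⟨t', ω⟩ t -
  obtain ⟨K, hK⟩ := exists_forall_lt_of_finite (hΦ.finite t ω)
  rw [tsum_increments_eq_sum (Φ.monotone ω) hK le_rfl _ fun t => x t ω * y t ω - C t ω,
    tsum_increments_eq_sum (Φ.monotone ω) hK le_rfl (fun n => Ψ.g n ω * valueAt M (Φ.τ n) ω -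
      Φ.g n ω * Ψ.g n ω * valueAt x (Φ.τ n) ω) fun t => y t ω,
    tsum_increments_eq_sum (Φ.monotone ω) hK le_rfl (fun n => Φ.g n ω * valueAt N (Φ.τ n) ω -
      Φ.g n ω * Ψ.g n ω * valueAt y (Φ.τ n) ω) fun t => x t ω,
    tsum_increments_eq_sum (Φ.monotone ω) hK le_rfl (fun n => Φ.g n ω * Ψ.g n ω) fun t => C t ω,
    ← Finset.sum_add_distrib, ← Finset.sum_add_distrib, eq_sub_iff_add_eq,
    ← Finset.sum_add_distrib]
  have e : ∑ n ∈ Finset.range K, (M (cap t (Φ.τ (n + 1) ω)) ω * N (cap t (Φ.τ (n + 1) ω)) ω -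
      M (cap t (Φ.τ n ω)) ω * N (cap t (Φ.τ n ω)) ω) = M t ω * N t ω := by
    rw [Finset.sum_range_sub (f := fun n => M (cap t (Φ.τ n ω)) ω * N (cap t (Φ.τ n ω)) ω), Φ.zero,
      cap_zero, cap_of_le (hK K le_rfl).le, hM, Φ.integral_zero_time, hΦ0, zero_mul, sub_zero]
  rw [← e]
  refine Finset.sum_congr rfl fun n _ => ?_
  have eM : M (cap t (Φ.τ (n + 1) ω)) ω = M (cap t (Φ.τ n ω)) ω +
      Φ.g n ω * (x (cap t (Φ.τ (n + 1) ω)) ω - x (cap t (Φ.τ n ω)) ω) :=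
    Φ.integral_cap_succ x t n ω
  have eN : N (cap t (Φ.τ (n + 1) ω)) ω = N (cap t (Φ.τ n ω)) ω +
      Ψ.g n ω * (y (cap t (Φ.τ (n + 1) ω)) ω - y (cap t (Φ.τ n ω)) ω) := by
    have := Ψ.integral_cap_succ y t n ω
    rwa [hτ, hτ] at this
  by_cases hn : Φ.τ n ω ≤ t
  · rw [valueAt_eq hn, valueAt_eq hn, valueAt_eq hn, valueAt_eq hn, eM, eN]
    ring
  · rw [cap_succ_eq_cap (Φ.monotone ω) (not_le.1 hn) le_rfl]
    ring

/-! ### Vanishing criteria -/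

/-- The maximal function has zero upper expectation, by the maximal bound with arbitrarily small
`a`. -/
lemma RM.eventually_eq_zero_of_L2Bound {z : ℝ≥0 → Ω → ℝ} (hz : 𝓜.RM z) (h : 𝓜.L2Bound z 0) :
    ∀ᶠ p in 𝓜.wie, ∀ s ≤ p.1, z s p.2 = 0 := by
  have h1 : 𝓜.upperExp (fun t ω => ⨆ s ≤ t, ENNReal.ofReal |z s ω|) = 0 := by
    refine le_antisymm ?_ zero_le
    refine ENNReal.le_of_forall_pos_le_add fun ε hε _ => ?_
    have hε' : (0 : ℝ) < ε := hε
    refine ((h.mono (sq_nonneg ((ε : ℝ) / 5))).upperExp_iSup_le (by positivity) hz).trans ?_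
    rw [zero_add, mul_div_cancel₀ _ (by norm_num), ENNReal.ofReal_coe_nnreal]
  filter_upwards [eventually_eq_zero_of_upperExp h1] with p hp s hs
  have h2 : ENNReal.ofReal |z s p.2| ≤ 0 :=
    (le_iSup₂ (f := fun s (_ : s ≤ p.1) => ENNReal.ofReal |z s p.2|) s hs).trans hp.le
  have h3 := ENNReal.ofReal_eq_zero.1 (le_antisymm h2 zero_le)
  exact abs_eq_zero.1 (le_antisymm h3 (abs_nonneg _))

/-- If `z²` is itself a martingale started at `0`, it serves as the dominating martingale for the
second moment, with constant `0`. -/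
lemma RM.eventually_eq_zero_of_sq {z : ℝ≥0 → Ω → ℝ} (hz : 𝓜.RM z) (hz2 : 𝓜.RM fun t ω => z t ω ^ 2)
    (h0 : ∀ ω, z 0 ω = 0) : ∀ᶠ p in 𝓜.wie, ∀ s ≤ p.1, z s p.2 = 0 :=
  hz.eventually_eq_zero_of_L2Bound <| .of_RM hz2 (fun ω => by simp [h0])
    (Eventually.of_forall fun p => (zero_add _).ge)

/-- A martingale of finite variation is constant. -/
lemma RM.eventually_eq_zero_of_variation {z B : ℝ≥0 → Ω → ℝ} (hz : 𝓜.RM z) (h0 : ∀ ω, z 0 ω = 0)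
    (hB : ∀ᶠ p in 𝓜.wie, ∀ s s', s ≤ s' → s' ≤ p.1 → |z s' p.2 - z s p.2| ≤ B s' p.2 - B s p.2) :
    ∀ᶠ p in 𝓜.wie, ∀ s ≤ p.1, z s p.2 = 0 := by
  have hZ : 𝓜.IsMartingale fun t ω => (z t ω : EReal) := hz
  obtain ⟨σ, -, hσ⟩ := hZ.exists_covers_seq
  rw [realPart_coe] at hσ
  refine hz.eventually_eq_zero_of_sq ?_ h0
  refine RM.of_locUnif (y := fun j t ω => 2 * coverIntegral (σ j) z t ω)
    (fun j => ((hσ j).coverIntegral_RM hz).const_mul 2) ?_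
  have hqv := fun j => (show 𝓜.Covers (σ j) (ModelFree.realPart fun t ω => (z t ω : EReal)) _ from
    hσ j).simpleQV_eq
  filter_upwards [hB, eventually_wie_all.2 hqv, eventually_wie_all.2 fun j => (hσ j).eventually_finite,
    eventually_wie_all.2 fun j => (hσ j).eventually_le] with ⟨t, ω⟩ hB hqv hfin hle
  simp only at hB hqv hfin hle ⊢
  -- The left-hand side is the simple quadratic variation, bounded by the largest increment times
  -- the variation. It tends to `0`, so `z²` is a limit of the martingales `2 ∑ z Δz`.
  have key : ∀ j, ∀ s ≤ t, |z s ω ^ 2 - 2 * coverIntegral (σ j) z s ω| ≤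
      (1 / 4) ^ j * (B t ω - B 0 ω) := by
    intro j s hs
    obtain ⟨K, hK⟩ := exists_forall_lt_of_finite (hfin j)
    have h1 := (simpleQV_eq_sum (X := fun t ω => (z t ω : EReal)) ((hσ j).monotone ω) hK hs).symm.trans
      (hqv j s hs)
    rw [realPart_coe, EReal.coe_eq_coe_iff, h0, zero_pow two_ne_zero, sub_zero] at h1
    rw [← h1, abs_of_nonneg (Finset.sum_nonneg fun _ _ => sq_nonneg _)]
    have hm := (hσ j).monotone ω
    have h2 : ∀ n, (z (cap s (σ j (n + 1) ω)) ω - z (cap s (σ j n ω)) ω) ^ 2 ≤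
        (1 / 4) ^ j * (B (cap s (σ j (n + 1) ω)) ω - B (cap s (σ j n ω)) ω) := by
      intro n
      have h3 := hB _ _ (cap_mono (le_refl s) (hm (Nat.le_succ n))) ((cap_le _ _).trans hs)
      have h4 : |z (cap s (σ j (n + 1) ω)) ω - z (cap s (σ j n ω)) ω| ≤ (1 / 4) ^ j := by
        by_cases hn : σ j n ω ≤ s
        · rw [← valueAt_eq (x := z) hn]
          refine hle j n _ ((cap_le _ _).trans hs) ?_ (coe_cap_le _ _)
          rw [← coe_cap_of_ge hn]
          exact WithTop.coe_le_coe.2 (cap_mono le_rfl (hm (Nat.le_succ n)))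
        · rw [cap_succ_eq_cap hm (not_le.1 hn) le_rfl, sub_self, abs_zero]
          positivity
      rw [← sq_abs, pow_two]
      exact mul_le_mul h4 h3 (abs_nonneg _) (by positivity)
    refine (Finset.sum_le_sum fun n _ => h2 n).trans ?_
    rw [← Finset.mul_sum, Finset.sum_range_sub (f := fun n => B (cap s (σ j n ω)) ω),
      cap_of_le ((WithTop.coe_le_coe.2 hs).trans (hK K le_rfl).le), (hσ j).zero, cap_zero]
    have h5 := (abs_nonneg _).trans (hB s t hs le_rfl)
    exact mul_le_mul_of_nonneg_left (by linarith) (by positivity)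
  rw [Metric.tendstoUniformlyOn_iff]
  intro ε hε
  have hlim := tendsto_quarter_pow.mul_const (B t ω - B 0 ω)
  rw [zero_mul] at hlim
  filter_upwards [hlim.eventually_lt_const hε] with j hj s hs
  rw [Real.dist_eq]
  exact (key j s hs).trans_lt hj

end MartingaleSpace

end ModelFree

end

/-! ### Step approximations of càdlàg integrands and limits of their integrals. -/

noncomputable section
namespace ModelFree

variable {Ω : Type*} [mΩ : MeasurableSpace Ω]

/-! ### Uniform approximation of càdlàg processes by step processes -/

/-- The strategy holding the value of `z` at the last of the times `τ n`. -/
def SimpleStrategy.sample {𝓕 : Filtration ℝ≥0 mΩ} {τ : ℕ → Ω → WithTop ℝ≥0} {z : ℝ≥0 → Ω → ℝ}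
    (hτ : ∀ n, IsStoppingTime 𝓕 (τ n)) (hmono : ∀ ω, Monotone fun n => τ n ω) (h0 : ∀ ω, τ 0 ω = 0)
    (hfin : ∀ (t : ℝ≥0) ω, {n | τ n ω ≤ t}.Finite) (hb : ∃ K : ℝ, ∀ t ω, |z t ω| ≤ K)
    (hz : ∀ n, LocMeas 𝓕 (τ n) (MartingaleSpace.valueAt z (τ n))) : SimpleStrategy 𝓕 :=
  ofLocMeas 0 τ (fun n => {ω | τ n ω ≠ ⊤}.indicator (MartingaleSpace.valueAt z (τ n))) hτ hmono h0
    (fun ω => Or.inl fun T => by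
      obtain ⟨K, hK⟩ := exists_forall_lt_of_finite (hfin T ω)
      exact ⟨K, hK K le_rfl⟩)
    (fun n => by
      obtain ⟨K, hK⟩ := hb
      refine ⟨K, fun ω => ?_⟩
      by_cases h : ω ∈ {ω | τ n ω ≠ ⊤}
      · rw [indicator_of_mem h]; exact hK _ _
      · rw [indicator_of_notMem h, abs_zero]; exact (abs_nonneg _).trans (hK 0 ω))
    (fun n t => by
      have e : {ω | τ n ω ≤ t}.indicator ({ω | τ n ω ≠ ⊤}.indicator (MartingaleSpace.valueAt z (τ n))) =
          {ω | τ n ω ≤ t}.indicator (MartingaleSpace.valueAt z (τ n)) := by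
        ext ω
        by_cases h : ω ∈ {ω | τ n ω ≤ t}
        · have h' : ω ∈ {ω | τ n ω ≠ ⊤} := ne_top_of_le_ne_top WithTop.coe_ne_top h
          rw [indicator_of_mem h, indicator_of_mem h, indicator_of_mem h']
        · rw [indicator_of_notMem h, indicator_of_notMem h]
      rw [e]
      exact hz n t)
    (fun n ω h => indicator_of_notMem (not_not_intro h) _)

lemma SimpleStrategy.sample_step {𝓕 : Filtration ℝ≥0 mΩ} {τ : ℕ → Ω → WithTop ℝ≥0}
    {z : ℝ≥0 → Ω → ℝ} (hτ : ∀ n, IsStoppingTime 𝓕 (τ n)) (hmono : ∀ ω, Monotone fun n => τ n ω)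
    (h0 : ∀ ω, τ 0 ω = 0) (hfin : ∀ (t : ℝ≥0) ω, {n | τ n ω ≤ t}.Finite)
    (hb : ∃ K : ℝ, ∀ t ω, |z t ω| ≤ K) (hz : ∀ n, LocMeas 𝓕 (τ n) (MartingaleSpace.valueAt z (τ n))) {n : ℕ}
    {s : ℝ≥0} {ω : Ω} (h : τ n ω ≤ s) (h' : (s : WithTop ℝ≥0) < τ (n + 1) ω) :
    (sample hτ hmono h0 hfin hb hz).step s ω = MartingaleSpace.valueAt z (τ n) ω := by
  rw [step_eq _ (n := n) h h']
  have : ω ∈ {ω | τ n ω ≠ ⊤} := ne_top_of_le_ne_top WithTop.coe_ne_top h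
  exact indicator_of_mem this _

namespace MartingaleSpace

variable {d : ℕ} {𝓜 : MartingaleSpace Ω d} [NeZero d] [hA : Fact 𝓜.AssumptionA]
  [hR : 𝓜.𝓕.IsRightContinuous]

variable (𝓜) in
/-- `Φ` approximates `G` uniformly, with errors `(1 / 4) ^ j`. -/
structure StepApprox (Φ : ℕ → SimpleStrategy 𝓜.𝓕) (G : ℝ≥0 → Ω → ℝ) : Prop where
  c_eq : ∀ j, (Φ j).c = 0
  unbounded : ∀ j, (Φ j).Unbounded
  le : ∀ j t ω, |(Φ j).step t ω - G t ω| ≤ (1 / 4) ^ j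

/-- Both processes are sampled along one partition at which either has moved by more than `4⁻ʲ`. The
common times are what makes `RM.integral_mul_sub` applicable to the pair. -/
lemma exists_stepApprox {G H : ℝ≥0 → Ω → ℝ} (hG : Adapted 𝓜.𝓕 G) (hH : Adapted 𝓜.𝓕 H)
    (hGc : ∀ ω, IsCadlag fun t => G t ω) (hHc : ∀ ω, IsCadlag fun t => H t ω)
    (hGb : ∃ K : ℝ, ∀ t ω, |G t ω| ≤ K) (hHb : ∃ K : ℝ, ∀ t ω, |H t ω| ≤ K) :
    ∃ Φ Ψ : ℕ → SimpleStrategy 𝓜.𝓕, 𝓜.StepApprox Φ G ∧ 𝓜.StepApprox Ψ H ∧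
      ∀ j n, (Ψ j).τ n = (Φ j).τ n := by
  have hGt : ∀ᶠ p in 𝓜.wie, CadlagTo (fun s => G s p.2) p.1 :=
    Eventually.of_forall fun p => (hGc p.2).cadlagTo p.1
  have hHt : ∀ᶠ p in 𝓜.wie, CadlagTo (fun s => H s p.2) p.1 :=
    Eventually.of_forall fun p => (hHc p.2).cadlagTo p.1
  have hτ := fun j : ℕ => partTime_isStoppingTime hG hH hGt hHt ((1 / 4) ^ j)
  have hfin : ∀ (j : ℕ) (t : ℝ≥0) ω, {n | partTime G H ((1 / 4) ^ j) n ω ≤ t}.Finite :=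
    fun j t ω => partTime_finite (by positivity) ((hGc ω).cadlagTo t) ((hHc ω).cadlagTo t)
  have hm := fun j : ℕ => partTime_monotone G H ((1 / 4) ^ j)
  have hGl := fun j n => locMeas_valueAt_of_adapted (hτ j n) (adapted_stop_of_cadlagTo hG hGt (hτ j n))
  have hHl := fun j n => locMeas_valueAt_of_adapted (hτ j n) (adapted_stop_of_cadlagTo hH hHt (hτ j n))
  have hidx : ∀ (j : ℕ) (t : ℝ≥0) ω, ∃ n, partTime G H ((1 / 4) ^ j) n ω ≤ t ∧
      (t : WithTop ℝ≥0) < partTime G H ((1 / 4) ^ j) (n + 1) ω := by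
    intro j t ω
    obtain ⟨K, hK⟩ := exists_forall_lt_of_finite (hfin j t ω)
    obtain ⟨n, -, h⟩ := SimpleStrategy.exists_index
      (τ := fun n => partTime G H ((1 / 4) ^ j) n ω) rfl (hK K le_rfl)
    exact ⟨n, h⟩
  have hub : ∀ (j : ℕ) ω (t : ℝ≥0), ∃ n, (t : WithTop ℝ≥0) < partTime G H ((1 / 4) ^ j) n ω :=
    fun j ω t => (hidx j t ω).imp' (· + 1) fun n h => h.2
  have hδ : ∀ j : ℕ, (0 : ℝ) < (1 / 4) ^ j := fun j => by positivity
  have h0 : ∀ (j : ℕ) ω, partTime G H ((1 / 4) ^ j) 0 ω = 0 := fun _ _ => rfl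
  refine ⟨fun j => .sample (hτ j) (hm j) (h0 j) (hfin j) hGb (hGl j),
    fun j => .sample (hτ j) (hm j) (h0 j) (hfin j) hHb (hHl j),
    ⟨fun j => rfl, fun j => hub j, fun j t ω => ?_⟩, ⟨fun j => rfl, fun j => hub j, fun j t ω => ?_⟩,
    fun j n => rfl⟩
  · obtain ⟨n, h1, h2⟩ := hidx j t ω
    rw [SimpleStrategy.sample_step _ _ _ _ _ _ h1 h2, abs_sub_comm]
    exact (abs_sub_le_of_mem_partition (hδ j) ((hGc ω).cadlagTo t) ((hHc ω).cadlagTo t) le_rfl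
      h1 h2).1
  · obtain ⟨n, h1, h2⟩ := hidx j t ω
    rw [SimpleStrategy.sample_step _ _ _ _ _ _ h1 h2, abs_sub_comm]
    exact (abs_sub_le_of_mem_partition (hδ j) ((hGc ω).cadlagTo t) ((hHc ω).cadlagTo t) le_rfl
      h1 h2).2

namespace StepApprox

variable {Φ : ℕ → SimpleStrategy 𝓜.𝓕} {G : ℝ≥0 → Ω → ℝ}

lemma tendsto_step (h : 𝓜.StepApprox Φ G) (t : ℝ≥0) (ω : Ω) :
    Tendsto (fun j => (Φ j).step t ω) atTop (𝓝 (G t ω)) := by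
  rw [tendsto_iff_dist_tendsto_zero]
  exact squeeze_zero (fun _ => dist_nonneg) (fun j => (Real.dist_eq _ _).trans_le (h.le j t ω))
    tendsto_quarter_pow

/-- Pathwise measurability of `G` comes from its being a pointwise limit of step paths. -/
lemma aestronglyMeasurable (h : 𝓜.StepApprox Φ G) (t : ℝ≥0) (ω : Ω) {μ : Measure ℝ≥0}
    [IsFiniteMeasure μ] : AEStronglyMeasurable (fun s => G s ω) (μ.restrict (Ioc 0 t)) :=
  aestronglyMeasurable_of_tendsto_ae atTop
    (fun j => ((h.unbounded j).isStepPath t ω).integrableOn.aestronglyMeasurable)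
    (Eventually.of_forall fun s => h.tendsto_step s ω)

/-- The two step processes are `4⁻ⁱ`- and `4⁻ʲ`-close to `G`, so their difference is at most the sum
of these errors. -/
lemma l2Bound_sub (h : 𝓜.StepApprox Φ G) {x : ℝ≥0 → Ω → ℝ} (hx : 𝓜.RM x) (N i j : ℕ) :
    𝓜.L2Bound (fun t ω => (Φ i).integral x (cap t (hit x N ω)) ω -
      (Φ j).integral x (cap t (hit x N ω)) ω) ((N : ℝ) ^ 2 * ((1 / 4) ^ i + (1 / 4) ^ j) ^ 2) := by
  have h1 := L2Bound.strategy hx (G := (Φ i).sub (Φ j)) (ε := (1 / 4) ^ i + (1 / 4) ^ j) (N := N)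
    (by rw [SimpleStrategy.sub_c, h.c_eq, h.c_eq, sub_zero]) (hx.isStoppingTime_hit N)
    (Eventually.of_forall fun p s _ hs => ⟨?_, (abs_lt_of_lt_hit hs).le⟩)
  · simp only [SimpleStrategy.sub_integral] at h1
    exact h1.mono (mul_comm _ _).le
  · rw [SimpleStrategy.sub_step]
    have h2 := abs_sub_le ((Φ i).step s p.2) (G s p.2) ((Φ j).step s p.2)
    rw [abs_sub_comm (G s p.2)] at h2
    exact h2.trans (add_le_add (h.le i s p.2) (h.le j s p.2))

/-- The limit of the simple integrals of uniform approximations. -/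
lemma exists_limit (h : 𝓜.StepApprox Φ G) {x : ℝ≥0 → Ω → ℝ} (hx : 𝓜.RM x) :
    ∃ I, 𝓜.RM I ∧ 𝓜.LocUnif (fun j => (Φ j).integral x) I ∧ ∀ N j : ℕ,
      𝓜.L2Bound (fun t ω => (Φ j).integral x (cap t (hit x N ω)) ω - I (cap t (hit x N ω)) ω)
        ((N : ℝ) ^ 2 * ((1 / 4) ^ j) ^ 2) :=
  exists_limit_of_L2Bound hx.localizing_hit (fun N => by positivity) (fun j => hx.strategy (Φ j))
    fun N i j => h.l2Bound_sub hx N i j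

end StepApprox

end MartingaleSpace

/-! ### Exit times of extended processes -/

lemma min_eq_min_of_lt_iff {t : ℝ≥0} {a b : WithTop ℝ≥0} (h : ∀ s ≤ t, a < s ↔ b < s) :
    min (t : WithTop ℝ≥0) a = min (t : WithTop ℝ≥0) b := by
  have key : ∀ {a b : WithTop ℝ≥0}, (∀ s ≤ t, a < s ↔ b < s) →
      min (t : WithTop ℝ≥0) a ≤ min (t : WithTop ℝ≥0) b := by
    intro a b h
    refine le_min (min_le_left _ _) (not_lt.1 fun hcon => ?_)
    have h1 : b < cap t a := hcon.trans_eq (coe_cap t a).symm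
    exact absurd ((h _ (cap_le t a)).2 h1) (not_lt.2 (coe_cap_le t a))
  exact le_antisymm (key h) (key fun s hs => (h s hs).symm)

/-- Exit times of the extended process, which occur in the distances, agree up to `t` with those of
its real part as long as the path is real on `[0, t]`. The latter are known to be stopping times. -/
lemma min_sigma_eq {X : ℝ≥0 → Ω → EReal} {x : ℝ≥0 → Ω → ℝ} {t : ℝ≥0} {ω : Ω}
    (h : ∀ s ≤ t, x s ω = X s ω) (N : ℕ) :
    min (t : WithTop ℝ≥0) (sigma X N ω) = min (t : WithTop ℝ≥0) (hit x N ω) := by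
  refine min_eq_min_of_lt_iff fun s hs => ?_
  rw [sigma, hit, hittingAfter_lt_iff, hittingAfter_lt_iff]
  refine exists_congr fun u => and_congr_right fun hu => ?_
  rw [← h u (hu.2.le.trans hs), EReal.abs_def, mem_Ici, ← ENNReal.ofReal_natCast,
    ENNReal.ofReal_le_ofReal_iff (abs_nonneg _)]
  rfl

lemma cap_sigma_eq {X : ℝ≥0 → Ω → EReal} {x : ℝ≥0 → Ω → ℝ} {t : ℝ≥0} {ω : Ω}
    (h : ∀ s ≤ t, x s ω = X s ω) (N : ℕ) : cap t (sigma X N ω) = cap t (hit x N ω) := by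
  rw [cap, cap, min_sigma_eq h]

end ModelFree

end

/-! ### Existence of the integral. -/

noncomputable section
namespace ModelFree

variable {Ω : Type*} [mΩ : MeasurableSpace Ω]

lemma tsum_geometric_mul_sq_ne_top :
    ∑' N : ℕ, (2 : ℝ≥0∞)⁻¹ ^ (N + 1) * ENNReal.ofReal (6 * ((N + 1 : ℕ) : ℝ) ^ 2) ≠ ⊤ := by
  have h1 : Summable fun N : ℕ => (1 / 2 : ℝ) ^ (N + 1) * (6 * ((N + 1 : ℕ) : ℝ) ^ 2) := by
    have h2 : Summable fun n : ℕ => ((n : ℝ) ^ 2 * (1 / 2 : ℝ) ^ n) :=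
      summable_pow_mul_geometric_of_norm_lt_one 2 (by norm_num)
    refine (((summable_nat_add_iff 1).2 h2).mul_left 6).congr fun n => ?_
    ring
  have h2 : ∀ N : ℕ, (2 : ℝ≥0∞)⁻¹ ^ (N + 1) * ENNReal.ofReal (6 * ((N + 1 : ℕ) : ℝ) ^ 2) =
      ENNReal.ofReal ((1 / 2 : ℝ) ^ (N + 1) * (6 * ((N + 1 : ℕ) : ℝ) ^ 2)) := by
    intro N
    rw [ENNReal.ofReal_mul (p := (1 / 2 : ℝ) ^ (N + 1)) (by positivity),
      ENNReal.ofReal_pow (p := (1 / 2 : ℝ)) (by norm_num), one_div,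
      ENNReal.ofReal_inv_of_pos two_pos, ENNReal.ofReal_ofNat]
  simp_rw [h2]
  rw [← ENNReal.ofReal_tsum_of_nonneg (fun N => by positivity) h1]
  exact ENNReal.ofReal_ne_top

/-- A common majorant for both localized distances: with level `N + 1` the errors are `4⁻ʲ (1 + (N +
1)²)` and `4⁻ʲ · 5 (N + 1)`, and `6 (N + 1)²` covers both. -/
lemma tendsto_tsum_geometric_mul {e : ℕ → ℕ → ℝ≥0∞}
    (h : ∀ j N, e j N ≤ ENNReal.ofReal ((1 / 4) ^ j * (6 * ((N + 1 : ℕ) : ℝ) ^ 2))) :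
    Tendsto (fun j => ∑' N : ℕ, (2 : ℝ≥0∞)⁻¹ ^ (N + 1) * e j N) atTop (𝓝 0) := by
  have h1 : Tendsto (fun j : ℕ => ENNReal.ofReal ((1 / 4) ^ j) *
      ∑' N : ℕ, (2 : ℝ≥0∞)⁻¹ ^ (N + 1) * ENNReal.ofReal (6 * ((N + 1 : ℕ) : ℝ) ^ 2)) atTop
      (𝓝 (ENNReal.ofReal 0 * _)) :=
    ENNReal.Tendsto.mul_const (ENNReal.tendsto_ofReal MartingaleSpace.tendsto_quarter_pow)
      (Or.inr tsum_geometric_mul_sq_ne_top)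
  rw [ENNReal.ofReal_zero, zero_mul] at h1
  refine tendsto_of_tendsto_of_tendsto_of_le_of_le tendsto_const_nhds h1 (fun _ => zero_le)
    fun j => ?_
  simp only
  rw [← ENNReal.tsum_mul_left]
  refine ENNReal.tsum_le_tsum fun N => ?_
  rw [mul_left_comm, ← ENNReal.ofReal_mul (by positivity)]
  exact mul_le_mul_right (h j N) _

/-- The crude `√Q ≤ 1 + Q` removes the square root, so that the upper expectation can be bounded
through a martingale dominating `Q`. -/
lemma qvDist_le {σ : Ω → WithTop ℝ≥0} {Q F G : ℝ≥0 → Ω → ℝ} {t : ℝ≥0} {ω : Ω}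
    (hm : MonotoneOn (fun s => Q s ω) (Iic t)) (hc : ContinuousOn (fun s => Q s ω) (Iic t))
    (h0 : Q 0 ω = 0) {ε : ℝ} (hε : 0 ≤ ε) (hFG : ∀ s, |F s ω - G s ω| ≤ ε)
    (hmeas : ∀ μ : Measure ℝ≥0, IsFiniteMeasure μ →
      AEStronglyMeasurable (fun s => F s ω - G s ω) (μ.restrict (Ioc 0 t))) :
    qvDist σ Q F G t ω ≤ ENNReal.ofReal (ε * (1 + Q (cap t (σ ω)) ω)) := by
  obtain ⟨μ, hμ⟩ := exists_isStieltjes hm hc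
  have := hμ.finite
  have hsq : ∀ s, |(F s ω - G s ω) ^ 2| ≤ ε ^ 2 := fun s => by
    rw [abs_pow]; exact pow_le_pow_left₀ (abs_nonneg _) (hFG s) 2
  have hint : IntegrableOn (fun s => (F s ω - G s ω) ^ 2) (Ioc 0 t) μ :=
    Integrable.of_bound ((hmeas μ hμ.finite).pow 2) (ε ^ 2)
      (Eventually.of_forall fun s => (Real.norm_eq_abs _).trans_le (hsq s))
  have h1 := hμ.lsIntegral_eq_of_monotone (cap_le t (σ ω)) hint
  have h2 := hμ.abs_setIntegral_le (a := 0) zero_le (cap_le t (σ ω)) fun u _ => hsq u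
  have e : qvDist σ Q F G t ω = ENNReal.ofReal (∫ u in Ioc 0 (cap t (σ ω)), (F u ω - G u ω) ^ 2 ∂μ) ^
      (1 / 2 : ℝ) := by
    rw [← h1.2]
    exact if_pos h1.1
  rw [e]
  rw [h0, sub_zero] at h2
  have hQ : 0 ≤ Q (cap t (σ ω)) ω :=
    h0.ge.trans (hm (mem_Iic.2 zero_le) (cap_le t (σ ω)) zero_le)
  have h3 : 0 ≤ ε * (1 + Q (cap t (σ ω)) ω) := by positivity
  calc _ ≤ ENNReal.ofReal ((ε * (1 + Q (cap t (σ ω)) ω)) ^ 2) ^ (1 / 2 : ℝ) := by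
        refine ENNReal.rpow_le_rpow (ENNReal.ofReal_le_ofReal ((le_abs_self _).trans (h2.trans ?_)))
          (by norm_num)
        rw [mul_pow]
        exact mul_le_mul_of_nonneg_left (by nlinarith) (sq_nonneg ε)
    _ = _ := by
        rw [ENNReal.ofReal_rpow_of_nonneg (sq_nonneg _) (by norm_num), ← Real.sqrt_eq_rpow,
          Real.sqrt_sq h3]

namespace MartingaleSpace

variable {d : ℕ} {𝓜 : MartingaleSpace Ω d} [NeZero d] [hA : Fact 𝓜.AssumptionA]
  [hR : 𝓜.𝓕.IsRightContinuous]

/-- The quadratic variation up to an exit time is dominated by a martingale. -/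
lemma IsQuadVar.exists_dominating {X : ℝ≥0 → Ω → EReal} {P : ℝ≥0 → Ω → ℝ}
    (hX : 𝓜.IsMartingale X) (hP : 𝓜.IsQuadVar X P) (N : ℕ) :
    ∃ W, 𝓜.RM W ∧ (∀ ω, W 0 ω = (N : ℝ) ^ 2) ∧
      ∀ᶠ p in 𝓜.wie, P (cap p.1 (hit (ModelFree.realPart X) N p.2)) p.2 ≤ W p.1 p.2 := by
  set x := ModelFree.realPart X with hx
  have hxRM : 𝓜.RM x := hX.realPart
  have hρ := hxRM.isStoppingTime_hit N
  obtain ⟨c, hc⟩ := hxRM.exists_zero_eq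
  have hcap : ∀ τ : WithTop ℝ≥0, cap 0 τ = 0 := fun τ => le_antisymm (cap_le 0 τ) zero_le
  -- Stop the martingale `x² - P` at the exit time, where `x² ≤ N²` if `|x₀| ≤ N`. In the other case
  -- stopping occurs at time `0` and `P` is still zero.
  refine ⟨fun t ω => (N : ℝ) ^ 2 + c ^ 2 - (x (cap t (hit x N ω)) ω ^ 2 - P (cap t (hit x N ω)) ω),
    (RM.const _).sub ((hP.sq_sub_RM hX).stopAt hρ), fun ω => ?_, ?_⟩
  · simp only [hcap, hc, hP.zero hX]
    ring
  filter_upwards [hxRM.eventually_continuousOn] with ⟨t, ω⟩ hcont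
  simp only at hcont ⊢
  by_cases h0 : |x 0 ω| ≤ N
  · have h1 := abs_le_of_le_hit hcont h0 (cap_le t (hit x N ω)) (coe_cap_le _ _)
    have h2 := sq_le_sq' (by linarith [(abs_le.1 h1).1]) (abs_le.1 h1).2
    linarith [sq_nonneg c]
  · have h1 : hit x N ω ≤ (0 : ℝ≥0) := hit_le (not_le.1 h0).le
    have h2 : cap t (hit x N ω) = 0 := by
      refine le_antisymm (WithTop.coe_le_coe.1 ((coe_cap_le _ _).trans h1)) zero_le
    rw [h2, hP.zero hX, hc]
    linarith [sq_nonneg (N : ℝ)]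

/-- The uniform approximations converge in `distQV` because the stopped quadratic variation is
dominated by a martingale, and their integrals converge in `distInf` by the first moment bound for
the maximal function. -/
lemma StepApprox.exists_isIntegral {Φ : ℕ → SimpleStrategy 𝓜.𝓕} {G : ℝ≥0 → Ω → ℝ}
    (h : 𝓜.StepApprox Φ G) {X : ℝ≥0 → Ω → EReal} (hX : 𝓜.IsMartingale X) :
    ∃ I, 𝓜.IsIntegral G X I := by
  set x := ModelFree.realPart X with hx
  have hxRM : 𝓜.RM x := hX.realPart
  obtain ⟨I, hI, -, hL2⟩ := h.exists_limit hxRM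
  obtain ⟨P, hP⟩ := hX.exists_isQuadVar
  have hN1 : ∀ N : ℕ, (1 : ℝ) ≤ ((N + 1 : ℕ) : ℝ) := fun N => by
    rw [Nat.one_le_cast]; omega
  refine ⟨fun t ω => (I t ω : EReal), fun t => measurable_coe_real_ereal.comp (hI.adapted t), ?_, P,
    Φ, hP, h.c_eq, ?_, ?_⟩
  · refine eventually_wie.1 (hI.eventually_continuousOn.mono fun p hp => ⟨fun s _ =>
      ⟨EReal.coe_ne_bot _, EReal.coe_ne_top _⟩, ?_⟩)
    exact measurable_coe_real_ereal.comp (continuousOn_iff_continuous_domRestrict.1 hp).measurable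
  · refine tendsto_tsum_geometric_mul fun j N => ?_
    obtain ⟨W, hW, hW0, hdom⟩ := hP.exists_dominating hX (N + 1)
    have hW' := ((RM.const 1).add hW).const_mul ((1 / 4 : ℝ) ^ j)
    have hpos : ∀ᶠ p in 𝓜.wie, 0 ≤ W p.1 p.2 := by
      filter_upwards [hdom, hP.nonneg hX] with p h1 h2
      exact (h2 _ (cap_le _ _)).trans h1
    refine (hW'.upperExp_le (c := (1 / 4) ^ j * (1 + ((N + 1 : ℕ) : ℝ) ^ 2))
      (hpos.mono fun p hp => by positivity) ?_ fun ω => by rw [hW0]).trans ?_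
    · filter_upwards [hdom, hP.eventually_continuousOn, hP.eventually_monotoneOn hX,
        hX.eventually_coe_realPart] with ⟨t, ω⟩ hdom hc hm hr
      simp only at hdom hc hm hr ⊢
      refine (qvDist_le hm hc (hP.zero hX ω) (ε := (1 / 4) ^ j) (by positivity)
        (fun s => h.le j s ω) fun μ hμ => ?_).trans (ENNReal.ofReal_le_ofReal ?_)
      · exact ((h.unbounded j).isStepPath t ω).integrableOn.aestronglyMeasurable.sub
          (h.aestronglyMeasurable t ω)
      · rw [cap_sigma_eq hr (N + 1)]
        exact mul_le_mul_of_nonneg_left (by linarith) (by positivity)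
    · refine ENNReal.ofReal_le_ofReal (mul_le_mul_of_nonneg_left ?_ (by positivity))
      nlinarith [hN1 N]
  · refine tendsto_tsum_geometric_mul fun j N => ?_
    have ha : (0 : ℝ) < ((N + 1 : ℕ) : ℝ) * (1 / 4) ^ j := by
      have := hN1 N
      positivity
    have hρ := hxRM.isStoppingTime_hit (N + 1 : ℕ)
    have hb := ((hL2 (N + 1) j).mono (mul_pow _ _ 2).ge).upperExp_iSup_le ha
      (((hxRM.strategy (Φ j)).stopAt hρ).sub (hI.stopAt hρ))
    refine (upperExp_mono ?_).trans (hb.trans (ENNReal.ofReal_le_ofReal ?_))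
    · filter_upwards [hX.eventually_coe_realPart] with ⟨t, ω⟩ hr
      simp only at hr ⊢
      refine iSup₂_le fun s hs => ?_
      have h1 : (s : WithTop ℝ≥0) ≤ hit x (N + 1 : ℕ) ω :=
        (le_min (WithTop.coe_le_coe.2 hs.1) hs.2).trans
          ((min_sigma_eq hr (N + 1)).trans_le (min_le_right _ _))
      refine le_trans (le_of_eq ?_) (le_iSup₂ (f := fun s (_ : s ≤ t) => ENNReal.ofReal
        |(Φ j).integral x (cap s (hit x (N + 1 : ℕ) ω)) ω - I (cap s (hit x (N + 1 : ℕ) ω)) ω|)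
        s hs.1)
      rw [cap_of_le h1, ← EReal.coe_sub, EReal.abs_def]
    · have h4 : (0 : ℝ) < (1 / 4) ^ j := by positivity
      have := hN1 N
      nlinarith [mul_le_mul_of_nonneg_left (show 5 * ((N + 1 : ℕ) : ℝ) ≤ 6 * ((N + 1 : ℕ) : ℝ) ^ 2 by
        nlinarith) h4.le]

end MartingaleSpace

end ModelFree

end

/-! ### Uniqueness of the integral and its martingale property. -/

noncomputable section
namespace ModelFree

variable {Ω : Type*} [mΩ : MeasurableSpace Ω]

lemma isCompact_Iic (t : ℝ≥0) : IsCompact (Iic t) := by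
  rw [← Icc_bot]; exact isCompact_Icc

lemma exists_subseq_tsum_ne_top {a b : ℕ → ℝ≥0∞} (ha : Tendsto a atTop (𝓝 0))
    (hb : Tendsto b atTop (𝓝 0)) :
    ∃ k : ℕ → ℕ, ∑' m, a (k m) ≠ ⊤ ∧ ∑' m, b (k m) ≠ ⊤ := by
  obtain ⟨ε, hε, hs⟩ := ENNReal.exists_pos_sum_of_countable' one_ne_zero ℕ
  have h : ∀ m, ∃ k, a k < ε m ∧ b k < ε m := fun m =>
    ((ha.eventually_lt_const (hε m)).and (hb.eventually_lt_const (hε m))).exists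
  choose k hk using h
  have hs' := (hs.trans ENNReal.one_lt_top).ne
  exact ⟨k, ne_top_of_le_ne_top hs' (ENNReal.tsum_le_tsum fun m => (hk m).1.le),
    ne_top_of_le_ne_top hs' (ENNReal.tsum_le_tsum fun m => (hk m).2.le)⟩

lemma tendsto_of_tendsto_ofReal_sqrt {a : ℕ → ℝ} (ha : ∀ m, 0 ≤ a m)
    (h : Tendsto (fun m => ENNReal.ofReal (a m) ^ (1 / 2 : ℝ)) atTop (𝓝 0)) :
    Tendsto a atTop (𝓝 0) := by
  have h1 : Tendsto (fun m => ((ENNReal.ofReal (a m) ^ (1 / 2 : ℝ)) ^ (2 : ℝ)).toReal) atTop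
      (𝓝 ((0 : ℝ≥0∞) ^ (2 : ℝ)).toReal) := by
    refine (ENNReal.tendsto_toReal ?_).comp ((ENNReal.continuous_rpow_const.tendsto _).comp h)
    simp
  rw [ENNReal.zero_rpow_of_pos two_pos, ENNReal.toReal_zero] at h1
  refine h1.congr fun m => ?_
  rw [← ENNReal.rpow_mul, one_div, inv_mul_cancel₀ two_ne_zero, ENNReal.rpow_one,
    ENNReal.toReal_ofReal (ha m)]

lemma qvDist_eq {μ : Measure ℝ≥0} {σ : Ω → WithTop ℝ≥0} {Q F G : ℝ≥0 → Ω → ℝ} {t : ℝ≥0} {ω : Ω}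
    (hμ : IsStieltjes μ (fun s => Q s ω) t)
    (hint : IntegrableOn (fun s => (F s ω - G s ω) ^ 2) (Ioc 0 t) μ) :
    qvDist σ Q F G t ω =
      ENNReal.ofReal (∫ u in Ioc 0 (cap t (σ ω)), (F u ω - G u ω) ^ 2 ∂μ) ^ (1 / 2 : ℝ) := by
  have h1 := hμ.lsIntegral_eq_of_monotone (cap_le t (σ ω)) hint
  rw [← h1.2]
  exact if_pos h1.1

namespace MartingaleSpace

variable {d : ℕ} {𝓜 : MartingaleSpace Ω d} [NeZero d]

/-- For fixed `N` the weight `2⁻⁽ᴺ⁺¹⁾` is a positive constant, so the errors at that level are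
summable on their own and Borel–Cantelli applies. -/
lemma eventually_tendsto_zero_of_tsum {Y : ℕ → ℕ → ℝ≥0 → Ω → ℝ≥0∞}
    (h : ∑' m, ∑' N : ℕ, (2 : ℝ≥0∞)⁻¹ ^ (N + 1) * 𝓜.upperExp (Y m N) ≠ ⊤) :
    ∀ᶠ p in 𝓜.wie, ∀ N, Tendsto (fun m => Y m N p.1 p.2) atTop (𝓝 0) := by
  refine eventually_wie_all.2 fun N => eventually_tendsto_zero fun hcon => h ?_
  have h1 : ∑' m, (2 : ℝ≥0∞)⁻¹ ^ (N + 1) * 𝓜.upperExp (Y m N) = ⊤ := by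
    rw [ENNReal.tsum_mul_left, hcon]
    exact ENNReal.mul_top (pow_ne_zero _ (ENNReal.inv_ne_zero.2 ENNReal.ofNat_ne_top))
  refine top_le_iff.1 (h1.ge.trans (ENNReal.tsum_le_tsum fun m => ?_))
  exact ENNReal.le_tsum (f := fun N : ℕ => (2 : ℝ≥0∞)⁻¹ ^ (N + 1) * 𝓜.upperExp (Y m N)) N

variable [hA : Fact 𝓜.AssumptionA] [hR : 𝓜.𝓕.IsRightContinuous]

lemma LocUnif.sub {y y' : ℕ → ℝ≥0 → Ω → ℝ} {z z' : ℝ≥0 → Ω → ℝ} (h : 𝓜.LocUnif y z)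
    (h' : 𝓜.LocUnif y' z') :
    𝓜.LocUnif (fun n t ω => y n t ω - y' n t ω) fun t ω => z t ω - z' t ω := by
  filter_upwards [h, h'] with p hp hp'
  exact hp.sub hp'

lemma LocUnif.mul {y y' : ℕ → ℝ≥0 → Ω → ℝ} {z z' : ℝ≥0 → Ω → ℝ} (h : 𝓜.LocUnif y z)
    (h' : 𝓜.LocUnif y' z') (hz : 𝓜.RM z) (hz' : 𝓜.RM z') :
    𝓜.LocUnif (fun n t ω => y n t ω * y' n t ω) fun t ω => z t ω * z' t ω := by
  filter_upwards [h, h', hz.eventually_continuousOn, hz'.eventually_continuousOn] with p hp hp' hc hc'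
  exact (tendstoLocallyUniformlyOn_iff_tendstoUniformlyOn_of_compact (isCompact_Iic p.1)).1
    (hp.tendstoLocallyUniformlyOn.mul₀ hp'.tendstoLocallyUniformlyOn hc hc')

lemma IsMartingale.eventually_exists_le_sigma {X : ℝ≥0 → Ω → EReal} (hX : 𝓜.IsMartingale X) :
    ∀ᶠ p in 𝓜.wie, ∃ N : ℕ, (p.1 : WithTop ℝ≥0) ≤ sigma X ((N + 1 : ℕ) : ℝ≥0∞) p.2 := by
  filter_upwards [hX.realPart.localizing_hit.2, hX.eventually_coe_realPart] with ⟨t, ω⟩ ⟨N, hN⟩ hr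
  simp only at hr hN ⊢
  refine ⟨N, min_eq_left_iff.1 ((min_sigma_eq hr (N + 1)).trans (min_eq_left ?_))⟩
  refine le_hit fun s hs => (abs_lt_of_lt_hit ((WithTop.coe_lt_coe.2 hs).trans_le hN)).trans ?_
  exact_mod_cast Nat.lt_succ_self N

/-- Every version of the integral is a limit, locally uniformly w.i.e., of simple integrals whose
step processes converge to the integrand. -/
lemma IsIntegral.exists_locUnif {G : ℝ≥0 → Ω → ℝ} {X I : ℝ≥0 → Ω → EReal}
    (hX : 𝓜.IsMartingale X) (hI : 𝓜.IsIntegral G X I) :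
    ∃ (Q : ℝ≥0 → Ω → ℝ) (Θ : ℕ → SimpleStrategy 𝓜.𝓕), 𝓜.IsQuadVar X Q ∧ (∀ m, (Θ m).c = 0) ∧
      (∀ m, (Θ m).Unbounded) ∧ 𝓜.LocUnif (fun m => (Θ m).integral (ModelFree.realPart X))
        (ModelFree.realPart I) ∧ (∀ᶠ p in 𝓜.wie, ∀ s ≤ p.1, (ModelFree.realPart I s p.2 : EReal) = I s p.2) ∧
      ∀ᶠ p in 𝓜.wie, ∃ σ : Ω → WithTop ℝ≥0, (p.1 : WithTop ℝ≥0) ≤ σ p.2 ∧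
        Tendsto (fun m => qvDist σ Q (Θ m).step G p.1 p.2) atTop (𝓝 0) := by
  obtain ⟨-, hmem, Q, Φ, hQ, hc, hQV, hInf⟩ := hI
  -- Convergence of the distances gives no pathwise convergence; indices with summable distances do.
  -- They need not be increasing.
  obtain ⟨k, hk1, hk2⟩ := exists_subseq_tsum_ne_top hQV hInf
  have hstep : ∀ m, (Φ (k m)).normalize.step = (Φ (k m)).step := fun m =>
    funext fun t => funext fun ω => SimpleStrategy.normalize_step _ t ω
  have hint : ∀ m, (Φ (k m)).normalize.integral (ModelFree.realPart X) =
      (Φ (k m)).integral (ModelFree.realPart X) := fun m =>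
    funext fun t => funext fun ω => SimpleStrategy.normalize_integral _ _ t ω
  have hreal : ∀ᶠ p in 𝓜.wie, ∀ s ≤ p.1, (ModelFree.realPart I s p.2 : EReal) = I s p.2 := by
    have h1 : ∀ᶠ p in 𝓜.wie, _ := hmem
    filter_upwards [h1] with p hp s hs
    exact EReal.coe_toReal (hp.1 s hs).2 (hp.1 s hs).1
  refine ⟨Q, fun m => (Φ (k m)).normalize, hQ, fun m => hc (k m),
    fun m => SimpleStrategy.normalize_unbounded _, ?_, hreal, ?_⟩
  · simp only [hint]
    filter_upwards [eventually_tendsto_zero_of_tsum hk2, hreal, hX.eventually_exists_le_sigma] with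
      ⟨t, ω⟩ h1 h2 ⟨N, hN⟩
    simp only at h1 h2 hN ⊢
    refine tendsto_iSup_abs_iff.1 ((h1 N).congr fun m => ?_)
    refine iSup_congr fun s => ?_
    refine (iSup_congr_Prop (q := s ≤ t) ⟨fun hs => hs.1, fun hs =>
      ⟨hs, (WithTop.coe_le_coe.2 hs).trans hN⟩⟩ fun _ => rfl).trans (iSup_congr fun hs => ?_)
    rw [← h2 s hs, ← EReal.coe_sub, ← EReal.coe_sub, EReal.abs_def, EReal.abs_def, abs_sub_comm]
  · simp only [hstep]
    filter_upwards [eventually_tendsto_zero_of_tsum hk1, hX.eventually_exists_le_sigma] with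
      p h1 ⟨N, hN⟩
    exact ⟨_, hN, h1 N⟩

/-- The defining simple integrals are martingales, and a suitable sequence of them converges locally
uniformly w.i.e. -/
lemma IsIntegral.isMartingale {G : ℝ≥0 → Ω → ℝ} {X I : ℝ≥0 → Ω → EReal}
    (hX : 𝓜.IsMartingale X) (hI : 𝓜.IsIntegral G X I) : 𝓜.IsMartingale I := by
  obtain ⟨Q, Θ, -, -, -, h, hr, -⟩ := hI.exists_locUnif hX
  exact (RM.of_locUnif (fun m => hX.realPart.strategy (Θ m)) h).isMartingale hI.1
    (hr.mono fun p hp s hs => (hp s hs).symm)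

/-- All versions of the integral agree with the limit along a uniform approximation. -/
lemma StepApprox.locUnif {Φ : ℕ → SimpleStrategy 𝓜.𝓕} {G : ℝ≥0 → Ω → ℝ} (h : 𝓜.StepApprox Φ G)
    {X I : ℝ≥0 → Ω → EReal} (hX : 𝓜.IsMartingale X) (hI : 𝓜.IsIntegral G X I) :
    𝓜.LocUnif (fun j => (Φ j).integral (ModelFree.realPart X)) (ModelFree.realPart I) := by
  obtain ⟨Q, Θ, hQ, hc, hub, hΘ, -, hqv⟩ := hI.exists_locUnif hX
  set x := ModelFree.realPart X with hx
  have hxRM : 𝓜.RM x := hX.realPart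
  have hIRM : 𝓜.RM (ModelFree.realPart I) := (hI.isMartingale hX).realPart
  obtain ⟨J, hJ, hJu, -⟩ := h.exists_limit hxRM
  -- The discrepancy of the two versions is the limit of the simple integrals of `Λ m = Θ m - Φ m`,
  -- step processes that become small in the quadratic variation sense only.
  set z : ℝ≥0 → Ω → ℝ := fun t ω => ModelFree.realPart I t ω - J t ω with hz
  have hzRM : 𝓜.RM z := hIRM.sub hJ
  set Λ : ℕ → SimpleStrategy 𝓜.𝓕 := fun m => ((Θ m).sub (Φ m)).normalize with hΛ
  have hΛc : ∀ m, (Λ m).c = 0 := fun m => by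
    have : (Λ m).c = ((Θ m).sub (Φ m)).c := rfl
    rw [this, SimpleStrategy.sub_c, hc, h.c_eq, sub_zero]
  have hΛub : ∀ m, (Λ m).Unbounded := fun m => SimpleStrategy.normalize_unbounded _
  have hΛint : ∀ m t ω, (Λ m).integral x t ω = (Θ m).integral x t ω - (Φ m).integral x t ω :=
    fun m t ω => by
      rw [hΛ, SimpleStrategy.normalize_integral, SimpleStrategy.sub_integral]
  have hΛstep : ∀ m t ω, (Λ m).step t ω = (Θ m).step t ω - (Φ m).step t ω := fun m t ω => by
    rw [hΛ, SimpleStrategy.normalize_step, SimpleStrategy.sub_step]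
  have hlim : 𝓜.LocUnif (fun m => (Λ m).integral x) z := by
    filter_upwards [hΘ.sub hJu] with p hp
    simp only [hΛint]
    exact hp
  have hz0 : ∀ ω, z 0 ω = 0 := fun ω => by
    have h1 := (eventually_wie_zero hlim ω).tendsto_at (mem_Iic.2 le_rfl)
    simp only [SimpleStrategy.integral_zero_time, hΛc] at h1
    exact tendsto_nhds_unique h1 tendsto_const_nhds
  have hsq : 𝓜.RM fun t ω => x t ω * x t ω - Q t ω :=
    (hQ.sq_sub_RM hX).congr (Eventually.of_forall fun p s _ => by rw [hx, pow_two])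
  -- `∫ Λ² d[X] → 0` pathwise, from `Λ² ≤ 2 (Θ - G)² + 2 (Φ - G)²`: the first term is controlled by
  -- the distance, the second by uniform approximation.
  have hA : 𝓜.LocUnif (fun m t ω => ∑' n, (Λ m).g n ω * (Λ m).g n ω *
      (Q (cap t ((Λ m).τ (n + 1) ω)) ω - Q (cap t ((Λ m).τ n ω)) ω)) fun _ _ => 0 := by
    filter_upwards [hqv, hQ.eventually_continuousOn, hQ.eventually_monotoneOn hX] with
      ⟨t, ω⟩ ⟨σ, hσ, hqv⟩ hcont hmono
    simp only at hσ hqv hcont hmono ⊢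
    obtain ⟨μ, hμ⟩ := exists_isStieltjes hmono hcont
    have := hμ.finite
    have hθ : ∀ m, IsStepPath (fun n => (Λ m).τ n ω)
        (fun n => (Λ m).g n ω * (Λ m).g n ω) (fun s => (Λ m).step s ω * (Λ m).step s ω) t := fun m =>
      ((hΛub m).isStepPath t ω).mul ((hΛub m).isStepPath t ω)
    have he : ∀ m, AEStronglyMeasurable (fun s => (Φ m).step s ω - G s ω) (μ.restrict (Ioc 0 t)) :=
      fun m => ((h.unbounded m).isStepPath t ω).integrableOn.aestronglyMeasurable.sub
        (h.aestronglyMeasurable t ω)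
    have he2 : ∀ m s, |((Φ m).step s ω - G s ω) ^ 2| ≤ ((1 / 4) ^ m) ^ 2 := fun m s => by
      rw [abs_pow]; exact pow_le_pow_left₀ (abs_nonneg _) (h.le m s ω) 2
    have he2i : ∀ m, IntegrableOn (fun s => ((Φ m).step s ω - G s ω) ^ 2) (Ioc 0 t) μ := fun m =>
      Integrable.of_bound ((he m).pow 2) _ (Eventually.of_forall fun s =>
        (Real.norm_eq_abs _).trans_le (he2 m s))
    -- Integrability must precede the reading of `qvDist` as an integral. It follows from `Θ - G = Λ
    -- + (Φ - G)`, a step path plus a bounded error.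
    have hi : ∀ m, IntegrableOn (fun s => ((Θ m).step s ω - G s ω) ^ 2) (Ioc 0 t) μ := by
      intro m
      have h1 : IntegrableOn (fun s => (Λ m).step s ω * ((Φ m).step s ω - G s ω)) (Ioc 0 t) μ := by
        refine (((hΛub m).isStepPath t ω).integrableOn.norm.mul_const ((1 / 4) ^ m)).mono'
          (((hΛub m).isStepPath t ω).integrableOn.aestronglyMeasurable.mul (he m))
          (Eventually.of_forall fun s => ?_)
        rw [norm_mul]
        exact mul_le_mul_of_nonneg_left ((Real.norm_eq_abs _).trans_le (h.le m s ω)) (norm_nonneg _)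
      refine (((hθ m).integrableOn.add (h1.const_mul 2)).add (he2i m)).congr
        (Eventually.of_forall fun s => ?_)
      simp only [Pi.add_apply, hΛstep]
      ring
    have hai : Tendsto (fun m => ∫ s in Ioc 0 t, ((Θ m).step s ω - G s ω) ^ 2 ∂μ) atTop (𝓝 0) := by
      refine tendsto_of_tendsto_ofReal_sqrt (fun m => integral_nonneg fun s => sq_nonneg _) ?_
      refine hqv.congr fun m => ?_
      rw [qvDist_eq hμ (hi m), cap_of_le hσ]
    have hlim2 : Tendsto (fun m : ℕ => 2 * (∫ s in Ioc 0 t, ((Θ m).step s ω - G s ω) ^ 2 ∂μ) +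
        2 * (((1 / 4 : ℝ) ^ m) ^ 2 * (Q t ω - Q 0 ω))) atTop
        (𝓝 (2 * 0 + 2 * (0 ^ 2 * (Q t ω - Q 0 ω)))) :=
      (hai.const_mul 2).add (((tendsto_quarter_pow.pow 2).mul_const _).const_mul 2)
    simp only [ne_eq, OfNat.ofNat_ne_zero, not_false_eq_true, zero_pow, mul_zero, zero_mul,
      add_zero] at hlim2
    have key : ∀ m, ∀ s ≤ t, |∑' n, (Λ m).g n ω * (Λ m).g n ω *
        (Q (cap s ((Λ m).τ (n + 1) ω)) ω - Q (cap s ((Λ m).τ n ω)) ω)| ≤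
        2 * (∫ s in Ioc 0 t, ((Θ m).step s ω - G s ω) ^ 2 ∂μ) +
          2 * (((1 / 4 : ℝ) ^ m) ^ 2 * (Q t ω - Q 0 ω)) := by
      intro m s hs
      rw [← hμ.integral_step (hθ m) hs, abs_of_nonneg (integral_nonneg fun u => mul_self_nonneg _)]
      have h1 := (le_abs_self _).trans (hμ.abs_setIntegral_le (a := 0) zero_le le_rfl
        fun u _ => he2 m u)
      calc _ ≤ ∫ u in Ioc 0 t, (Λ m).step u ω * (Λ m).step u ω ∂μ :=
            setIntegral_mono_set (hθ m).integrableOn (Eventually.of_forall fun u =>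
              mul_self_nonneg _) (Eventually.of_forall (Ioc_subset_Ioc_right hs))
        _ ≤ ∫ u in Ioc 0 t, (2 * ((Θ m).step u ω - G u ω) ^ 2 +
              2 * ((Φ m).step u ω - G u ω) ^ 2) ∂μ := by
            refine integral_mono (hθ m).integrableOn
              (((hi m).const_mul 2).add ((he2i m).const_mul 2)) fun u => ?_
            simp only [hΛstep]
            nlinarith [sq_nonneg ((Θ m).step u ω - G u ω + ((Φ m).step u ω - G u ω))]
        _ ≤ _ := by
            rw [integral_add ((hi m).const_mul 2) ((he2i m).const_mul 2), integral_const_mul,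
              integral_const_mul]
            linarith
    rw [Metric.tendstoUniformlyOn_iff]
    intro ε hε
    filter_upwards [hlim2.eventually_lt_const hε] with m hm s hs
    rw [dist_comm, Real.dist_eq, sub_zero]
    exact (key m s hs).trans_lt hm
  -- The martingales `(Λ·x)² - ∫ Λ² d[X]` converge to `z²`, whose compensator has disappeared.
  have hz2 : 𝓜.RM fun t ω => z t ω ^ 2 := by
    refine (RM.of_locUnif (fun m => hxRM.integral_mul_sub hxRM hsq (hΛub m) (fun _ => rfl) (hΛc m))
      ((hlim.mul hlim hzRM hzRM).sub hA)).congr (Eventually.of_forall fun p s _ => ?_)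
    rw [sub_zero, pow_two]
  filter_upwards [hJu, hzRM.eventually_eq_zero_of_sq hz2 hz0] with p h1 h2
  refine h1.congr_right fun s hs => ?_
  exact (sub_eq_zero.1 (h2 s hs)).symm

end MartingaleSpace

end ModelFree

end

/-! ### Covariation of two integrals. -/

noncomputable section
namespace ModelFree

variable {Ω : Type*} [mΩ : MeasurableSpace Ω]

lemma IsStieltjes.integral_step_sub {μ ν : Measure ℝ≥0} {p n q : ℝ≥0 → ℝ} {s t : ℝ≥0}
    (hμ : IsStieltjes μ p t) (hν : IsStieltjes ν n t) (hq : ∀ u ≤ t, q u = p u - n u) (hs : s ≤ t)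
    {τ : ℕ → WithTop ℝ≥0} {g : ℕ → ℝ} {f : ℝ≥0 → ℝ} (hf : IsStepPath τ g f t) :
    (∫ u in Ioc 0 s, f u ∂μ) - ∫ u in Ioc 0 s, f u ∂ν =
      ∑' k, g k * (q (cap s (τ (k + 1))) - q (cap s (τ k))) := by
  obtain ⟨K, hK⟩ := exists_forall_lt_of_finite hf.finite
  rw [hμ.integral_step hf hs, hν.integral_step hf hs, tsum_increments_eq_sum hf.monotone hK hs g p,
    tsum_increments_eq_sum hf.monotone hK hs g n, tsum_increments_eq_sum hf.monotone hK hs g q,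
    ← Finset.sum_sub_distrib]
  refine Finset.sum_congr rfl fun k _ => ?_
  rw [hq _ ((cap_le _ _).trans hs), hq _ ((cap_le _ _).trans hs)]
  ring

namespace MartingaleSpace

variable {d : ℕ} {𝓜 : MartingaleSpace Ω d} [NeZero d] [hA : Fact 𝓜.AssumptionA]
  [hR : 𝓜.𝓕.IsRightContinuous]

variable {X Y : ℝ≥0 → Ω → EReal} {C : ℝ≥0 → Ω → ℝ}

/-! ### Covariation -/

lemma IsMartingale.add (hX : 𝓜.IsMartingale X) (hY : 𝓜.IsMartingale Y) :
    𝓜.IsMartingale fun t ω => X t ω + Y t ω := by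
  refine (hX.realPart.add hY.realPart).isMartingale
    (fun t => (hX.adapted t).add (hY.adapted t)) ?_
  filter_upwards [hX.eventually_coe_realPart, hY.eventually_coe_realPart] with p h1 h2 s hs
  rw [EReal.coe_add, h1 s hs, h2 s hs]

lemma IsMartingale.sub (hX : 𝓜.IsMartingale X) (hY : 𝓜.IsMartingale Y) :
    𝓜.IsMartingale fun t ω => X t ω - Y t ω := by
  refine (hX.realPart.sub hY.realPart).isMartingale (fun t => ?_) ?_
  · exact (hX.adapted t).add (continuous_neg.measurable.comp (hY.adapted t))
  filter_upwards [hX.eventually_coe_realPart, hY.eventually_coe_realPart] with p h1 h2 s hs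
  rw [EReal.coe_sub, h1 s hs, h2 s hs]

lemma IsMartingale.exists_isQuadCovar (hX : 𝓜.IsMartingale X) (hY : 𝓜.IsMartingale Y) :
    ∃ C, 𝓜.IsQuadCovar X Y C := by
  obtain ⟨P, hP⟩ := (hX.add hY).exists_isQuadVar
  obtain ⟨N, hN⟩ := (hX.sub hY).exists_isQuadVar
  exact ⟨_, P, N, hP, hN, fun _ _ => rfl⟩

/-- The covariation is a difference of continuous nondecreasing processes. -/
lemma IsQuadCovar.exists_eq_sub (hX : 𝓜.IsMartingale X) (hY : 𝓜.IsMartingale Y)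
    (hC : 𝓜.IsQuadCovar X Y C) : ∃ P N : ℝ≥0 → Ω → ℝ, (∀ t ω, C t ω = P t ω - N t ω) ∧
      (∀ ω, P 0 ω = 0) ∧ (∀ ω, N 0 ω = 0) ∧
      (∀ᶠ p in 𝓜.wie, MonotoneOn (fun s => P s p.2) (Iic p.1)) ∧
      (∀ᶠ p in 𝓜.wie, ContinuousOn (fun s => P s p.2) (Iic p.1)) ∧
      (∀ᶠ p in 𝓜.wie, MonotoneOn (fun s => N s p.2) (Iic p.1)) ∧
      ∀ᶠ p in 𝓜.wie, ContinuousOn (fun s => N s p.2) (Iic p.1) := by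
  obtain ⟨P, N, hP, hN, e⟩ := hC
  refine ⟨fun t ω => 1 / 4 * P t ω, fun t ω => 1 / 4 * N t ω, e, fun ω => ?_, fun ω => ?_,
    (hP.eventually_monotoneOn (hX.add hY)).mono fun p hp a ha b hb h =>
      mul_le_mul_of_nonneg_left (hp ha hb h) (by norm_num),
    hP.eventually_continuousOn.mono fun p hp => continuousOn_const.mul hp,
    (hN.eventually_monotoneOn (hX.sub hY)).mono fun p hp a ha b hb h =>
      mul_le_mul_of_nonneg_left (hp ha hb h) (by norm_num),
    hN.eventually_continuousOn.mono fun p hp => continuousOn_const.mul hp⟩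
  · change 1 / 4 * P 0 ω = 0
    rw [hP.zero (hX.add hY), mul_zero]
  · change 1 / 4 * N 0 ω = 0
    rw [hN.zero (hX.sub hY), mul_zero]

/-- Polarization: `4 x y = (x + y)² - (x - y)²`, applied to the compensated squares of the sum and
the difference. -/
lemma IsQuadCovar.mul_sub_RM (hX : 𝓜.IsMartingale X) (hY : 𝓜.IsMartingale Y)
    (hC : 𝓜.IsQuadCovar X Y C) :
    𝓜.RM fun t ω => ModelFree.realPart X t ω * ModelFree.realPart Y t ω - C t ω := by
  obtain ⟨P, N, hP, hN, e⟩ := hC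
  refine (((hP.sq_sub_RM (hX.add hY)).const_mul (1 / 4)).sub
    ((hN.sq_sub_RM (hX.sub hY)).const_mul (1 / 4))).congr ?_
  filter_upwards [hX.eventually_coe_realPart, hY.eventually_coe_realPart] with p h1 h2 s hs
  have e1 : ModelFree.realPart (fun t ω => X t ω + Y t ω) s p.2 =
      ModelFree.realPart X s p.2 + ModelFree.realPart Y s p.2 := by
    rw [ModelFree.realPart, ← h1 s hs, ← h2 s hs, ← EReal.coe_add, EReal.toReal_coe]
  have e2 : ModelFree.realPart (fun t ω => X t ω - Y t ω) s p.2 =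
      ModelFree.realPart X s p.2 - ModelFree.realPart Y s p.2 := by
    rw [ModelFree.realPart, ← h1 s hs, ← h2 s hs, ← EReal.coe_sub, EReal.toReal_coe]
  rw [e1, e2, e]
  ring

/-! ### The covariation of two integrals -/

lemma abs_mul_sub_mul_le {a b a' b' ε K L : ℝ} (ha : |a' - a| ≤ ε) (hb : |b' - b| ≤ ε)
    (hε : ε ≤ 1) (hK : |a| ≤ K) (hL : |b| ≤ L) : |a' * b' - a * b| ≤ ε * (K + L + 1) := by
  have h0 := (abs_nonneg _).trans ha
  have e : a' * b' - a * b = (a' - a) * (b' - b) + (a' - a) * b + a * (b' - b) := by ring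
  rw [e]
  refine (abs_add_three _ _ _).trans ?_
  rw [abs_mul, abs_mul, abs_mul]
  nlinarith [mul_le_mul ha hb (abs_nonneg _) h0, mul_le_mul ha hL (abs_nonneg _) h0,
    mul_le_mul hK hb (abs_nonneg _) ((abs_nonneg _).trans hK)]

variable {G H : ℝ≥0 → Ω → ℝ} {Φ Ψ : ℕ → SimpleStrategy 𝓜.𝓕}

lemma StepApprox.integrableOn_mul (hΦ : 𝓜.StepApprox Φ G) (hΨ : 𝓜.StepApprox Ψ H) {K L : ℝ}
    (hK : ∀ t ω, |G t ω| ≤ K) (hL : ∀ t ω, |H t ω| ≤ L) (t : ℝ≥0) (ω : Ω) {μ : Measure ℝ≥0}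
    [IsFiniteMeasure μ] : IntegrableOn (fun s => G s ω * H s ω) (Ioc 0 t) μ :=
  Integrable.of_bound ((hΦ.aestronglyMeasurable t ω).mul (hΨ.aestronglyMeasurable t ω)) (K * L)
    (Eventually.of_forall fun s => by
      rw [norm_mul]
      exact mul_le_mul (hK s ω) (hL s ω) (norm_nonneg _) ((abs_nonneg _).trans (hK s ω)))

lemma StepApprox.abs_setIntegral_sub_le (hΦ : 𝓜.StepApprox Φ G) (hΨ : 𝓜.StepApprox Ψ H)
    (hτ : ∀ j n, (Ψ j).τ n = (Φ j).τ n) {K L : ℝ}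
    (hK : ∀ t ω, |G t ω| ≤ K) (hL : ∀ t ω, |H t ω| ≤ L) {s t : ℝ≥0} (hs : s ≤ t) (ω : Ω)
    {μ : Measure ℝ≥0} {p : ℝ≥0 → ℝ} (hμ : IsStieltjes μ p t) (j : ℕ) :
    |(∫ u in Ioc 0 s, (Φ j).step u ω * (Ψ j).step u ω ∂μ) - ∫ u in Ioc 0 s, G u ω * H u ω ∂μ| ≤
      (1 / 4) ^ j * (K + L + 1) * (p t - p 0) := by
  have := hμ.finite
  have hK0 := (abs_nonneg _).trans (hK 0 ω)
  have hL0 := (abs_nonneg _).trans (hL 0 ω)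
  have h1 : IsStepPath (fun n => (Φ j).τ n ω) (fun n => (Φ j).g n ω * (Ψ j).g n ω)
      (fun u => (Φ j).step u ω * (Ψ j).step u ω) t := by
    have := (hΨ.unbounded j).isStepPath t ω
    simp only [hτ] at this
    exact ((hΦ.unbounded j).isStepPath t ω).mul this
  rw [← integral_sub (h1.integrableOn.mono_set (Ioc_subset_Ioc_right hs))
    ((hΦ.integrableOn_mul hΨ hK hL t ω).mono_set (Ioc_subset_Ioc_right hs))]
  refine (hμ.abs_setIntegral_le zero_le hs fun u _ => abs_mul_sub_mul_le (hΦ.le j u ω)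
    (hΨ.le j u ω) (pow_le_one₀ (by norm_num) (by norm_num)) (hK u ω) (hL u ω)).trans ?_
  exact mul_le_mul_of_nonneg_left (sub_le_sub_right (hμ.monotoneOn hs (mem_Iic.2 le_rfl) hs) _)
    (by positivity)

/-- Integration by parts for the simple integrals passes to the limit. The products converge since
the limits have continuous paths, and the compensators converge since the integrands do so uniformly
and `C` has finite variation. -/
lemma StepApprox.mul_sub_lsIntegral_RM (hX : 𝓜.IsMartingale X) (hY : 𝓜.IsMartingale Y)
    (hC : 𝓜.IsQuadCovar X Y C) (hΦ : 𝓜.StepApprox Φ G) (hΨ : 𝓜.StepApprox Ψ H)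
    (hτ : ∀ j n, (Ψ j).τ n = (Φ j).τ n) {K L : ℝ}
    (hK : ∀ t ω, |G t ω| ≤ K) (hL : ∀ t ω, |H t ω| ≤ L) {I J : ℝ≥0 → Ω → EReal}
    (hI : 𝓜.IsIntegral G X I) (hJ : 𝓜.IsIntegral H Y J) :
    𝓜.RM fun t ω => ModelFree.realPart I t ω * ModelFree.realPart J t ω -
      lsIntegral (fun s => G s ω * H s ω) (fun s => C s ω) t := by
  obtain ⟨P, N, hPN, -, -, hPm, hPc, hNm, hNc⟩ := hC.exists_eq_sub hX hY
  refine RM.of_locUnif (fun j => hX.realPart.integral_mul_sub hY.realPart (hC.mul_sub_RM hX hY)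
    (hΦ.unbounded j) (hτ j) (hΦ.c_eq j)) (LocUnif.sub ((hΦ.locUnif hX hI).mul (hΨ.locUnif hY hJ)
      (hI.isMartingale hX).realPart (hJ.isMartingale hY).realPart) ?_)
  filter_upwards [hPm, hPc, hNm, hNc] with ⟨t, ω⟩ hPm hPc hNm hNc
  simp only at hPm hPc hNm hNc ⊢
  obtain ⟨μ, hμ⟩ := exists_isStieltjes hPm hPc
  obtain ⟨ν, hν⟩ := exists_isStieltjes hNm hNc
  have := hμ.finite
  have := hν.finite
  have hstep : ∀ j, IsStepPath (fun n => (Φ j).τ n ω) (fun n => (Φ j).g n ω * (Ψ j).g n ω)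
      (fun u => (Φ j).step u ω * (Ψ j).step u ω) t := fun j => by
    have := (hΨ.unbounded j).isStepPath t ω
    simp only [hτ] at this
    exact ((hΦ.unbounded j).isStepPath t ω).mul this
  have hlim := (tendsto_quarter_pow.mul_const (K + L + 1)).mul_const
    ((P t ω - P 0 ω) + (N t ω - N 0 ω))
  rw [zero_mul, zero_mul] at hlim
  rw [Metric.tendstoUniformlyOn_iff]
  intro ε hε
  filter_upwards [hlim.eventually_lt_const hε] with j hj s hs
  rw [dist_comm, Real.dist_eq, ← hμ.integral_step_sub hν (fun u _ => hPN u ω) hs (hstep j),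
    (hμ.lsIntegral_eq hν (fun u _ => hPN u ω) hs (hΦ.integrableOn_mul hΨ hK hL t ω)
      (hΦ.integrableOn_mul hΨ hK hL t ω)).2, sub_sub_sub_comm]
  refine lt_of_le_of_lt ((abs_sub _ _).trans (add_le_add
    (hΦ.abs_setIntegral_sub_le hΨ hτ hK hL hs ω hμ j)
    (hΦ.abs_setIntegral_sub_le hΨ hτ hK hL hs ω hν j))) ?_
  rw [← mul_add]
  exact hj

/-- The covariation of two integrals is the Lebesgue–Stieltjes integral of the product. -/
lemma StepApprox.covariation_eq (hX : 𝓜.IsMartingale X) (hY : 𝓜.IsMartingale Y)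
    (hC : 𝓜.IsQuadCovar X Y C) (hΦ : 𝓜.StepApprox Φ G) (hΨ : 𝓜.StepApprox Ψ H)
    (hτ : ∀ j n, (Ψ j).τ n = (Φ j).τ n) {K L : ℝ}
    (hK : ∀ t ω, |G t ω| ≤ K) (hL : ∀ t ω, |H t ω| ≤ L) {I J : ℝ≥0 → Ω → EReal}
    (hI : 𝓜.IsIntegral G X I) (hJ : 𝓜.IsIntegral H Y J) {D : ℝ≥0 → Ω → ℝ}
    (hD : 𝓜.IsQuadCovar I J D) :
    ∀ᶠ p in 𝓜.wie, LSIntegrable (fun s => G s p.2 * H s p.2) (fun s => C s p.2) p.1 ∧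
      D p.1 p.2 = lsIntegral (fun s => G s p.2 * H s p.2) (fun s => C s p.2) p.1 := by
  have hIM := hI.isMartingale hX
  have hJM := hJ.isMartingale hY
  obtain ⟨P, N, hPN, hP0, hN0, hPm, hPc, hNm, hNc⟩ := hC.exists_eq_sub hX hY
  obtain ⟨P', N', hPN', hP0', hN0', hPm', -, hNm', -⟩ := hD.exists_eq_sub hIM hJM
  set A : ℝ≥0 → Ω → ℝ := fun t ω => lsIntegral (fun s => G s ω * H s ω) (fun s => C s ω) t with hAdef
  -- Both `I J - A` and `I J - D` are martingales, so the product `I J` cancels.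
  have hz : 𝓜.RM fun t ω => D t ω - A t ω :=
    ((hΦ.mul_sub_lsIntegral_RM hX hY hC hΨ hτ hK hL hI hJ).sub (hD.mul_sub_RM hIM hJM)).congr
      (Eventually.of_forall fun p s _ => by rw [hAdef]; ring)
  have key : ∀ᶠ p in 𝓜.wie, ∃ μ ν, IsStieltjes μ (fun s => P s p.2) p.1 ∧
      IsStieltjes ν (fun s => N s p.2) p.1 ∧ ∀ s ≤ p.1,
        LSIntegrable (fun s => G s p.2 * H s p.2) (fun s => C s p.2) s ∧
        A s p.2 = (∫ u in Ioc 0 s, G u p.2 * H u p.2 ∂μ) - ∫ u in Ioc 0 s, G u p.2 * H u p.2 ∂ν := by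
    filter_upwards [hPm, hPc, hNm, hNc] with ⟨t, ω⟩ hPm hPc hNm hNc
    obtain ⟨μ, hμ⟩ := exists_isStieltjes hPm hPc
    obtain ⟨ν, hν⟩ := exists_isStieltjes hNm hNc
    have := hμ.finite
    have := hν.finite
    exact ⟨μ, ν, hμ, hν, fun s hs => hμ.lsIntegral_eq hν (fun u _ => hPN u ω) hs
      (hΦ.integrableOn_mul hΨ hK hL t ω) (hΦ.integrableOn_mul hΨ hK hL t ω)⟩
  have hz0 : ∀ ω, D 0 ω - A 0 ω = 0 := fun ω => by
    obtain ⟨μ, ν, -, -, h⟩ := eventually_wie_zero key ω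
    rw [(h 0 le_rfl).2, hPN', hP0', hN0', Ioc_self]
    simp
  -- The increments of `D` are controlled by those of `P' + N'`, and those of `A` by `K L` times
  -- those of `P + N`, as `|G H| ≤ K L`.
  have hzero := hz.eventually_eq_zero_of_variation (B := fun t ω => P' t ω + N' t ω +
    K * L * (P t ω + N t ω)) hz0 (by
      filter_upwards [key, hPm', hNm'] with ⟨t, ω⟩ ⟨μ, ν, hμ, hν, h⟩ hPm' hNm' s s' hss hs'
      simp only at hμ hν h hPm' hNm' hs' ⊢
      have := hμ.finite
      have := hν.finite
      have hGH : ∀ u, |G u ω * H u ω| ≤ K * L := fun u => by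
        rw [abs_mul]
        exact mul_le_mul (hK u ω) (hL u ω) (abs_nonneg _) ((abs_nonneg _).trans (hK u ω))
      have e : A s' ω - A s ω = (∫ u in Ioc s s', G u ω * H u ω ∂μ) -
          ∫ u in Ioc s s', G u ω * H u ω ∂ν := by
        rw [(h s' hs').2, (h s (hss.trans hs')).2,
          ← hμ.setIntegral_sub hss hs' (hΦ.integrableOn_mul hΨ hK hL t ω),
          ← hν.setIntegral_sub hss hs' (hΦ.integrableOn_mul hΨ hK hL t ω)]
        ring
      have h1 := abs_le.1 (hμ.abs_setIntegral_le hss hs' fun u _ => hGH u)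
      have h2 := abs_le.1 (hν.abs_setIntegral_le hss hs' fun u _ => hGH u)
      have h3 := hPm' (hss.trans hs') hs' hss
      have h4 := hNm' (hss.trans hs') hs' hss
      simp only at h3 h4
      rw [show D s' ω - A s' ω - (D s ω - A s ω) = (P' s' ω - P' s ω) - (N' s' ω - N' s ω) -
        (A s' ω - A s ω) by rw [hPN', hPN']; ring, e, abs_le]
      constructor <;> linarith [h1.1, h1.2, h2.1, h2.2])
  filter_upwards [key, hzero] with p h1 h2
  obtain ⟨μ, ν, _, _, h⟩ := h1
  exact ⟨(h p.1 le_rfl).1, sub_eq_zero.1 (h2 p.1 le_rfl)⟩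

end MartingaleSpace

end ModelFree

end

theorem mainTheorem8 {Ω : Type*} [MeasurableSpace Ω] {d : ℕ} (hd : 0 < d)
    (𝓜 : ModelFree.MartingaleSpace Ω d) (hA : 𝓜.AssumptionA)
    (hrc : 𝓜.𝓕.IsRightContinuous)
    (G H : ℝ≥0 → Ω → ℝ) (hG : Adapted 𝓜.𝓕 G) (hH : Adapted 𝓜.𝓕 H)
    (hGc : ∀ ω, ModelFree.IsCadlag fun t => G t ω) (hHc : ∀ ω, ModelFree.IsCadlag fun t => H t ω)
    (hGb : ∃ K : ℝ, ∀ t ω, |G t ω| ≤ K) (hHb : ∃ K : ℝ, ∀ t ω, |H t ω| ≤ K)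
    (X Y : ℝ≥0 → Ω → EReal) (hX : 𝓜.IsMartingale X) (hY : 𝓜.IsMartingale Y) :
    (∃ I, 𝓜.IsIntegral G X I) ∧ (∃ J, 𝓜.IsIntegral H Y J) ∧ (∃ C, 𝓜.IsQuadCovar X Y C) ∧
      ∀ I J, 𝓜.IsIntegral G X I → 𝓜.IsIntegral H Y J →
        𝓜.IsMartingale I ∧ 𝓜.IsMartingale J ∧ (∃ D, 𝓜.IsQuadCovar I J D) ∧
          ∀ C D, 𝓜.IsQuadCovar X Y C → 𝓜.IsQuadCovar I J D →
            𝓜.Wie {p | ModelFree.LSIntegrable (fun s => G s p.2 * H s p.2) (fun s => C s p.2) p.1 ∧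
              D p.1 p.2 =
                ModelFree.lsIntegral (fun s => G s p.2 * H s p.2) (fun s => C s p.2) p.1} := by
  have : NeZero d := ⟨hd.ne'⟩
  have : Fact 𝓜.AssumptionA := ⟨hA⟩
  have := hrc
  obtain ⟨Φ, Ψ, hΦ, hΨ, hτ⟩ := ModelFree.MartingaleSpace.exists_stepApprox hG hH hGc hHc hGb hHb
  refine ⟨hΦ.exists_isIntegral hX, hΨ.exists_isIntegral hY, hX.exists_isQuadCovar hY,
    fun I J hI hJ => ⟨hI.isMartingale hX, hJ.isMartingale hY,
      (hI.isMartingale hX).exists_isQuadCovar (hJ.isMartingale hY), fun C D hC hD => ?_⟩⟩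
  obtain ⟨K, hK⟩ := hGb
  obtain ⟨L, hL⟩ := hHb
  exact hΦ.covariation_eq hX hY hC hΨ hτ hK hL hI hJ hD
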